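/- **Setting.** Let $R_0$ be an irreducible reduced crystallographic root system in a Euclidean space $(V_0,\langle\cdot,\cdot\rangle)$, scaled so that long roots have squared length $2$; put $\alpha^\vee=2\alpha/\|\alpha\|^2$. Let $W_0$ be its Weyl group with length function $l$, $\alpha_1,\dots,\alpha_n$ a basis of $R_0$ with simple reflections $s_1,\dots,s_n$, $R_0^+$ the positive roots, $\varphi$ the highest root, $w_0\in W_0$ the longest element, and $P^\vee=\{\lambda\in V_0 : \langle\lambda,\alpha\rangle\in\mathbb Z\ \forall\alpha\in R_0\}$. Let $W=W_0\ltimes P^\vee$, with translations $\tau(\lambda)$. It acts on $V_0\oplus\mathbb R c$ by $w(v+rc)=wv+rc$ for $w\in W_0$ and $\tau(\lambda)(v+rc)=v+(r-\langle\lambda,v\rangle)c$. The affine roots are $R=\{\alpha^\vee+\tfrac{2r}{\|\alpha\|^2}c : \alpha\in R_0,\ r\in\mathbb Z\}$; $R^+$ consists of those with $r>0$, or $r=0$ and $\alpha\in R_0^+$, and $R^-=-R^+$. The simple affine roots are $a_0=c-\varphi^\vee$ and $a_i=\alpha_i^\vee$, with reflections $s_0=s_\varphi\tau(-\varphi^\vee)$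 and $s_1,\dots,s_n$. Put $l(w)=\#(R^+\cap w^{-1}R^-)$ for $w\in W$ and $\Omega=\{\omega\in W: l(\omega)=0\}$. Let $k:R\to\mathbb C^*$, $a\mapsto k_a$, be $W$-invariant, $k_j=k_{a_j}$. The extended affine Hecke algebra $H(k)$ is the unital complex associative algebra generated by $T_w$ $(w\in W)$ with relations $T_1=1$, $T_vT_w=T_{vw}$ if $l(vw)=l(v)+l(w)$, and $(T_j-k_j)(T_j+k_j^{-1})=0$ for $T_j=T_{s_j}$, $0\le j\le n$. Let $\epsilon_\pm^k:H(k)\to\mathbb C$ be the characters with $\epsilon_\pm^k(T_j)=\pm k_j^{\pm1}$ $(0\le j\le n)$ and $\epsilon_\pm^k(T_\omega)=1$ $(\omega\in\Omega)$. Put $Y^\lambda=T_{\tau(\mu)}T_{\tau(\nu)}^{-1}$ if $\lambda=\mu-\nu$ with $\mu,\nu\in P^\vee$ dominant. Let $T=\mathrm{Hom}(P^\vee,\mathbb C^*)$ be the complex torus, $t^\lambda$ the value of $t\in T$ at $\lambda$, and let $W_0$ act on it by $(wt)^\lambda=t^{w^{-1}\lambda}$. Let $\mathbb C[T]=\bigoplus_\lambda\mathbb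 Ce^\lambda$ be its algebra of regular functions, $e^\lambda(t)=t^\lambda$, and $f(Y)=\sum_\lambda f_\lambda Y^\lambda$ for $f=\sum_\lambda f_\lambda e^\lambda$. For $I\subseteq\{1,\dots,n\}$ let $W_{0,I}=\langle s_i\mid i\in I\rangle$, let $W_0^I$ be the set of minimal length representatives of $W_0/W_{0,I}$, $R_0^I=R_0\cap\mathrm{span}_{\mathbb Z}\{\alpha_i\mid i\in I\}$, $R_0^{I,+}=R_0^I\cap R_0^+$, and $H_{0,I}(k)\subseteq H(k)$ the subalgebra generated by the $T_i$, $i\in I$. Let $\overline{w_0}\in W_0^I$ be the minimal representative of $w_0W_{0,I}$, and $I^*$ the subset with $\{\alpha_j\mid j\in I^*\}=\{\overline{w_0}\alpha_i\mid i\in I\}$. Put $$T_{I,reg}^k=\{\gamma\in T:\ \gamma^{\alpha_i^\vee}=k_i^2\ \ \forall i\in I,\quad k_{\alpha^\vee}^2\neq\gamma^{\alpha^\vee}\neq1\ \ \forall\alpha\in R_0^+\setminus R_0^{I,+}\},$$ $$C_\pm^I(k)=\sum_{w\in W_0^I}\epsilon_\pm^k(T_w)T_w\in H(k),\qquad C_\pm(k)=C_\pm^\emptyset(k).$$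 Let $m$ be the positive integer with $m\langle P^\vee,P^\vee\rangle=\mathbb Z$ and fix $q^{1/m}\in\mathbb C^*$ (roots of unity are allowed); $q^r=(q^{1/m})^{mr}$ for $r\in\frac1m\mathbb Z$. Let $W$ act on the field $\mathbb C(T)$ of rational functions by algebra automorphisms with $(\tau(\lambda)w)(e^\mu)=q^{-\langle\lambda,w\mu\rangle}e^{w\mu}$ $(\lambda,\mu\in P^\vee,\ w\in W_0)$, and let $\mathbb C(T)\#_qW$ be the smash product. For $a=\lambda+rc\in R$ put $e_q^a=q^re^\lambda$ and $c_a^{k,q}=(k_a^{-1}-k_ae_q^a)/(1-e_q^a)$. Let $\mathbb C_{\sigma,\nabla}^{k,q}[T]\subseteq\mathbb C(T)$ be the subalgebra generated by $\mathbb C[T]$, $(1-e_q^a)^{-1}$ and $(k_a^{-1}-k_ae_q^a)^{-1}$ for all $a\in R$, and $\mathbb C_{\sigma,\nabla}^{k,q}[T]\#_qW$ the subalgebra of $\mathbb C(T)\#_qW$ generated by it and $W$. Let $L$ be a left $\mathbb C_{\sigma,\nabla}^{k,q}[T]\#_qW$-module. **Statement.** There is a unique unital algebra homomorphism $\pi=\pi^{k^{-1},q}:H(k^{-1})\to\mathbb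 C_{\sigma,\nabla}^{k,q}[T]\#_qW$ with $\pi(T_j)=k_j^{-1}+c_{a_j}^{k^{-1},q}(s_j-1)$ for $0\le j\le n$ and $\pi(T_\omega)=\omega$ for $\omega\in\Omega$. Write $L_\pi$ for $L$ viewed as an $H(k^{-1})$-module through $\pi$ and, for $\gamma\in T$, $J\subseteq\{1,\dots,n\}$, $$L_{\pi,\gamma}=\{\phi\in L:\pi(f(Y))\phi=f(\gamma)\phi\ \ \forall f\in\mathbb C[T]\},\qquad L_\pi^{J,\pm}=\{\phi\in L:\pi(h)\phi=\epsilon_\pm^{k^{-1}}(h)\phi\ \ \forall h\in H_{0,J}(k^{-1})\},$$ $$L_\pi^{J,\pm}[\gamma]=L_\pi^{J,\pm}\cap L_{\pi,\gamma},\qquad L_\pi^{W_0\gamma}=\{\phi\in L:\pi(f(Y))\phi=f(\gamma)\phi\ \ \forall f\in\mathbb C[T]^{W_0}\},\qquad (L_\pi^{W_0\gamma})^\pm=L_\pi^{W_0\gamma}\cap L_\pi^{\{1,\dots,n\},\pm}.$$ Then, for each choice of the sign $\pm$: (a) For all $I\subseteq\{1,\dots,n\}$ and $\gamma\in T_{I,reg}^{k^{\pm1}}$,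 the operator $\pi(C_\pm^{I^*}(k^{-1}))$ maps $L_\pi^{I^*,\pm}[\overline{w_0}\gamma^{-1}]$ into $(L_\pi^{W_0\gamma^{-1}})^\pm$, and it is injective on $L_\pi^{I^*,\pm}[\overline{w_0}\gamma^{-1}]$. (b) If $\gamma\in T$ satisfies $k_{\alpha^\vee}^2\neq\gamma^{\alpha^\vee}\neq1$ for all $\alpha\in R_0$, then $\pi(C_\pm(k^{-1}))$ restricts to a linear isomorphism $L_{\pi,w_0\gamma^{-1}}\to(L_\pi^{W_0\gamma^{-1}})^\pm$. -/

import Mathlib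

noncomputable section

namespace AffHecke

open RootPairing

variable {ι M N : Type*} [AddCommGroup M] [Module ℝ M] [AddCommGroup N] [Module ℝ N]

section Finite

variable (P : RootPairing ι ℝ M N)

/-- The coweight lattice `P^∨ = {x | ⟨x, α⟩ ∈ ℤ for all roots α}`. -/
def coweightLattice : AddSubgroup N where
  carrier := {x | ∀ i, ∃ z : ℤ, P.root' i x = z}
  zero_mem' _ := ⟨0, by simp⟩
  add_mem' {x y} hx hy i := by
    obtain ⟨a, ha⟩ := hx i
    obtain ⟨c, hc⟩ := hy i
    exact ⟨a + c, by rw [map_add, ha, hc]; push_cast; rfl⟩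
  neg_mem' {x} hx i := by
    obtain ⟨a, ha⟩ := hx i
    exact ⟨-a, by rw [map_neg, ha]; push_cast; rfl⟩

/-- The coweight lattice as a type. -/
abbrev Cowt : Type _ := coweightLattice P

variable {P}

/-- The integer `⟨x, α_i⟩`. -/
def pair (x : Cowt P) (i : ι) : ℤ := (x.2 i).choose

lemma pair_spec (x : Cowt P) (i : ι) : P.root' i (x : N) = pair x i := (x.2 i).choose_spec

lemma pair_eq (x : Cowt P) (i : ι) {z : ℤ} (h : P.root' i (x : N) = z) : pair x i = z := by
  exact_mod_cast (pair_spec x i).symm.trans h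

@[simp] lemma pair_zero (i : ι) : pair (0 : Cowt P) i = 0 := pair_eq _ _ (by simp)

@[simp] lemma pair_add (x y : Cowt P) (i : ι) : pair (x + y) i = pair x i + pair y i :=
  pair_eq _ _ (by simp [pair_spec])

lemma root'_coweightEquiv (w : P.Aut) (i : ι) (x : N) :
    P.root' i (Equiv.coweightEquiv P P w x) = P.root' (w • i) x := by
  have h := congrArg (fun f => f (P.root i)) (w.toHom.weight_coweight_transpose_apply P P x)
  simp only [LinearMap.dualMap_apply] at h
  have h2 : w.weightMap (P.root i) = P.root (w • i) := w.toHom.root_weightMap_apply P P i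
  rw [h2] at h
  exact h.symm

/-- The left action of the Weyl group on the coweight lattice, normalised so that
`⟨w x, w α⟩ = ⟨x, α⟩`. -/
instance : DistribMulAction P.weylGroup (Cowt P) where
  smul w x := ⟨Equiv.coweightEquiv P P (w⁻¹ : P.weylGroup).1 x, fun i => by
    rw [root'_coweightEquiv]; exact x.2 _⟩
  one_smul x := by
    apply Subtype.ext
    change Equiv.coweightEquiv P P ((1 : P.weylGroup)⁻¹).1 (x : N) = x
    rw [inv_one]; rfl
  mul_smul u v x := by
    apply Subtype.ext
    change Equiv.coweightEquiv P P ((u * v : P.weylGroup)⁻¹).1 (x : N) =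
      Equiv.coweightEquiv P P (u⁻¹).1 (Equiv.coweightEquiv P P (v⁻¹).1 (x : N))
    rw [mul_inv_rev]; rfl
  smul_zero u := Subtype.ext (map_zero _)
  smul_add u x y := Subtype.ext (map_add _ _ _)

lemma root'_smul (w : P.weylGroup) (x : Cowt P) (i : ι) :
    P.root' i ((w • x : Cowt P) : N) = P.root' (w⁻¹ • i) (x : N) :=
  root'_coweightEquiv _ _ _

lemma pair_smul (w : P.weylGroup) (x : Cowt P) (i : ι) :
    pair (w • x) i = pair x (w⁻¹ • i) :=
  pair_eq _ _ (by rw [root'_smul, pair_spec])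

/-- The coroot `α_i^∨`, as an element of the coweight lattice. -/
def corootCowt [P.IsCrystallographic] (i : ι) : Cowt P :=
  ⟨P.coroot i, fun j => ⟨P.pairingIn ℤ j i, by
    simpa using (P.algebraMap_pairingIn ℤ j i).symm⟩⟩

lemma pair_coroot [P.IsCrystallographic] (i j : ι) :
    pair (corootCowt (P := P) i) j = P.pairingIn ℤ j i :=
  pair_eq _ _ (by simpa [corootCowt] using (P.algebraMap_pairingIn ℤ j i).symm)

variable (P) in
/-- The action of `W_0` on `P^∨`, as a homomorphism to the automorphisms of `P^∨` (written
multiplicatively). -/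
def weylMulAut : P.weylGroup →* MulAut (Multiplicative (Cowt P)) where
  toFun w := AddEquiv.toMultiplicative (DistribMulAction.toAddEquiv (Cowt P) w)
  map_one' := by
    ext x : 1
    exact congrArg Multiplicative.ofAdd (one_smul P.weylGroup x.toAdd)
  map_mul' u v := by
    ext x : 1
    exact congrArg Multiplicative.ofAdd (mul_smul u v x.toAdd)

variable (P) in
/-- The extended affine Weyl group `W = W_0 ⋉ P^∨`; the element `⟨x, w⟩` is `τ(x) w`. -/
abbrev ExtWeyl : Type _ :=
  Multiplicative (Cowt P) ⋊[weylMulAut P] P.weylGroup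

/-- The translation `τ(x) ∈ W`. -/
def tau (x : Cowt P) : ExtWeyl P := SemidirectProduct.inl (Multiplicative.ofAdd x)

/-- The inclusion `W_0 ⊆ W`. -/
def fin (w : P.weylGroup) : ExtWeyl P := SemidirectProduct.inr w

/-- An affine root is recorded as a pair `(i, r)`: it stands for `(α_i + r c)^∨`. -/
abbrev AffRoot (ι : Type*) : Type _ := ι × ℤ

/-- The action of `W` on affine roots:
`τ(x) w (α + r c)^∨ = (w α + (r - ⟨x, w α⟩) c)^∨`. -/
def act (w : ExtWeyl P) (a : AffRoot ι) : AffRoot ι :=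
  (w.right • a.1, a.2 - pair w.left.toAdd (w.right • a.1))

lemma act_one (a : AffRoot ι) : act (1 : ExtWeyl P) a = a := by
  simp [act]

lemma act_mul (v w : ExtWeyl P) (a : AffRoot ι) : act (v * w) a = act v (act w a) := by
  simp only [act, SemidirectProduct.mul_right, SemidirectProduct.mul_left, mul_smul, toAdd_mul,
    pair_add, Prod.mk.injEq, true_and]
  have : pair (Multiplicative.toAdd (weylMulAut P v.right w.left)) (v.right • w.right • a.1) = pair w.left.toAdd (w.right • a.1) := by
    change pair (v.right • w.left.toAdd) _ = _
    rw [pair_smul, inv_smul_smul]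
  rw [this]; ring

lemma act_injective (w : ExtWeyl P) : Function.Injective (act w) := fun a c h => by
  have := congrArg (act w⁻¹) h
  simpa only [← act_mul, inv_mul_cancel, act_one] using this

/-- The affine reflection `s_a = s_α τ(r α^∨)` in `a = (α + r c)^∨`. -/
def affRefl [P.IsCrystallographic] (a : AffRoot ι) : ExtWeyl P :=
  fin (weylGroup.ofIdx P a.1) * tau (a.2 • corootCowt a.1)

lemma act_affRefl [P.IsCrystallographic] (a c : AffRoot ι) :
    act (affRefl (P := P) a) c =
      (P.reflectionPerm a.1 c.1, c.2 - a.2 * P.pairingIn ℤ c.1 a.1) := by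
  have h : pair (a.2 • corootCowt (P := P) a.1) c.1 = a.2 * P.pairingIn ℤ c.1 a.1 := by
    apply pair_eq
    have := pair_spec (corootCowt (P := P) a.1) c.1
    rw [pair_coroot] at this
    simp [this]
  rw [affRefl, act_mul]
  simp only [act, fin, tau, SemidirectProduct.right_inr, SemidirectProduct.left_inr,
    SemidirectProduct.right_inl, SemidirectProduct.left_inl, one_smul, toAdd_ofAdd, toAdd_one,
    pair_zero, sub_zero, h]
  rfl

variable (P) in
/-- Multiplicity functions: `W`-invariant functions from the affine roots to `ℂˣ`. -/
def Mult : Subgroup (AffRoot ι → ℂˣ) where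
  carrier := {k | ∀ (w : ExtWeyl P) a, k (act w a) = k a}
  one_mem' _ _ := rfl
  mul_mem' hx hy w a := by simp [hx w a, hy w a]
  inv_mem' hx w a := by simp [hx w a]

/-- The scalar `±k_a^{±1}`, with the sign `±1` given by `s`. -/
def epsScalar (k : Mult P) (s : ℤˣ) (a : AffRoot ι) : ℂ := ((s : ℤ) : ℂ) * (k.1 a : ℂ) ^ (s : ℤ)

variable (P) in
/-- The complex torus `T = Hom(P^∨, ℂˣ)`. -/
abbrev Torus : Type _ := Multiplicative (Cowt P) →* ℂˣ

/-- The value `t^x`. -/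
def tpow (t : Torus P) (x : Cowt P) : ℂ := t (Multiplicative.ofAdd x)

/-- The action of `W_0` on the torus: `(w t)^x = t^{w⁻¹ x}`. -/
def torusAct (w : P.weylGroup) (t : Torus P) : Torus P :=
  t.comp (weylMulAut P w⁻¹).toMonoidHom

variable (P) in
/-- The algebra `ℂ[T]` of regular functions on `T`; `e^x` is `single x 1`. -/
abbrev Reg : Type _ := AddMonoidAlgebra ℂ (Cowt P)

/-- Evaluation `f ↦ f(t)`. -/
def evalAt (t : Torus P) : Reg P →ₐ[ℂ] ℂ :=
  AddMonoidAlgebra.lift ℂ ℂ (Cowt P) ((Units.coeHom ℂ).comp t)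

/-- `f ∈ ℂ[T]^{W_0}`, where `w e^x = e^{w x}`. -/
def IsInv (f : Reg P) : Prop :=
  ∀ w : P.weylGroup, AddMonoidAlgebra.mapDomain (w • ·) f = f

instance : IsDomain (Reg P) := by
  let : Module ℚ N := Module.compHom N (algebraMap ℚ ℝ)
  have : TwoUniqueSums (Cowt P) :=
    TwoUniqueSums.of_injective_addHom ((coweightLattice P).subtype : Cowt P →ₙ+ N)
      Subtype.val_injective inferInstance
  have : NoZeroDivisors (Reg P) := inferInstance
  exact NoZeroDivisors.to_isDomain _

instance [Finite ι] [P.IsRootSystem] : Finite P.weylGroup := by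
  refine Finite.of_injective (fun w : P.weylGroup => P.weylGroupToPerm w) fun u v h => ?_
  apply Subtype.ext
  apply Equiv.weightHom_injective P
  apply LinearEquiv.toLinearMap_injective
  apply LinearMap.ext_on_range (v := P.root) (by simp)
  intro i
  have h1 := P.weylGroup_apply_root u i
  have h2 := P.weylGroup_apply_root v i
  have h' : P.weylGroupToPerm u = P.weylGroupToPerm v := h
  rw [h'] at h1
  exact h1.trans h2.symm

end Finite

section Length

variable {P : RootPairing ι ℝ M N} (b : P.Base)

/-- Positive affine roots: `(α + r c)^∨` with `r > 0`, or `r = 0` and `α > 0`. -/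
def IsPosAff (a : AffRoot ι) : Prop := 0 < a.2 ∨ (a.2 = 0 ∧ b.IsPos a.1)

/-- The inversion set `R^+ ∩ w⁻¹ R^-`. -/
def invSet (w : ExtWeyl P) : Set (AffRoot ι) := {a | IsPosAff b a ∧ ¬ IsPosAff b (act w a)}

/-- The length `l(w) = #(R^+ ∩ w⁻¹ R^-)` on the extended affine Weyl group. -/
def length (w : ExtWeyl P) : ℕ := (invSet b w).ncard

/-- The length `l(w) = #(R_0^+ ∩ w⁻¹ R_0^-)` on the finite Weyl group. -/
def length₀ (w : P.weylGroup) : ℕ := {i | b.IsPos i ∧ ¬ b.IsPos (w • i)}.ncard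

lemma invSet_finite [Finite ι] (w : ExtWeyl P) : (invSet b w).Finite := by
  refine Set.Finite.subset (s := ⋃ i : ι, (fun r : ℤ => (i, r)) ''
    Set.Icc 0 (pair w.left.toAdd (w.right • i))) ?_ ?_
  · exact Set.finite_iUnion fun i => (Set.finite_Icc _ _).image _
  · rintro ⟨i, r⟩ ⟨h1, h2⟩
    simp only [Set.mem_iUnion]
    refine ⟨i, r, ?_, rfl⟩
    simp only [IsPosAff, act, not_or, not_and] at h1 h2
    constructor <;> omega

lemma invSet_one : invSet b (1 : ExtWeyl P) = ∅ := by
  ext a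
  simp [invSet, act_one]

lemma invSet_mul [Finite ι] (v w : ExtWeyl P) (h : length b (v * w) = length b v + length b w) :
    invSet b (v * w) = invSet b w ∪ act w⁻¹ '' invSet b v ∧
      Disjoint (invSet b w) (act w⁻¹ '' invSet b v) := by
  have hdis : Disjoint (invSet b w) (act w⁻¹ '' invSet b v) := by
    rw [Set.disjoint_left]
    rintro _ h1 ⟨c, hc, rfl⟩
    apply h1.2
    rw [← act_mul, mul_inv_cancel, act_one]
    exact hc.1
  refine ⟨Set.eq_of_subset_of_ncard_le ?_ ?_
    ((invSet_finite b w).union ((invSet_finite b v).image _)), hdis⟩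
  · rintro a ⟨h1, h2⟩
    by_cases h3 : IsPosAff b (act w a)
    · right
      refine ⟨act w a, ⟨h3, by rwa [← act_mul]⟩, ?_⟩
      rw [← act_mul, inv_mul_cancel, act_one]
    · exact Or.inl ⟨h1, h3⟩
  · rw [Set.ncard_union_eq hdis (invSet_finite b w) ((invSet_finite b v).image _),
      Set.ncard_image_of_injective _ (act_injective _)]
    change _ ≤ length b (v * w)
    rw [h, add_comm]
    rfl

variable [Fintype ι] [Nonempty ι]

/-- The index of the highest root `φ`: the root of maximal height. -/
def highest : ι := (Finite.exists_max b.height).choose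

lemma height_le_highest (i : ι) : b.height i ≤ b.height (highest b) :=
  (Finite.exists_max b.height).choose_spec i

/-- The simple affine roots: `a_0 = c - φ^∨ = (-φ + c)^∨` (index `none`) and
`a_i = α_i^∨`. -/
def simpleRoot : Option b.support → AffRoot ι
  | none => (P.reflectionPerm (highest b) (highest b), 1)
  | some j => (j, 0)

variable [P.IsCrystallographic]

/-- The simple reflections `s_0, …, s_n` of the affine Weyl group. -/
def simpleRefl (j : Option b.support) : ExtWeyl P := affRefl (simpleRoot b j)

lemma invSet_simpleRefl [P.IsReduced] (j : Option b.support) :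
    invSet b (simpleRefl b j) = {simpleRoot b j} := by
  ext ⟨i, r⟩
  simp only [invSet, simpleRefl, act_affRefl, Set.mem_ofPred_eq, Set.mem_singleton_iff]
  cases j with
  | some j =>
    simp only [simpleRoot, zero_mul, sub_zero, IsPosAff, Prod.mk.injEq]
    constructor
    · rintro ⟨h1, h2⟩
      have hr : r = 0 := by by_contra; omega
      subst hr
      simp only [lt_irrefl, true_and, false_or] at h1 h2
      refine ⟨?_, rfl⟩
      by_contra hne
      exact h2 (h1.reflectionPerm j.2 hne)
    · rintro ⟨rfl, rfl⟩
      have := b.height_reflectionPerm_self (j : ι)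
      have h1 := Base.height_one_of_mem_support j.2
      have h2 : b.height (P.reflectionPerm j j) = -b.height j := this
      simp only [lt_irrefl, true_and, false_or, Base.IsPos, h2]
      omega
  | none =>
    set f := highest b with hf
    have hmax : ∀ i, b.height i ≤ b.height f := height_le_highest b
    have hpos : 0 < b.height f := by
      have h1 := hmax (P.reflectionPerm f f)
      have h2 : b.height (P.reflectionPerm f f) = -b.height f := b.height_reflectionPerm_self f
      have h3 := b.height_ne_zero f
      rw [h2] at h1
      omega
    have hneg : b.height (P.reflectionPerm f f) = -b.height f := b.height_reflectionPerm_self f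
    have hmin (i : ι) : -b.height f ≤ b.height i := by
      have h1 := hmax (P.reflectionPerm i i)
      have h2 : b.height (P.reflectionPerm i i) = -b.height i := b.height_reflectionPerm_self i
      rw [h2] at h1; omega
    have hpn : P.pairingIn ℤ i (P.reflectionPerm f f) = -P.pairingIn ℤ i f := by
      simp
    have hperm : P.reflectionPerm (P.reflectionPerm f f) i = P.reflectionPerm f i := by
      apply P.root.injective
      simp [reflection_apply]
      module
    have hroot : P.root (P.reflectionPerm f i) = P.root i + (-P.pairingIn ℤ i f) • P.root f := by
      rw [root_reflectionPerm, neg_smul, reflection_apply_root' ℤ, sub_eq_add_neg]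
    have hht := b.height_add_zsmul hroot
    simp only [simpleRoot, ← hf, hpn, hperm, IsPosAff, Prod.mk.injEq, Base.IsPos]
    generalize hn : P.pairingIn ℤ i f = n at *
    rw [hht]
    have hle := hmax (P.reflectionPerm f i)
    have hge := hmin (P.reflectionPerm f i)
    have hnz := b.height_ne_zero (P.reflectionPerm f i)
    rw [hht] at hle hge hnz
    have h3 := hmax i
    have h4 := hmin i
    have h5 := b.height_ne_zero i
    simp only [smul_eq_mul] at *
    constructor
    · rintro ⟨h1, h2⟩
      by_cases hi : i = P.reflectionPerm f f
      · refine ⟨hi, ?_⟩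
        have : n = -2 := by rw [← hn, hi]; simp
        subst this
        rw [hi, hneg] at h1 h2
        omega
      · exfalso
        have hi' : P.root i ≠ - P.root f := fun h => hi (P.root.injective (by simpa using h))
        have hneg0 : n < 0 → b.height i + b.height f ≠ 0 := fun h0 => by
          obtain ⟨l, hl⟩ := P.root_add_root_mem_of_pairingIn_neg (by rw [hn]; exact h0) hi'
          rw [← b.height_add hl]
          exact b.height_ne_zero l
        rcases lt_trichotomy n (-1) with h | h | h
        · have := hneg0 (by omega)
          nlinarith [show b.height f < b.height i + 2 * b.height f by omega]
        · subst h
          have := hneg0 (by omega)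
          omega
        · have hr0 : 0 ≤ r := by omega
          have hn0 : n = 0 ∧ r = 0 := by omega
          obtain ⟨rfl, rfl⟩ := hn0
          simp at h1 h2
          omega
    · rintro ⟨rfl, rfl⟩
      have : n = -2 := by rw [← hn]; simp
      subst this
      rw [hneg]
      omega

end Length

section Hecke

variable {P : RootPairing ι ℝ M N} [Fintype ι] [Nonempty ι] [P.IsCrystallographic]
  (b : P.Base) (k : Mult P)

/-- The relations of the extended affine Hecke algebra `H(k)` on generators `T_w`, `w ∈ W`:
`T_1 = 1`, `T_v T_w = T_{vw}` when `l(vw) = l(v) + l(w)` (the braid relations, together with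
`T_ω T_j = T_{ω(j)} T_ω` for `ω ∈ Ω`), and `(T_j - k_j)(T_j + k_j⁻¹) = 0` for `0 ≤ j ≤ n`. -/
inductive HeckeRel : FreeAlgebra ℂ (ExtWeyl P) → FreeAlgebra ℂ (ExtWeyl P) → Prop
  | one : HeckeRel (FreeAlgebra.ι ℂ 1) 1
  | mul (v w : ExtWeyl P) : length b (v * w) = length b v + length b w →
      HeckeRel (FreeAlgebra.ι ℂ v * FreeAlgebra.ι ℂ w) (FreeAlgebra.ι ℂ (v * w))
  | quad (j : Option b.support) :
      HeckeRel ((FreeAlgebra.ι ℂ (simpleRefl b j) -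
          algebraMap ℂ _ (k.1 (simpleRoot b j) : ℂ)) *
        (FreeAlgebra.ι ℂ (simpleRefl b j) +
          algebraMap ℂ _ ((k.1 (simpleRoot b j) : ℂ)⁻¹))) 0

/-- The extended affine Hecke algebra `H(k)`. -/
def Hecke : Type _ := RingQuot (HeckeRel b k)

instance : Ring (Hecke b k) := inferInstanceAs (Ring (RingQuot (HeckeRel b k)))

instance : Algebra ℂ (Hecke b k) := inferInstanceAs (Algebra ℂ (RingQuot (HeckeRel b k)))

/-- The basis element `T_w` of `H(k)`, `w ∈ W`. -/
def heckeT (w : ExtWeyl P) : Hecke b k :=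
  RingQuot.mkAlgHom ℂ (HeckeRel b k) (FreeAlgebra.ι ℂ w)

/-- The value of the character `ε_±^k` at `T_w`, the product of `±k_a^{±1}` over the inversions. -/
def epsVal (s : ℤˣ) (w : ExtWeyl P) : ℂ := ∏ᶠ a ∈ invSet b w, epsScalar k s a

variable [P.IsReduced]

/-- The character `ε_±^k : H(k) → ℂ` with `ε_±^k(T_j) = ±k_j^{±1}` and `ε_±^k(T_ω) = 1` for
`l(ω) = 0`: the trivial character for `s = 1`, the Steinberg character for `s = -1`. -/
def eps (s : ℤˣ) : Hecke b k →ₐ[ℂ] ℂ :=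
  RingQuot.liftAlgHom ℂ ⟨FreeAlgebra.lift ℂ (epsVal b k s), by
    intro x y h
    induction h with
    | one => simp [epsVal, invSet_one]
    | mul v w h =>
      obtain ⟨h1, h2⟩ := invSet_mul b v w h
      simp only [map_mul, FreeAlgebra.lift_ι_apply, epsVal]
      rw [h1, finprod_mem_union h2 (invSet_finite b w) ((invSet_finite b v).image _),
        finprod_mem_image (act_injective _).injOn, mul_comm]
      congr 1
      refine finprod_mem_congr rfl fun a _ => ?_
      simp only [epsScalar, k.2 w⁻¹ a]
    | quad j =>
      simp only [map_mul, map_sub, map_add, map_zero, FreeAlgebra.lift_ι_apply, epsVal,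
        invSet_simpleRefl, finprod_mem_singleton, AlgHom.commutes, epsScalar,
        Algebra.algebraMap_self, RingHom.id_apply]
      rcases Int.units_eq_one_or s with rfl | rfl <;> simp⟩

lemma eps_heckeT (s : ℤˣ) (w : ExtWeyl P) : eps b k s (heckeT b k w) = epsVal b k s w := by
  rw [eps, heckeT]
  erw [RingQuot.liftAlgHom_mkAlgHom_apply]
  simp

lemma eps_simpleRefl (s : ℤˣ) (j : Option b.support) :
    eps b k s (heckeT b k (simpleRefl b j)) =
      ((s : ℤ) : ℂ) * (k.1 (simpleRoot b j) : ℂ) ^ (s : ℤ) := by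
  simp [eps_heckeT, epsVal, invSet_simpleRefl, epsScalar]

end Hecke

section Dominant

variable {P : RootPairing ι ℝ M N} (b : P.Base)

/-- Dominant coweights. -/
def IsDominant (x : Cowt P) : Prop := ∀ i, b.IsPos i → 0 ≤ pair x i

lemma exists_cowt [P.IsRootSystem] (g : b.support → ℤ) :
    ∃ x : Cowt P, ∀ j : b.support, pair x j = g j := by
  let F : Module.Dual ℝ M := b.toWeightBasis.constr ℝ fun j => (g j : ℝ)
  let x : N := P.flip.toPerfPair.symm F
  have hx (j : b.support) : P.root' j x = g j := by
    have h1 : P.flip.toPerfPair x = F := LinearEquiv.apply_symm_apply _ _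
    have h2 : P.root' j x = P.flip.toPerfPair x (P.root j) := rfl
    rw [h2, h1]
    have h3 := b.toWeightBasis.constr_basis ℝ (fun j => (g j : ℝ)) j
    rwa [Base.toWeightBasis_apply] at h3
  have hmem : x ∈ coweightLattice P := fun i => by
    obtain ⟨f, -, -, hf⟩ := b.exists_root_eq_sum_int i
    refine ⟨∑ j ∈ b.support.attach, f j * g j, ?_⟩
    have h2 (i : ι) : P.root' i x = P.flip.toLinearMap x (P.root i) := rfl
    rw [h2, hf, map_sum, ← Finset.sum_attach]
    push_cast
    refine Finset.sum_congr rfl fun j _ => ?_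
    rw [map_zsmul, ← h2, hx, zsmul_eq_mul]
  exact ⟨⟨x, hmem⟩, fun j => pair_eq _ _ (hx j)⟩

lemma pair_eq_sum (x : Cowt P) {i : ι} {f : ι → ℤ}
    (hf : P.root i = ∑ j ∈ b.support, f j • P.root j) :
    pair x i = ∑ j ∈ b.support, f j * pair x j := by
  apply pair_eq
  have h2 (i : ι) : P.root' i (x : N) = P.flip.toLinearMap (x : N) (P.root i) := rfl
  rw [h2, hf, map_sum]
  push_cast
  refine Finset.sum_congr rfl fun j _ => ?_
  rw [map_zsmul, ← h2, pair_spec, zsmul_eq_mul]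

lemma isDominant_of_simple (x : Cowt P) (h : ∀ j ∈ b.support, 0 ≤ pair x j) :
    IsDominant b x := fun i hi => by
  obtain ⟨f, -, hf1, hf⟩ := b.exists_root_eq_sum_int i
  have hf0 : 0 < f := by
    refine hf1.resolve_right fun hn => ?_
    rw [Base.isPos_iff, Base.height_eq_sum hf] at hi
    exact absurd hi (not_lt.2 (Finset.sum_nonpos fun i _ => hn.le i))
  rw [pair_eq_sum b x hf]
  exact Finset.sum_nonneg fun j hj => mul_nonneg (hf0.le j) (h j hj)

/-- Every coweight is a difference of two dominant ones. -/
lemma exists_dominant [P.IsRootSystem] (x : Cowt P) :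
    ∃ y : Cowt P × Cowt P, IsDominant b y.1 ∧ IsDominant b y.2 ∧ x = y.1 - y.2 := by
  obtain ⟨z, hz⟩ := exists_cowt b fun j => max 0 (-pair x j)
  refine ⟨(x + z, z), isDominant_of_simple b _ fun j hj => ?_,
    isDominant_of_simple b _ fun j hj => ?_, by simp⟩
  · have := hz ⟨j, hj⟩
    simp only [pair_add] at *
    omega
  · have := hz ⟨j, hj⟩
    simp only at *
    omega

variable [Fintype ι] [Nonempty ι] [P.IsCrystallographic] [P.IsRootSystem] (k : Mult P)

/-- The elements `Y^x ∈ H(k)`, `x ∈ P^∨`: `Y^x = T_{τ(y)} T_{τ(z)}⁻¹` where `x = y - z` with `y`,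
`z` dominant (independent of this choice). In particular `Y^x = T_{τ(x)}` for `x` dominant. -/
def heckeY (x : Cowt P) : Hecke b k :=
  heckeT b k (tau (exists_dominant b x).choose.1) *
    Ring.inverse (heckeT b k (tau (exists_dominant b x).choose.2))

/-- The element `f(Y) = ∑_x f_x Y^x` of `H(k)`, for `f = ∑_x f_x e^x ∈ ℂ[T]`. -/
def fY (f : Reg P) : Hecke b k := f.coeff.sum fun x c => c • heckeY b k x

end Dominant

section Parabolic

variable {P : RootPairing ι ℝ M N} (b : P.Base)

/-- The simple reflection `s_i ∈ W_0`. -/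
def simpleRefl₀ (j : b.support) : P.weylGroup := weylGroup.ofIdx P j

/-- The parabolic subgroup `W_{0,I}`. -/
def parabolic (I : Set b.support) : Subgroup P.weylGroup :=
  Subgroup.closure (simpleRefl₀ b '' I)

/-- The minimal coset representatives `W_0^I = {w | l(w s_i) > l(w) for all i ∈ I}`. -/
def minReps (I : Set b.support) : Set P.weylGroup :=
  {w | ∀ i ∈ I, length₀ b w < length₀ b (w * simpleRefl₀ b i)}

/-- The indices of the roots in the parabolic root subsystem
`R_0^I = R_0 ∩ span_ℤ {α_i | i ∈ I}`. -/
def parabolicRoots (I : Set b.support) : Set ι :=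
  {i | P.root i ∈ AddSubgroup.closure ((fun j : b.support => P.root j) '' I)}

/-- The longest element `w_0` of `W_0`. -/
def longest [Finite ι] [P.IsRootSystem] : P.weylGroup := (Finite.exists_max (length₀ b)).choose

/-- The minimal coset representative `w̄ ∈ W_0^I` of `w W_{0,I}`. -/
def minRep (I : Set b.support) (w : P.weylGroup) : P.weylGroup :=
  Classical.epsilon fun u => u ∈ minReps b I ∧ u⁻¹ * w ∈ parabolic b I

/-- The subset `I^*`, determined by `α_{i^*} = w̄_0 α_i` for `i ∈ I`. -/
def dualSet [Finite ι] [P.IsRootSystem] (I : Set b.support) : Set b.support :=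
  {j | ∃ i ∈ I, minRep b I (longest b) • (i : ι) = j}

variable [P.IsCrystallographic]

/-- The set `T_I^k` of all `γ ∈ T` with `γ^{α_i^∨} = k_i^2` for `i ∈ I`. -/
def TI (k : Mult P) (I : Set b.support) : Set (Torus P) :=
  {γ | ∀ i ∈ I, tpow γ (corootCowt (i : ι)) = (k.1 (i, 0) : ℂ) ^ 2}

/-- The set `T_{I,reg}^k` of all `γ ∈ T_I^k` with `k_{α^∨}^2 ≠ γ^{α^∨} ≠ 1` for all
`α ∈ R_0^+ ∖ R_0^{I,+}`. -/
def TIreg (k : Mult P) (I : Set b.support) : Set (Torus P) :=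
  {γ | γ ∈ TI b k I ∧ ∀ i, b.IsPos i → i ∉ parabolicRoots b I →
    tpow γ (corootCowt i) ≠ (k.1 (i, 0) : ℂ) ^ 2 ∧ tpow γ (corootCowt i) ≠ 1}

variable [Fintype ι] [Nonempty ι] (k : Mult P)

/-- The subalgebra `H_{0,I}(k)` generated by the `T_i`, `i ∈ I`. -/
def heckeFin (I : Set b.support) : Subalgebra ℂ (Hecke b k) :=
  Algebra.adjoin ℂ ((fun i => heckeT b k (simpleRefl b (some i))) '' I)

/-- The element `C_±^I(k) = ∑_{w ∈ W_0^I} ε_±^k(T_w) T_w`. -/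
def symmetrizer [P.IsReduced] (I : Set b.support) (s : ℤˣ) : Hecke b k :=
  ∑ᶠ w ∈ minReps b I, eps b k s (heckeT b k (fin w)) • heckeT b k (fin w)

end Parabolic

section Modules

variable {P : RootPairing ι ℝ M N} [Fintype ι] [Nonempty ι] [P.IsCrystallographic]
  {b : P.Base} {k : Mult P} {L : Type*} [AddCommGroup L] [Module ℂ L]
  (ρ : Hecke b k →ₐ[ℂ] Module.End ℂ L)

/-- For the `H(k)`-module `L` given by `ρ`, the space `L^{I,±}` of vectors on which `H_{0,I}(k)`
acts by `ε_±^k`. -/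
def spherical [P.IsReduced] (I : Set b.support) (s : ℤˣ) : Submodule ℂ L where
  carrier := {v | ∀ h ∈ heckeFin b k I, ρ h v = eps b k s h • v}
  zero_mem' _ _ := by simp
  add_mem' hu hv h hh := by rw [map_add, hu h hh, hv h hh, smul_add]
  smul_mem' c v hv h hh := by rw [map_smul, hv h hh, smul_comm]

variable [P.IsRootSystem]

/-- The weight space `L_γ = {v | f(Y) v = f(γ) v for all f ∈ ℂ[T]}`. -/
def weightSpace (γ : Torus P) : Submodule ℂ L where
  carrier := {v | ∀ f : Reg P, ρ (fY b k f) v = evalAt γ f • v}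
  zero_mem' _ := by simp
  add_mem' hu hv f := by rw [map_add, hu f, hv f, smul_add]
  smul_mem' c v hv f := by rw [map_smul, hv f, smul_comm]

/-- The space `L^{W_0 γ} = {v | f(Y) v = f(γ) v for all f ∈ ℂ[T]^{W_0}}`. -/
def centralSpace (γ : Torus P) : Submodule ℂ L where
  carrier := {v | ∀ f : Reg P, IsInv f → ρ (fY b k f) v = evalAt γ f • v}
  zero_mem' _ := by simp
  add_mem' hu hv f hf := by rw [map_add, hu f hf, hv f hf, smul_add]
  smul_mem' c v hv f hf := by rw [map_smul, hv f hf, smul_comm]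

end Modules

section QParam

variable {P : RootPairing ι ℝ M N} [Fintype ι] [Nonempty ι] (b : P.Base)

/-- The `W_0`-invariant scalar product on the coweight space normalised by `⟨φ^∨, φ^∨⟩ = 2`, that
is, such that long roots have squared length `2`. Since `⟨α^∨, α^∨⟩ = 4 / ‖α‖²`, one has
`2 / ‖α‖² = ⟨α^∨, α^∨⟩ / 2`. -/
def form (x y : N) : ℝ :=
  2 * P.CorootForm x y / P.CorootForm (P.coroot (highest b)) (P.coroot (highest b))

/-- The positive integer `m` with `m ⟨P^∨, P^∨⟩ = ℤ`, and a nonzero complex number `q^{1/m}`. -/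
structure QParam where
  m : ℕ
  m_pos : 0 < m
  m_spec : {r : ℝ | ∃ x y : Cowt P, r = m * form b x y} = Set.range ((↑) : ℤ → ℝ)
  root : ℂˣ

namespace QParam

variable {b} (q : QParam b)

/-- `q^r = (q^{1/m})^{mr}` for `r ∈ (1/m)ℤ`. -/
def qpow (r : ℝ) : ℂ := (q.root : ℂ) ^ ⌊q.m * r⌋

lemma exists_int (x y : Cowt P) : ∃ z : ℤ, q.m * form b x y = z := by
  have : (q.m * form b x y : ℝ) ∈ {r : ℝ | ∃ x y : Cowt P, r = q.m * form b x y} := ⟨x, y, rfl⟩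
  rw [q.m_spec] at this
  obtain ⟨z, hz⟩ := this
  exact ⟨z, hz.symm⟩

lemma form_add_left (x y z : N) : form b (x + y) z = form b x z + form b y z := by
  simp [form, mul_add, add_div]

lemma form_add_right (x y z : N) : form b x (y + z) = form b x y + form b x z := by
  simp [form, mul_add, add_div]

lemma form_smul (w : P.weylGroup) (x y : Cowt P) :
    form b ((w • x : Cowt P) : N) ((w • y : Cowt P) : N) = form b (x : N) (y : N) := by
  have : P.CorootForm ((w • x : Cowt P) : N) ((w • y : Cowt P) : N) =
      P.CorootForm (x : N) (y : N) := by
    simp only [corootForm_apply_apply, root'_smul]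
    exact Equiv.sum_comp (MulAction.toPerm w⁻¹) fun i => P.root' i (x : N) * P.root' i (y : N)
  rw [form, form, this]

/-- The scalar `q^{-⟨x, y⟩}`. -/
def qpair (x y : Cowt P) : ℂ := q.qpow (-form b x y)

lemma qpair_add_left (x y z : Cowt P) : q.qpair (x + y) z = q.qpair x z * q.qpair y z := by
  obtain ⟨u, hu⟩ := q.exists_int x z
  obtain ⟨v, hv⟩ := q.exists_int y z
  have h : (q.m : ℝ) * -form b ((x + y : Cowt P) : N) z = ((-u + -v : ℤ) : ℝ) := by
    rw [AddSubgroup.coe_add, form_add_left]; push_cast; linarith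
  have hu' : (q.m : ℝ) * -form b x z = ((-u : ℤ) : ℝ) := by push_cast; linarith
  have hv' : (q.m : ℝ) * -form b y z = ((-v : ℤ) : ℝ) := by push_cast; linarith
  rw [qpair, qpair, qpair, qpow, qpow, qpow, h, hu', hv', Int.floor_intCast, Int.floor_intCast,
    Int.floor_intCast, zpow_add₀ q.root.ne_zero]

lemma qpair_add_right (x y z : Cowt P) : q.qpair x (y + z) = q.qpair x y * q.qpair x z := by
  obtain ⟨u, hu⟩ := q.exists_int x y
  obtain ⟨v, hv⟩ := q.exists_int x z
  have h : (q.m : ℝ) * -form b x ((y + z : Cowt P) : N) = ((-u + -v : ℤ) : ℝ) := by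
    rw [AddSubgroup.coe_add, form_add_right]; push_cast; linarith
  have hu' : (q.m : ℝ) * -form b x y = ((-u : ℤ) : ℝ) := by push_cast; linarith
  have hv' : (q.m : ℝ) * -form b x z = ((-v : ℤ) : ℝ) := by push_cast; linarith
  rw [qpair, qpair, qpair, qpow, qpow, qpow, h, hu', hv', Int.floor_intCast, Int.floor_intCast,
    Int.floor_intCast, zpow_add₀ q.root.ne_zero]

lemma qpair_zero_left (x : Cowt P) : q.qpair 0 x = 1 := by simp [qpair, qpow, form]

lemma qpair_zero_right (x : Cowt P) : q.qpair x 0 = 1 := by simp [qpair, qpow, form]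

lemma qpair_smul (w : P.weylGroup) (x y : Cowt P) : q.qpair (w • x) (w • y) = q.qpair x y := by
  rw [qpair, qpair, form_smul]

/-- The action of `w ∈ W` on `ℂ[T]` by `q`-difference reflection operators:
`(τ(x) w) e^y = q^{-⟨x, w y⟩} e^{w y}`. -/
def regAct (w : ExtWeyl P) : Reg P →ₐ[ℂ] Reg P :=
  AddMonoidAlgebra.lift ℂ (Reg P) (Cowt P)
    { toFun := fun y => AddMonoidAlgebra.single (w.right • y.toAdd)
        (q.qpair w.left.toAdd (w.right • y.toAdd))
      map_one' := by
        rw [toAdd_one, smul_zero, qpair_zero_right]; rfl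
      map_mul' := fun y z => by
        rw [toAdd_mul, smul_add, qpair_add_right, AddMonoidAlgebra.single_mul_single] }

lemma regAct_single (w : ExtWeyl P) (y : Cowt P) (c : ℂ) :
    q.regAct w (AddMonoidAlgebra.single y c) =
      AddMonoidAlgebra.single (w.right • y) (c * q.qpair w.left.toAdd (w.right • y)) := by
  simp [regAct, AddMonoidAlgebra.lift_single]

lemma regAct_one : q.regAct 1 = AlgHom.id ℂ (Reg P) := by
  ext y
  simp [regAct_single, qpair_zero_left]

lemma regAct_mul (v w : ExtWeyl P) : q.regAct (v * w) = (q.regAct v).comp (q.regAct w) := by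
  refine AddMonoidAlgebra.algHom_ext (fun y => ?_) (Subsingleton.elim _ _)
  rw [AlgHom.comp_apply, regAct_single, regAct_single, regAct_single]
  have h : (v * w).left.toAdd = v.left.toAdd + v.right • w.left.toAdd := rfl
  rw [h, SemidirectProduct.mul_right, mul_smul, qpair_add_left, qpair_smul]
  congr 1
  ring

/-- The `W`-action on `ℂ[T]`, as an action by ring automorphisms. -/
@[reducible] def regAction : MulSemiringAction (ExtWeyl P) (Reg P) where
  smul w f := q.regAct w f
  one_smul f := by change q.regAct 1 f = f; rw [regAct_one]; rfl
  mul_smul v w f := by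
    change q.regAct (v * w) f = q.regAct v (q.regAct w f); rw [regAct_mul]; rfl
  smul_zero w := map_zero (q.regAct w)
  smul_add w := map_add (q.regAct w)
  smul_one w := map_one (q.regAct w)
  smul_mul w := map_mul (q.regAct w)

end QParam

variable {b}

/-- The field `ℂ(T)` of rational functions on `T`; the parameter `q` is recorded since the
`W`-action depends on it. -/
def RatFun (_q : QParam b) : Type _ := FractionRing (Reg P)

variable (q : QParam b)

instance : Field (RatFun q) := inferInstanceAs (Field (FractionRing (Reg P)))

instance : Algebra ℂ (RatFun q) := inferInstanceAs (Algebra ℂ (FractionRing (Reg P)))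

instance : Algebra (Reg P) (RatFun q) := inferInstanceAs (Algebra (Reg P) (FractionRing (Reg P)))

instance : IsScalarTower ℂ (Reg P) (RatFun q) :=
  inferInstanceAs (IsScalarTower ℂ (Reg P) (FractionRing (Reg P)))

instance : IsFractionRing (Reg P) (RatFun q) :=
  inferInstanceAs (IsFractionRing (Reg P) (FractionRing (Reg P)))

/-- The `W`-action on `ℂ(T)` extending the one on `ℂ[T]`. -/
instance : MulSemiringAction (ExtWeyl P) (RatFun q) :=
  letI := q.regAction
  IsFractionRing.mulSemiringAction (ExtWeyl P) (Reg P) (RatFun q)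

lemma smul_algebraMap_reg (w : ExtWeyl P) (f : Reg P) :
    w • algebraMap (Reg P) (RatFun q) f = algebraMap (Reg P) (RatFun q) (q.regAct w f) := by
  let := q.regAction
  have := IsFractionRing.smulDistribClass (ExtWeyl P) (Reg P) (RatFun q)
  exact (algebraMap.coe_smul' w f (RatFun q)).symm

instance : SMulCommClass (ExtWeyl P) ℂ (RatFun q) where
  smul_comm w c f := by
    rw [Algebra.smul_def, Algebra.smul_def, smul_mul',
      IsScalarTower.algebraMap_apply ℂ (Reg P) (RatFun q), smul_algebraMap_reg,
      AlgHom.commutes]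

/-- The smash product algebra `ℂ(T) #_q W` of `q`-difference reflection operators. -/
abbrev Smash : Type _ := SkewMonoidAlgebra (RatFun q) (ExtWeyl P)

/-- A rational function, as an element of `ℂ(T) #_q W`. -/
def ofFun (f : RatFun q) : Smash q := SkewMonoidAlgebra.single 1 f

/-- An element of `W`, as an element of `ℂ(T) #_q W`. -/
def ofW (w : ExtWeyl P) : Smash q := SkewMonoidAlgebra.single w 1

variable [P.IsCrystallographic]

/-- The function `e_q^a = q^{2r/‖α‖²} e^{α^∨}`, where `a = (α + r c)^∨ = (2r/‖α‖²) c + α^∨`. -/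
def expRoot (a : AffRoot ι) : RatFun q :=
  algebraMap (Reg P) (RatFun q) (AddMonoidAlgebra.single (corootCowt a.1)
    (q.qpow (a.2 * (form b (P.coroot a.1) (P.coroot a.1) / 2))))

/-- The scalar `k_a`, as a constant function. -/
def constRoot (k : Mult P) (a : AffRoot ι) : RatFun q := algebraMap ℂ (RatFun q) (k.1 a : ℂ)

/-- The function `c_a^{k,q} = (k_a⁻¹ - k_a e_q^a) / (1 - e_q^a)`. -/
def cFun (k : Mult P) (a : AffRoot ι) : RatFun q :=
  ((constRoot q k a)⁻¹ - constRoot q k a * expRoot q a) / (1 - expRoot q a)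

/-- The algebra `ℂ_{σ,∇}^{k,q}[T]` generated by `ℂ[T]`, `(1 - e_q^a)⁻¹` and
`(k_a⁻¹ - k_a e_q^a)⁻¹` for all affine roots `a`. -/
def coeffAlg (k : Mult P) : Subalgebra ℂ (RatFun q) :=
  Algebra.adjoin ℂ (Set.range (algebraMap (Reg P) (RatFun q)) ∪
    Set.range (fun a => (1 - expRoot q a)⁻¹) ∪
    Set.range (fun a => ((constRoot q k a)⁻¹ - constRoot q k a * expRoot q a)⁻¹))

/-- The algebra `ℂ_{σ,∇}^{k,q}[T] #_q W`, as a subalgebra of `ℂ(T) #_q W`. -/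
def diffAlg (k : Mult P) : Subalgebra ℂ (Smash q) :=
  Algebra.adjoin ℂ (ofFun q '' coeffAlg q k ∪ Set.range (ofW q))

/-- The algebra map `π^{k',q}` from `H(k')` to the `q`-difference reflection operators is
characterised by `π(T_j) = k'_j + c_j^{k',q} (s_j - 1)` for `0 ≤ j ≤ n` and `π(T_ω) = ω` for
`l(ω) = 0`. -/
def IsCherednikHom (k k' : Mult P) (π : Hecke b k' →ₐ[ℂ] diffAlg q k) : Prop :=
  (∀ j, (π (heckeT b k' (simpleRefl b j)) : Smash q) =
    algebraMap ℂ (Smash q) (k'.1 (simpleRoot b j) : ℂ) +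
      ofFun q (cFun q k' (simpleRoot b j)) * (ofW q (simpleRefl b j) - 1)) ∧
  ∀ ω, length b ω = 0 → (π (heckeT b k' ω) : Smash q) = ofW q ω

/-- The `H(k')`-module `L_π`: a module `L` over `ℂ_{σ,∇}^{k,q}[T] #_q W`, viewed as an
`H(k')`-module through `π`. -/
def pull {q : QParam b} {k k' : Mult P} (π : Hecke b k' →ₐ[ℂ] diffAlg q k) (L : Type*)
    [AddCommGroup L] [Module ℂ L] [Module (diffAlg q k) L] [IsScalarTower ℂ (diffAlg q k) L] :
    Hecke b k' →ₐ[ℂ] Module.End ℂ L :=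
  (Algebra.lsmul ℂ ℂ L).comp π

end QParam
end AffHecke

end

noncomputable section

namespace AffHecke

open RootPairing

set_option linter.unusedSectionVars false

variable {ι M N : Type*} [AddCommGroup M] [Module ℝ M] [AddCommGroup N] [Module ℝ N]

/-! ### Words in two reflection operators applied to an invariant vector -/

section RankTwo

variable {F R : Type*} [CommRing F] [Ring R] {i : F →+* R}

/-! Existence of `π` amounts to the quadratic and braid relations for the Demazure–Lusztig operators
`T_j`. Let `D` be the difference of the two sides of a braid relation. Explicit partial fraction
identities in rank two give `D (1 + s) = 0` for both reflections `s`, so that vanishing of one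
coefficient of `D` propagates along the dihedral group. The coefficient at the longest dihedral
element does vanish, since both words produce there the same product of c-functions; hence `D = 0`
(`alt_opT_comm`). Matsumoto's argument (`exists_lift_of_braid`, `map_mul_of_length_add`) then
defines `T_w` for every `w ∈ W`. The image of `T_w` has leading term a nonzero multiple of `w`, so
the `T_w` are linearly independent in the Hecke algebra, and the Bernstein relation (`bernstein`)
turns this into independence of the elements `T_w Y^x`.

Statements (a) and (b) hold for every module over the Hecke algebra. Write `δ` for the weight, `J`
for the parabolic index set, `C` for the symmetrizer, and let `v` be a `J`-spherical vector of
weight `δ`. Two mechanisms are combined.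

Triangularity: on `v`, one has `f(Y) T_w = f(wδ) T_w` plus shorter terms, for `w ∈ W_0^J`
(`fYHom_mul_heckeT_sub_mem`). Regularity gives `wδ ≠ δ` for `1 ≠ w ∈ W_0^J`
(`eq_one_of_torusAct_eq`), so some `p` satisfies `p(δ) = 1` and `p(wδ) = 0` for these `w`. Replacing
`p` by a power, `p(Y) C v = c v` with a scalar `c` that does not depend on the module.

Intertwiners: on a spherical vector `ψ` an intertwiner acts as a function of `Y`. Therefore, if
`f(Y) ψ = 0` with `f(δ) ≠ 0`, then for each `w ∈ W_0^J` some `F` with `F(wδ) ≠ 0` satisfies `F(Y) ψ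
= 0` (`exists_annihilator`). If `c` were zero, this could be applied to the symmetrization of an
eigenfunctional in the dual of the Hecke algebra, with `w` the longest element of `W_0^J`; but
triangularity computes the value of `F(Y) C` on that functional as `ε(T_w) F(wδ) ≠ 0`
(`fYHom_mul_symmetrizer_notMem`). So `c ≠ 0`, and `v` is recovered from `C v`: this is injectivity.

For surjectivity in (b) the orbit of `δ` is free, and Lagrange interpolation shows that `p(Y) φ` has
weight `δ` for every `φ` with the right central character. If `φ` is spherical, then `φ - c⁻¹ C p(Y)
φ` is spherical and killed by `p(Y)`. By the intertwiners its annihilator contains a function that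
vanishes nowhere on the orbit. The norm of such a function is invariant, kills the vector, and acts
on it by a nonzero scalar, so the vector is zero. -/

lemma reflStep_pair {σ : F →+* F} {S : R} (hS : ∀ f, S * i f = i (σ f) * S) {v v' : R}
    (h : S * v = v') (h' : S * v' = v) (a c g g' : F) :
    (i a + i c * S) * (i g * v + i g' * v') =
      i (a * g + c * σ g') * v + i (a * g' + c * σ g) * v' := by
  have e1 : S * (i g * v) = i (σ g) * v' := by rw [← mul_assoc, hS, mul_assoc, h]
  have e2 : S * (i g' * v') = i (σ g') * v := by rw [← mul_assoc, hS, mul_assoc, h']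
  simp only [add_mul, mul_add, mul_assoc, e1, e2, map_add, map_mul]
  abel

lemma reflStep_fixed {σ : F →+* F} {S : R} (hS : ∀ f, S * i f = i (σ f) * S) {v : R}
    (h : S * v = v) (a c g : F) :
    (i a + i c * S) * (i g * v) = i (a * g + c * σ g) * v := by
  have e1 : S * (i g * v) = i (σ g) * v := by rw [← mul_assoc, hS, mul_assoc, h]
  simp only [add_mul, mul_assoc, e1, map_add, map_mul]

variable {σ τ : F →+* F} {S T : R} (hS : ∀ f, S * i f = i (σ f) * S)
  (hT : ∀ f, T * i f = i (τ f) * T) (hSS : S * S = 1) (hTT : T * T = 1)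
  (hσ : ∀ f, σ (σ f) = f) {v : R} (hv : S * v = v)

include hS hT hSS hTT hv

/-- With `a' + c' = k`, the operator `i a' + i c' * T` multiplies by `k` any `g w + g' (T w)` with
`τ g = g'`, and any `g w` with `T w = w` and `τ g = g`. The hypotheses `h0`, `h2` are these
symmetries for the coefficients of the inner vector. This is the braid relation of order three on
`v`, when the other operator already multiplies `v` by the same `k`. -/
lemma chain_three {a c a' c' k : F}
    (hT2 : T * (S * (T * v)) = S * (T * v)) (hτ : ∀ f, τ (τ f) = f)
    (hk' : a' + c' = k)
    (h0 : τ (a * a' + c * σ a') = a * c') (h2 : τ (c * σ c') = c * σ c') :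
    (i a' + i c' * T) * ((i a + i c * S) * ((i a' + i c' * T) * v)) =
      i k * ((i a + i c * S) * ((i a' + i c' * T) * v)) := by
  have hvT : T * (T * v) = v := by rw [← mul_assoc, hTT, one_mul]
  have hvS : S * (S * (T * v)) = T * v := by rw [← mul_assoc S S, hSS, one_mul]
  have e1 : (i a' + i c' * T) * v = i a' * v + i c' * (T * v) := by rw [add_mul, mul_assoc]
  have e2 : (i a + i c * S) * ((i a' + i c' * T) * v) =
      i (a * a' + c * σ a') * v + i (a * c') * (T * v) + i (c * σ c') * (S * (T * v)) := by
    have := reflStep_pair hS rfl hvS a c c' 0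
    rw [e1, mul_add, reflStep_fixed hS hv, add_assoc]
    congr 1
    simpa using this
  rw [e2, mul_add, reflStep_pair hT rfl hvT, reflStep_fixed hT hT2]
  have h0' : τ (a * c') = a * a' + c * σ a' := by rw [← h0, hτ]
  rw [h0, h0', h2, ← add_mul, ← add_mul, ← add_mul, hk']
  simp only [mul_add, map_mul, map_add, add_mul, mul_assoc]

include hσ

/-- Same principle as for three letters. The symmetry of the coefficient of `v` need not be assumed:
it follows from that of the others, because the sum of all coefficients is constant. -/
lemma chain_four {a c a' c' k k' : F} (hS3 : S * (T * (S * (T * v))) = T * (S * (T * v)))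
    (hk : a + c = k) (hk' : a' + c' = k') (hσk : σ k = k) (hσk' : σ k' = k') (hτk : τ k = k)
    (hτk' : τ k' = k')
    (h1 : σ (a' * (a * c') + c' * τ (a * a' + c * σ a')) = a' * (c * σ c'))
    (h3 : σ (c' * τ (c * σ c')) = c' * τ (c * σ c')) :
    (i a + i c * S) * ((i a' + i c' * T) * ((i a + i c * S) * ((i a' + i c' * T) * v))) =
      i k * ((i a' + i c' * T) * ((i a + i c * S) * ((i a' + i c' * T) * v))) := by
  have hvT : T * (T * v) = v := by rw [← mul_assoc, hTT, one_mul]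
  have hvS : S * (S * (T * v)) = T * v := by rw [← mul_assoc S S, hSS, one_mul]
  have hvT2 : T * (T * (S * (T * v))) = S * (T * v) := by rw [← mul_assoc T T, hTT, one_mul]
  have e1 : (i a' + i c' * T) * v = i a' * v + i c' * (T * v) := by rw [add_mul, mul_assoc]
  have e2 : (i a + i c * S) * ((i a' + i c' * T) * v) =
      i (a * a' + c * σ a') * v + (i (a * c') * (T * v) + i (c * σ c') * (S * (T * v))) := by
    have := reflStep_pair hS rfl hvS a c c' 0
    rw [e1, mul_add, reflStep_fixed hS hv]
    congr 1
    simpa using this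
  have e3 : (i a' + i c' * T) * ((i a + i c * S) * ((i a' + i c' * T) * v)) =
      i (a' * (a * a' + c * σ a') + c' * τ (a * c')) * v +
      (i (a' * (a * c') + c' * τ (a * a' + c * σ a')) * (T * v) +
        i (a' * (c * σ c')) * (S * (T * v))) +
      i (c' * τ (c * σ c')) * (T * (S * (T * v))) := by
    have := reflStep_pair hT rfl hvT2 a' c' (c * σ c') 0
    rw [e2, ← add_assoc, mul_add, reflStep_pair hT rfl hvT]
    simp only [map_zero, mul_zero, zero_mul, add_zero, zero_add] at this
    rw [this]
    abel
  -- The sum of the coefficients is what the word yields on the constant function `1`, hence the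
  -- product of the scalars.
  have hsum : (a' * (a * a' + c * σ a') + c' * τ (a * c')) +
      (a' * (a * c') + c' * τ (a * a' + c * σ a')) + a' * (c * σ c') + c' * τ (c * σ c') =
        k' * (k * k') := by
    have h : a * a' + c * σ a' + a * c' + c * σ c' = k * k' := by
      have : σ a' + σ c' = k' := by rw [← map_add, hk', hσk']
      rw [← hk, add_mul, ← this]
      linear_combination a * hk' + a * (-this)
    have h2 := congrArg τ h
    simp only [map_add, map_mul, hτk, hτk'] at h2 ⊢
    linear_combination a' * h + c' * h2 + k * k' * hk'
  generalize a' * (a * a' + c * σ a') + c' * τ (a * c') = g0 at *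
  generalize a' * (a * c') + c' * τ (a * a' + c * σ a') = g1 at *
  generalize a' * (c * σ c') = g2 at *
  generalize c' * τ (c * σ c') = g3 at *
  -- The total is fixed by `σ` and the other coefficients are permuted among themselves, so the
  -- remaining one is fixed.
  have h0 : σ g0 = g0 := by
    have h := congrArg σ hsum
    have h2 : σ g2 = g1 := by rw [← h1, hσ]
    simp only [map_add, map_mul, h1, h2, h3, hσk, hσk'] at h
    linear_combination h - hsum
  have h2 : σ g2 = g1 := by rw [← h1, hσ]
  rw [e3, mul_add, mul_add, reflStep_fixed hS hv, reflStep_fixed hS hS3, reflStep_pair hS rfl hvS,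
    h0, h1, h2, h3]
  simp only [← add_mul, hk]
  simp only [mul_add, map_mul, mul_assoc]

/-- The letters `A`, `B`, `g` name the coefficients after three, four and five operators; the
argument is that of `chain_four`. -/
lemma chain_six {a c a' c' k k' A0 A1 A2 A3 B0 B1 B2 B3 B4 g0 g1 g2 g3 g4 g5 : F}
    (hS5 : S * (T * (S * (T * (S * (T * v))))) = T * (S * (T * (S * (T * v)))))
    (hk : a + c = k) (hk' : a' + c' = k') (hσk : σ k = k) (hσk' : σ k' = k') (hτk : τ k = k)
    (hτk' : τ k' = k')
    (hA0 : A0 = a' * (a * a' + c * σ a') + c' * τ (a * c'))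
    (hA1 : A1 = a' * (a * c') + c' * τ (a * a' + c * σ a'))
    (hA2 : A2 = a' * (c * σ c')) (hA3 : A3 = c' * τ (c * σ c'))
    (hB0 : B0 = a * A0 + c * σ A0) (hB1 : B1 = a * A1 + c * σ A2) (hB2 : B2 = a * A2 + c * σ A1)
    (hB3 : B3 = a * A3) (hB4 : B4 = c * σ A3)
    (hg0 : g0 = a' * B0 + c' * τ B1) (hg1 : g1 = a' * B1 + c' * τ B0)
    (hg2 : g2 = a' * B2 + c' * τ B3) (hg3 : g3 = a' * B3 + c' * τ B2)
    (hg4 : g4 = a' * B4) (hg5 : g5 = c' * τ B4)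
    (h1 : σ g1 = g2) (h3 : σ g3 = g4) (h5 : σ g5 = g5) :
    (i a + i c * S) * ((i a' + i c' * T) * ((i a + i c * S) * ((i a' + i c' * T) *
      ((i a + i c * S) * ((i a' + i c' * T) * v))))) =
      i k * ((i a' + i c' * T) * ((i a + i c * S) * ((i a' + i c' * T) *
        ((i a + i c * S) * ((i a' + i c' * T) * v))))) := by
  have hvT : T * (T * v) = v := by rw [← mul_assoc, hTT, one_mul]
  have hvS : S * (S * (T * v)) = T * v := by rw [← mul_assoc S S, hSS, one_mul]
  have hvT2 : T * (T * (S * (T * v))) = S * (T * v) := by rw [← mul_assoc T T, hTT, one_mul]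
  have hvS2 : S * (S * (T * (S * (T * v)))) = T * (S * (T * v)) := by
    rw [← mul_assoc S S, hSS, one_mul]
  have hvT3 : T * (T * (S * (T * (S * (T * v))))) = S * (T * (S * (T * v))) := by
    rw [← mul_assoc T T, hTT, one_mul]
  have e1 : (i a' + i c' * T) * v = i a' * v + i c' * (T * v) := by rw [add_mul, mul_assoc]
  have e2 : (i a + i c * S) * ((i a' + i c' * T) * v) =
      i (a * a' + c * σ a') * v + (i (a * c') * (T * v) + i (c * σ c') * (S * (T * v))) := by
    have := reflStep_pair hS rfl hvS a c c' 0
    rw [e1, mul_add, reflStep_fixed hS hv]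
    congr 1
    simpa using this
  have e3 : (i a' + i c' * T) * ((i a + i c * S) * ((i a' + i c' * T) * v)) =
      i A0 * v + (i A1 * (T * v) + i A2 * (S * (T * v))) + i A3 * (T * (S * (T * v))) := by
    have := reflStep_pair hT rfl hvT2 a' c' (c * σ c') 0
    rw [e2, ← add_assoc, mul_add, reflStep_pair hT rfl hvT, ← hA0, ← hA1]
    simp only [map_zero, mul_zero, zero_mul, add_zero, zero_add] at this
    rw [this, ← hA2, ← hA3]
    abel
  have e4 : (i a + i c * S) * ((i a' + i c' * T) * ((i a + i c * S) * ((i a' + i c' * T) * v))) =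
      (i B0 * v + i B1 * (T * v)) + (i B2 * (S * (T * v)) + i B3 * (T * (S * (T * v)))) +
        i B4 * (S * (T * (S * (T * v)))) := by
    have := reflStep_pair hS rfl hvS2 a c A3 0
    simp only [map_zero, mul_zero, add_zero, zero_add] at this
    rw [zero_mul, add_zero] at this
    rw [e3, mul_add, mul_add, reflStep_fixed hS hv, reflStep_pair hS rfl hvS, this, ← hB0, ← hB1,
      ← hB2, ← hB3, ← hB4]
    abel
  have e5 : (i a' + i c' * T) * ((i a + i c * S) * ((i a' + i c' * T) *
        ((i a + i c * S) * ((i a' + i c' * T) * v)))) =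
      i g0 * v + (i g1 * (T * v) + i g2 * (S * (T * v))) +
        (i g3 * (T * (S * (T * v))) + i g4 * (S * (T * (S * (T * v))))) +
        i g5 * (T * (S * (T * (S * (T * v))))) := by
    have := reflStep_pair hT rfl hvT3 a' c' B4 0
    simp only [map_zero, mul_zero, add_zero, zero_add] at this
    rw [zero_mul, add_zero] at this
    rw [e4, mul_add, mul_add, reflStep_pair hT rfl hvT, reflStep_pair hT rfl hvT2, this, ← hg0,
      ← hg1, ← hg2, ← hg3, ← hg4, ← hg5]
    abel
  have hsA : A0 + A1 + A2 + A3 = k' * (k * k') := by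
    have h : a * a' + c * σ a' + a * c' + c * σ c' = k * k' := by
      have : σ a' + σ c' = k' := by rw [← map_add, hk', hσk']
      rw [← hk, add_mul, ← this]
      linear_combination a * hk' + a * (-this)
    have h2 := congrArg τ h
    rw [hA0, hA1, hA2, hA3]
    simp only [map_add, map_mul, hτk, hτk'] at h2 ⊢
    linear_combination a' * h + c' * h2 + k * k' * hk'
  have hsB : B0 + B1 + B2 + B3 + B4 = k * (k' * (k * k')) := by
    have h2 := congrArg σ hsA
    simp only [map_add, map_mul, hσk, hσk'] at h2
    rw [hB0, hB1, hB2, hB3, hB4]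
    linear_combination a * hsA + c * h2 + k' * (k * k') * hk
  have hsum : g0 + g1 + g2 + g3 + g4 + g5 = k' * (k * (k' * (k * k'))) := by
    have h2 := congrArg τ hsB
    simp only [map_add, map_mul, hτk, hτk'] at h2
    rw [hg0, hg1, hg2, hg3, hg4, hg5]
    linear_combination a' * hsB + c' * h2 + k * (k' * (k * k')) * hk'
  have h2 : σ g2 = g1 := by rw [← h1, hσ]
  have h4 : σ g4 = g3 := by rw [← h3, hσ]
  have h0 : σ g0 = g0 := by
    have h := congrArg σ hsum
    simp only [map_add, map_mul, h1, h2, h3, h4, h5, hσk, hσk'] at h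
    linear_combination h - hsum
  rw [e5, mul_add, mul_add, mul_add, reflStep_fixed hS hv, reflStep_fixed hS hS5,
    reflStep_pair hS rfl hvS, reflStep_pair hS rfl hvS2, h0, h1, h2, h3, h4, h5]
  simp only [← add_mul, hk]
  simp only [mul_add, map_mul, mul_assoc]

end RankTwo

set_option linter.unusedSimpArgs false
set_option linter.unusedVariables false

/-! ### Coefficient identities in types A2, B2 and G2 -/

section RankTwoIdentities

variable {F R : Type*} [CommRing F] [Ring R] {i : F →+* R}
  {σ τ : F →+* F} {S T : R} (hS : ∀ f, S * i f = i (σ f) * S)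
  (hT : ∀ f, T * i f = i (τ f) * T) (hSS : S * S = 1) (hTT : T * T = 1)
  {v : R} (hv : S * v = v) {ks hs kt ht : F}

include hS hT hSS hTT hv

/-- Here and below `tmn` stands for `1 / (1 - x ^ m * y ^ n)`, with `x`, `y` the exponentials of the
two simple roots. The hypotheses `s..` and `u..` record the two reflections, and the `r..` are
partial fraction relations. -/
lemma spherical_A2 (hτ : ∀ f, τ (τ f) = f) (hσk : σ ks = ks) (hτk : τ ks = ks) (hσh : σ hs = hs)
    (hτh : τ hs = hs) {t10 t01 t11 : F}
    (hT2 : T * (S * (T * v)) = S * (T * v))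
    (s01 : σ t01 = t11) (u10 : τ t10 = t11) (u01 : τ t01 = 1 - t01)
    (u11 : τ t11 = t10) (r : t10 * t01 = t11 * (t10 + t01 - 1)) :
    (i (hs * t01) + i (ks - hs * t01) * T) * ((i (hs * t10) + i (ks - hs * t10) * S) *
        ((i (hs * t01) + i (ks - hs * t01) * T) * v)) =
      i ks * ((i (hs * t10) + i (ks - hs * t10) * S) *
        ((i (hs * t01) + i (ks - hs * t01) * T) * v)) := by
  refine chain_three hS hT hSS hTT hv hT2 hτ (by ring) ?_ ?_
  · simp only [map_mul, map_sub, map_add, hσk, hτk, hσh, hτh, s01, u10, u01, u11]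
    linear_combination hs ^ 2 * r
  · simp only [map_mul, map_sub, hσk, hτk, hσh, hτh, s01, u10, u11]
    ring

variable (hσ : ∀ f, σ (σ f) = f)
  (hσk : σ ks = ks) (hσk' : σ kt = kt) (hτk : τ ks = ks) (hτk' : τ kt = kt)
  (hσh : σ hs = hs) (hσh' : σ ht = ht) (hτh : τ hs = hs) (hτh' : τ ht = ht)

include hσ hσk hσk' hτk hτk' hσh hσh' hτh hτh'

lemma spherical_B2_of_sq {t10 t01 t11 t21 : F}
    (hS3 : S * (T * (S * (T * v))) = T * (S * (T * v)))
        (s10 : σ t10 = 1 - t10) (s01 : σ t01 = t21) (s11 : σ t11 = t11) (s21 : σ t21 = t01)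
    (u10 : τ t10 = t11) (u01 : τ t01 = 1 - t01) (u11 : τ t11 = t10) (u21 : τ t21 = t21)
    (r10_01 : t10 * t01 = t11 * (t10 + t01 - 1)) (r10_11 : t10 * t11 = t21 * (t10 + t11 - 1)) :
    (i (hs * t10) + i (ks - hs * t10) * S) * ((i (ht * t01) + i (kt - ht * t01) * T) *
        ((i (hs * t10) + i (ks - hs * t10) * S) * ((i (ht * t01) + i (kt - ht * t01) * T) * v))) =
      i ks * ((i (ht * t01) + i (kt - ht * t01) * T) *
        ((i (hs * t10) + i (ks - hs * t10) * S) * ((i (ht * t01) + i (kt - ht * t01) * T) * v))) := by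
  refine chain_four hS hT hSS hTT hσ hv hS3 (by ring) (by ring) hσk hσk' hτk hτk' ?_ ?_
  · simp only [map_mul, map_sub, map_add, map_one, hσk, hσk', hτk, hτk', hσh, hσh', hτh, hτh', s10, s01, s11, s21, u10, u01, u11, u21]
    -- The common factor is `σ c'`; the other factor lies in the ideal of the partial fraction
    -- relations.
    linear_combination (kt - ht * t21) * (hs * ht * r10_01 + hs * ht * r10_11)
  · simp only [map_mul, map_sub, map_add, map_one, hσk, hσk', hτk, hτk', hσh, hσh', hτh, hτh', s10, s01, s11, s21, u10, u01, u11, u21]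
    ring

lemma spherical_B2_of_sq' {t10 t01 t11 t12 : F}
    (hS3 : S * (T * (S * (T * v))) = T * (S * (T * v)))
        (s10 : σ t10 = 1 - t10) (s01 : σ t01 = t11) (s11 : σ t11 = t01) (s12 : σ t12 = t12)
    (u10 : τ t10 = t12) (u01 : τ t01 = 1 - t01) (u11 : τ t11 = t11) (u12 : τ t12 = t10)
    (r10_01 : t10 * t01 = t11 * (t10 + t01 - 1)) (r01_11 : t01 * t11 = t12 * (t01 + t11 - 1)) :
    (i (hs * t10) + i (ks - hs * t10) * S) * ((i (ht * t01) + i (kt - ht * t01) * T) *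
        ((i (hs * t10) + i (ks - hs * t10) * S) * ((i (ht * t01) + i (kt - ht * t01) * T) * v))) =
      i ks * ((i (ht * t01) + i (kt - ht * t01) * T) *
        ((i (hs * t10) + i (ks - hs * t10) * S) * ((i (ht * t01) + i (kt - ht * t01) * T) * v))) := by
  refine chain_four hS hT hSS hTT hσ hv hS3 (by ring) (by ring) hσk hσk' hτk hτk' ?_ ?_
  · simp only [map_mul, map_sub, map_add, map_one, hσk, hσk', hτk, hτk', hσh, hσh', hτh, hτh', s10, s01, s11, s12, u10, u01, u11, u12]
    linear_combination (kt - ht * t11) * (hs * ht * r10_01 + hs * ht * r01_11)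
  · simp only [map_mul, map_sub, map_add, map_one, hσk, hσk', hτk, hτk', hσh, hσh', hτh, hτh', s10, s01, s11, s12, u10, u01, u11, u12]
    ring

lemma spherical_G2_of_cube {t10 t01 t11 t21 t31 t32 : F}
    (hS5 : S * (T * (S * (T * (S * (T * v))))) = T * (S * (T * (S * (T * v)))))
        (s10 : σ t10 = 1 - t10) (s01 : σ t01 = t31) (s11 : σ t11 = t21) (s21 : σ t21 = t11) (s31
    : σ t31 = t01) (s32 : σ t32 = t32)     (u10 : τ t10 = t11) (u01 : τ t01 = 1 - t01) (u11 : τ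
    t11 = t10) (u21 : τ t21 = t21) (u31 : τ t31 = t32) (u32 : τ t32 = t31)     (r10_01 : t10 *
    t01 = t11 * (t10 + t01 - 1)) (r10_11 : t10 * t11 = t21 * (t10 + t11 - 1)) (r10_21 : t10 *
    t21 = t31 * (t10 + t21 - 1)) (r11_21 : t11 * t21 = t32 * (t11 + t21 - 1)) (r01_31 : t01 *
    t31 = t32 * (t01 + t31 - 1)) :
    (i (hs * t10) + i (ks - hs * t10) * S) * ((i (ht * t01) + i (kt - ht * t01) * T) *
        ((i (hs * t10) + i (ks - hs * t10) * S) * ((i (ht * t01) + i (kt - ht * t01) * T) *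
          ((i (hs * t10) + i (ks - hs * t10) * S) * ((i (ht * t01) + i (kt - ht * t01) * T) * v))))) =
      i ks * ((i (ht * t01) + i (kt - ht * t01) * T) *
        ((i (hs * t10) + i (ks - hs * t10) * S) * ((i (ht * t01) + i (kt - ht * t01) * T) *
          ((i (hs * t10) + i (ks - hs * t10) * S) * ((i (ht * t01) + i (kt - ht * t01) * T) * v))))) := by
  refine chain_six hS hT hSS hTT hσ hv hS5 (by ring) (by ring) hσk hσk' hτk hτk' rfl rfl rfl rfl
    rfl rfl rfl rfl rfl rfl rfl rfl rfl rfl rfl ?_ ?_ ?_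
  · simp only [map_mul, map_sub, map_add, map_one, hσk, hσk', hτk, hτk', hσh, hσh', hτh, hτh', s10, s01, s11, s21, s31, s32, u10, u01, u11, u21, u31, u32]
    -- Again `σ c'` factors out, and the multipliers exhibit the rest as a combination of the five
    -- partial fraction relations.
    linear_combination (kt - ht * t31) * ((hs^2 * ht^2 * (t10 * t01 + t10 * t11 + (-2) * t10 * t31 + t21 + 2 * t31
      - t11 * t21 - t21 * t31 - t31 * t32) + ks * hs * ht^2 * (-t01 + t32)) * r10_01 + (hs^2 * ht^2 * (t10 * t11 +
      t10 * t21 + (-2) * t10 * t31 - t11 + 2 * t31 + t01 * t11 + (-2) * t21 * t31 - t21 * t32 + t21) +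
      ks * hs * ht^2 * (t32 - t01) + hs^2 * kt^2 * (1) + hs^2 * kt * ht * ((-1))) * r10_11 + (hs^2 * ht^2 * (t10 * t21 -
      t10 * t31 + t31 + 2 * t01 * t11 - t01 * t32 + t11 * t21 + (-2) * t11 - t21 * t31 + t11 * t32 - t21 * t32) +
      ks * hs * ht^2 * (t32 - t01)) * r10_21 + (hs^2 * ht^2 * (t01 * t31 - t21 * t31 - t21 * t32 + t21) +
      ks * hs * ht^2 * (-t01 + t32)) * r11_21 + (ks * hs * ht^2 * ((-1)) + ks^2 * ht^2 * (1)) * r01_31)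
  · simp only [map_mul, map_sub, map_add, map_one, hσk, hσk', hτk, hτk', hσh, hσh', hτh, hτh', s10, s01, s11, s21, s31, s32, u10, u01, u11, u21, u31, u32]
    linear_combination (kt - ht * t31) * ((ks * hs * kt * ht * (1) + ks * hs * ht^2 * (-t32) + hs^2 * kt * ht * (-t21) +
      hs^2 * ht^2 * (t21 * t32)) * r10_01 + (ks * hs * kt * ht * (1) + ks * hs * ht^2 * (-t32) + hs^2 * kt * ht * (-t21) +
      hs^2 * ht^2 * (t21 * t32)) * r10_11 + (ks * hs * kt * ht * (1) + ks * hs * ht^2 * (-t32) + hs^2 * kt * ht * (-t21) +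
      hs^2 * ht^2 * (t21 * t32)) * r10_21 + (ks * hs * kt * ht * (1) + ks * hs * ht^2 * (-t32) + hs^2 * kt * ht * (-t21) +
      hs^2 * ht^2 * (t21 * t32)) * r11_21)
  · simp only [map_mul, map_sub, map_add, map_one, hσk, hσk', hτk, hτk', hσh, hσh', hτh, hτh', s10, s01, s11, s21, s31, s32, u10, u01, u11, u21, u31, u32]
    ring

lemma spherical_G2_of_cube' {t10 t01 t11 t12 t13 t23 : F}
    (hS5 : S * (T * (S * (T * (S * (T * v))))) = T * (S * (T * (S * (T * v)))))
        (s10 : σ t10 = 1 - t10) (s01 : σ t01 = t11) (s11 : σ t11 = t01) (s12 : σ t12 = t12) (s13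
    : σ t13 = t23) (s23 : σ t23 = t13)     (u10 : τ t10 = t13) (u01 : τ t01 = 1 - t01) (u11 : τ
    t11 = t12) (u12 : τ t12 = t11) (u13 : τ t13 = t10) (u23 : τ t23 = t23)     (r10_01 : t10 *
    t01 = t11 * (t10 + t01 - 1)) (r01_11 : t01 * t11 = t12 * (t01 + t11 - 1)) (r01_12 : t01 *
    t12 = t13 * (t01 + t12 - 1)) (r11_12 : t11 * t12 = t23 * (t11 + t12 - 1)) (r10_13 : t10 *
    t13 = t23 * (t10 + t13 - 1)) :
    (i (hs * t10) + i (ks - hs * t10) * S) * ((i (ht * t01) + i (kt - ht * t01) * T) *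
        ((i (hs * t10) + i (ks - hs * t10) * S) * ((i (ht * t01) + i (kt - ht * t01) * T) *
          ((i (hs * t10) + i (ks - hs * t10) * S) * ((i (ht * t01) + i (kt - ht * t01) * T) * v))))) =
      i ks * ((i (ht * t01) + i (kt - ht * t01) * T) *
        ((i (hs * t10) + i (ks - hs * t10) * S) * ((i (ht * t01) + i (kt - ht * t01) * T) *
          ((i (hs * t10) + i (ks - hs * t10) * S) * ((i (ht * t01) + i (kt - ht * t01) * T) * v))))) := by
  refine chain_six hS hT hSS hTT hσ hv hS5 (by ring) (by ring) hσk hσk' hτk hτk' rfl rfl rfl rfl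
    rfl rfl rfl rfl rfl rfl rfl rfl rfl rfl rfl ?_ ?_ ?_
  · simp only [map_mul, map_sub, map_add, map_one, hσk, hσk', hτk, hτk', hσh, hσh', hτh, hτh', s10, s01, s11, s12, s13, s23, u10, u01, u11, u12, u13, u23]
    linear_combination (kt - ht * t11) * ((hs^2 * ht^2 * (t10 * t01 - t10 * t11 + t01 * t11 - t01 * t13 -
      t11 * t23 + t11 + t23 - t13 * t23 - t11 * t12 + t13) + ks * hs * ht^2 * (-t01 + t12)) * r10_01 +
      (hs^2 * ht^2 * (t01 * t11 + t01 * t12 - t01 * t13 - t11 * t23 - t12 * t13 + t13 + t23 - t12 * t23) +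
      ks * hs * ht^2 * (-t01 + (-1) + t12) + ks^2 * ht^2 * (1)) * r01_11 + (hs^2 * ht^2 * (-t10 * t23 + t10 * t11 +
      t01 * t12 - t12 + t23 + t11 * t12 - t11 - t12 * t23) + ks * hs * ht^2 * (-t01 + t12)) * r01_12 +
      (hs^2 * ht^2 * (t10 * t13 - t10 * t11 + t01 * t13 - t11 * t23 + t11 - t13 + t23 - t12 * t23) +
      ks * hs * ht^2 * (-t01 + t12)) * r11_12 + (hs^2 * kt^2 * (1) + hs^2 * kt * ht * ((-1))) * r10_13)
  · simp only [map_mul, map_sub, map_add, map_one, hσk, hσk', hτk, hτk', hσh, hσh', hτh, hτh', s10, s01, s11, s12, s13, s23, u10, u01, u11, u12, u13, u23]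
    linear_combination (kt - ht * t11) * ((ks * hs * kt * ht * (1) + ks * hs * ht^2 * (-t12) + hs^2 * kt * ht * (-t23) +
      hs^2 * ht^2 * (t12 * t23)) * r10_01 + (ks * hs * kt * ht * (1) + ks * hs * ht^2 * (-t12) + hs^2 * kt * ht * (-t23) +
      hs^2 * ht^2 * (t12 * t23)) * r01_11 + (ks * hs * kt * ht * (1) + ks * hs * ht^2 * (-t12) + hs^2 * kt * ht * (-t23) +
      hs^2 * ht^2 * (t12 * t23)) * r01_12 + (ks * hs * kt * ht * (1) + ks * hs * ht^2 * (-t12) + hs^2 * kt * ht * (-t23) +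
      hs^2 * ht^2 * (t12 * t23)) * r11_12)
  · simp only [map_mul, map_sub, map_add, map_one, hσk, hσk', hτk, hτk', hσh, hσh', hτh, hτh', s10, s01, s11, s12, s13, s23, u10, u01, u11, u12, u13, u23]
    ring

end RankTwoIdentities

/-! ### The finite Weyl group acting on roots and coweights -/

section FiniteWeyl

variable {P : RootPairing ι ℝ M N}

lemma root_smul (w : P.weylGroup) (i : ι) : P.root (w • i) = w • P.root i :=
  (P.weylGroup_apply_root w i).symm

lemma ofIdx_smul_index (i j : ι) : weylGroup.ofIdx P i • j = P.reflectionPerm i j := rfl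

lemma root_negIndex (i : ι) : P.root (P.reflectionPerm i i) = -P.root i := by simp

lemma smul_negIndex (w : P.weylGroup) (i : ι) :
    w • P.reflectionPerm i i = P.reflectionPerm (w • i) (w • i) := by
  apply P.root.injective
  rw [root_smul, root_negIndex, root_negIndex, root_smul, smul_neg]

lemma negIndex_negIndex (i : ι) :
    P.reflectionPerm (P.reflectionPerm i i) (P.reflectionPerm i i) = i := by
  apply P.root.injective
  rw [root_negIndex, root_negIndex, neg_neg]

lemma pair_of_root_eq (x : Cowt P) {i j l : ι} {c d : ℤ}
    (h : P.root l = c • P.root i + d • P.root j) : pair x l = c * pair x i + d * pair x j := by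
  apply pair_eq
  have h2 (i : ι) : P.root' i (x : N) = P.flip.toLinearMap (x : N) (P.root i) := rfl
  rw [h2, h, map_add, map_zsmul, map_zsmul, ← h2, ← h2, pair_spec, pair_spec]
  push_cast
  simp

lemma pair_negIndex (x : Cowt P) (i : ι) : pair x (P.reflectionPerm i i) = -pair x i := by
  have := pair_of_root_eq x (i := i) (j := i) (l := P.reflectionPerm i i) (c := -1) (d := 0)
    (by simp)
  simpa using this

@[simp] lemma pair_neg (x : Cowt P) (i : ι) : pair (-x) i = -pair x i :=
  pair_eq _ _ (by simp [pair_spec])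

@[simp] lemma pair_sub (x y : Cowt P) (i : ι) : pair (x - y) i = pair x i - pair y i := by
  rw [sub_eq_add_neg, pair_add, pair_neg, sub_eq_add_neg]

@[simp] lemma pair_zsmul (n : ℤ) (x : Cowt P) (i : ι) : pair (n • x) i = n * pair x i :=
  pair_eq _ _ (by simp [pair_spec])

@[simp] lemma pair_nsmul (n : ℕ) (x : Cowt P) (i : ι) : pair (n • x) i = n * pair x i :=
  pair_eq _ _ (by simp [pair_spec])

lemma cowt_ext [P.IsRootSystem] {x y : Cowt P} (h : ∀ i, pair x i = pair y i) : x = y := by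
  apply Subtype.ext
  apply P.flip.toPerfPair.injective
  apply LinearMap.ext_on_range (v := P.root) (by simp)
  intro i
  change P.root' i (x : N) = P.root' i (y : N)
  rw [pair_spec, pair_spec, h]

lemma weyl_ext [P.IsRootSystem] {u v : P.weylGroup} (h : ∀ i : ι, u • i = v • i) : u = v := by
  apply Subtype.ext
  apply Equiv.weightHom_injective P
  apply LinearEquiv.toLinearMap_injective
  apply LinearMap.ext_on_range (v := P.root) (by simp)
  intro i
  have h1 := root_smul u i
  have h2 := root_smul v i
  rw [h] at h1
  exact h1.symm.trans h2

variable [P.IsCrystallographic]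

lemma root_reflectionPerm_eq (i j : ι) :
    P.root (P.reflectionPerm i j) = P.root j - P.pairingIn ℤ j i • P.root i := by
  rw [root_reflectionPerm, reflection_apply_root' ℤ]

lemma pairingIn_smul_smul (w : P.weylGroup) (i j : ι) :
    P.pairingIn ℤ (w • i) (w • j) = P.pairingIn ℤ i j := by
  obtain ⟨w, hw⟩ := w
  revert i j
  induction hw using weylGroup.induction with
  | mem l =>
    intro i j
    change P.pairingIn ℤ (P.reflectionPerm l i) (P.reflectionPerm l j) = _
    apply (algebraMap ℤ ℝ).injective_int
    rw [algebraMap_pairingIn, algebraMap_pairingIn, pairing_reflectionPerm, reflectionPerm_self]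
  | one => intro i j; rfl
  | mul x y hx hy h1 h2 =>
    intro i j
    exact (h1 _ _).trans (h2 i j)

lemma smul_reflectionPerm (w : P.weylGroup) (i j : ι) :
    w • P.reflectionPerm i j = P.reflectionPerm (w • i) (w • j) := by
  apply P.root.injective
  have hz (n : ℤ) (x : M) : w • (n • x) = n • (w • x) :=
    map_zsmul (DistribSMul.toAddMonoidHom M w) n x
  rw [root_smul, root_reflectionPerm_eq, root_reflectionPerm_eq, smul_sub, pairingIn_smul_smul,
    root_smul, root_smul, hz]

lemma pair_reflectionPerm (x : Cowt P) (i j : ι) :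
    pair x (P.reflectionPerm i j) = pair x j - P.pairingIn ℤ j i * pair x i := by
  rw [pair_of_root_eq x (i := j) (j := i) (c := 1) (d := -P.pairingIn ℤ j i)
    (by rw [root_reflectionPerm_eq]; module)]
  ring

lemma ofIdx_mul_self [P.IsRootSystem] (i : ι) :
    weylGroup.ofIdx P i * weylGroup.ofIdx P i = 1 := by
  apply weyl_ext
  intro j
  rw [mul_smul, one_smul, ofIdx_smul_index, ofIdx_smul_index, reflectionPerm_self]

lemma ofIdx_smul_cowt [P.IsRootSystem] (i : ι) (x : Cowt P) :
    weylGroup.ofIdx P i • x = x - pair x i • corootCowt i := by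
  apply cowt_ext
  intro j
  have : (weylGroup.ofIdx P i)⁻¹ = weylGroup.ofIdx P i := inv_eq_of_mul_eq_one_left (ofIdx_mul_self i)
  rw [pair_smul, this, ofIdx_smul_index, pair_reflectionPerm, pair_sub, pair_zsmul, pair_coroot]
  ring

lemma smul_corootCowt [P.IsRootSystem] (w : P.weylGroup) (i : ι) :
    w • corootCowt (P := P) i = corootCowt (w • i) := by
  apply cowt_ext
  intro j
  rw [pair_smul, pair_coroot, pair_coroot, ← pairingIn_smul_smul w, smul_inv_smul]

lemma corootCowt_negIndex [P.IsRootSystem] (i : ι) :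
    corootCowt (P := P) (P.reflectionPerm i i) = -corootCowt i := by
  apply Subtype.ext
  simp [corootCowt]

end FiniteWeyl

/-! ### The extended affine Weyl group acting on affine roots -/

section AffineAction

variable {P : RootPairing ι ℝ M N}

@[simp] lemma fin_mul (u v : P.weylGroup) : fin (u * v) = fin u * fin v := map_mul _ _ _
@[simp] lemma fin_one : fin (1 : P.weylGroup) = 1 := map_one _
@[simp] lemma fin_inv (u : P.weylGroup) : fin u⁻¹ = (fin u)⁻¹ := map_inv _ _

lemma tau_add (x y : Cowt P) : tau (x + y) = tau x * tau y := by
  rw [tau, ofAdd_add, map_mul]; rfl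

lemma tau_zero : tau (0 : Cowt P) = 1 := map_one _

lemma tau_neg (x : Cowt P) : tau (-x) = (tau x)⁻¹ := by
  rw [eq_inv_iff_mul_eq_one, ← tau_add, neg_add_cancel, tau_zero]

lemma fin_mul_tau (w : P.weylGroup) (x : Cowt P) : fin w * tau x = tau (w • x) * fin w := by
  apply SemidirectProduct.ext
  · simp [fin, tau]; rfl
  · simp [fin, tau]

lemma act_fin (w : P.weylGroup) (a : AffRoot ι) : act (fin w) a = (w • a.1, a.2) := by
  simp [act, fin]

lemma act_tau (x : Cowt P) (a : AffRoot ι) : act (tau x) a = (a.1, a.2 - pair x a.1) := by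
  simp [act, tau]

lemma act_inv_act (w : ExtWeyl P) (a : AffRoot ι) : act w⁻¹ (act w a) = a := by
  rw [← act_mul, inv_mul_cancel, act_one]

lemma act_act_inv (w : ExtWeyl P) (a : AffRoot ι) : act w (act w⁻¹ a) = a := by
  rw [← act_mul, mul_inv_cancel, act_one]

/-- The finite part is read off from the roots and the translation part from the levels. Identities
in `W` can thus be checked on affine roots. -/
lemma act_faithful [P.IsRootSystem] {v w : ExtWeyl P} (h : ∀ a, act v a = act w a) : v = w := by
  have hr : v.right = w.right := weyl_ext fun i => congrArg Prod.fst (h (i, 0))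
  apply SemidirectProduct.ext _ hr
  apply Multiplicative.toAdd.injective
  apply cowt_ext
  intro i
  have := congrArg Prod.snd (h (v.right⁻¹ • i, 0))
  simp only [act, ← hr, smul_inv_smul] at this
  omega

variable (P) in
/-- The negative of an affine root. -/
def negAff (a : AffRoot ι) : AffRoot ι := (P.reflectionPerm a.1 a.1, -a.2)

@[simp] lemma negAff_negAff (a : AffRoot ι) : negAff P (negAff P a) = a := by
  simp [negAff, negIndex_negIndex]

lemma act_negAff (w : ExtWeyl P) (a : AffRoot ι) : act w (negAff P a) = negAff P (act w a) := by
  simp only [act, negAff, smul_negIndex, pair_negIndex, Prod.mk.injEq, true_and]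
  ring

variable [P.IsCrystallographic]

lemma act_affRefl_self (a : AffRoot ι) : act (affRefl (P := P) a) a = negAff P a := by
  rw [act_affRefl, negAff]
  simp only [Prod.mk.injEq, true_and, pairingIn_same]
  ring

variable [P.IsRootSystem]

lemma affRefl_mul_self (a : AffRoot ι) : affRefl (P := P) a * affRefl a = 1 := by
  apply act_faithful
  rintro ⟨i, r⟩
  rw [act_mul, act_affRefl, act_affRefl, act_one]
  simp only [reflectionPerm_self, Prod.mk.injEq, true_and]
  have : P.pairingIn ℤ (P.reflectionPerm a.1 i) a.1 = -P.pairingIn ℤ i a.1 := by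
    apply (algebraMap ℤ ℝ).injective_int
    rw [map_neg, algebraMap_pairingIn, algebraMap_pairingIn, ← pairing_reflectionPerm,
      pairing_reflectionPerm_self_right]
  rw [this]; ring

lemma affRefl_inv (a : AffRoot ι) : (affRefl (P := P) a)⁻¹ = affRefl a :=
  inv_eq_of_mul_eq_one_left (affRefl_mul_self a)

lemma conj_affRefl (w : ExtWeyl P) (a : AffRoot ι) :
    w * affRefl a * w⁻¹ = affRefl (act w a) := by
  rw [mul_inv_eq_iff_eq_mul]
  apply act_faithful
  rintro ⟨i, r⟩
  rw [act_mul, act_mul, act_affRefl, act_affRefl]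
  simp only [act, smul_reflectionPerm, pairingIn_smul_smul, pair_reflectionPerm, Prod.mk.injEq,
    true_and]
  ring

lemma mul_affRefl (w : ExtWeyl P) (a : AffRoot ι) :
    w * affRefl a = affRefl (act w a) * w := by
  rw [← conj_affRefl, inv_mul_cancel_right]

lemma affRefl_fin (i : ι) : affRefl (P := P) (i, 0) = fin (weylGroup.ofIdx P i) := by
  simp [affRefl, tau_zero]

end AffineAction

/-! ### Inversion sets and the length function -/

section LengthFunction

variable {P : RootPairing ι ℝ M N} (b : P.Base) [Fintype ι] [Nonempty ι]

lemma isPos_negIndex (i : ι) : b.IsPos (P.reflectionPerm i i) ↔ ¬ b.IsPos i := by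
  have h2 : b.height (P.reflectionPerm i i) = -b.height i := b.height_reflectionPerm_self i
  have h3 := b.height_ne_zero i
  rw [Base.isPos_iff, Base.isPos_iff, h2]
  omega

lemma isPosAff_negAff (a : AffRoot ι) : IsPosAff b (negAff P a) ↔ ¬ IsPosAff b a := by
  simp only [IsPosAff, negAff, isPos_negIndex]
  rcases lt_trichotomy a.2 0 with h | h | h
  · simp [h, h.not_gt, h.ne]
  · simp [h]
  · simp [h, h.not_gt, h.ne']

/-- The hypothesis says that `v` undoes no inversion of `w`. The inversions of `v * w` are then
those of `w` together with the preimages under `w` of those of `v`. -/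
lemma length_mul_of_forall {v w : ExtWeyl P}
    (h : ∀ a, IsPosAff b a → ¬ IsPosAff b (act w a) → ¬ IsPosAff b (act (v * w) a)) :
    length b (v * w) = length b v + length b w := by
  have hset : invSet b (v * w) = invSet b w ∪ act w⁻¹ '' invSet b v := by
    ext a
    constructor
    · rintro ⟨h1, h2⟩
      by_cases h3 : IsPosAff b (act w a)
      · exact Or.inr ⟨act w a, ⟨h3, by rwa [← act_mul]⟩, act_inv_act w a⟩
      · exact Or.inl ⟨h1, h3⟩
    · rintro (⟨h1, h2⟩ | ⟨c, ⟨h1, h2⟩, rfl⟩)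
      · exact ⟨h1, h a h1 h2⟩
      · refine ⟨?_, by rwa [act_mul, act_act_inv]⟩
        -- If the preimage of an inversion `c` of `v` were negative, its opposite would be an
        -- inversion of `w` which `v` makes positive again.
        by_contra h3
        have h4 := h (negAff P (act w⁻¹ c)) ((isPosAff_negAff b _).2 h3)
          (by rw [act_negAff, act_act_inv, isPosAff_negAff]; exact not_not.2 h1)
        rw [act_negAff, isPosAff_negAff, act_mul, act_act_inv] at h4
        exact h4 h2
  have hdis : Disjoint (invSet b w) (act w⁻¹ '' invSet b v) := by
    rw [Set.disjoint_left]
    rintro _ h1 ⟨c, hc, rfl⟩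
    apply h1.2
    rw [act_act_inv]
    exact hc.1
  rw [length, hset, Set.ncard_union_eq hdis (invSet_finite b w) ((invSet_finite b v).image _),
    Set.ncard_image_of_injective _ (act_injective _), add_comm]
  rfl

lemma length_inv (w : ExtWeyl P) : length b w⁻¹ = length b w := by
  rw [length, length, ← Set.ncard_image_of_injective (invSet b w)
    ((Function.LeftInverse.injective (negAff_negAff (P := P))).comp (act_injective w))]
  congr 1
  ext a
  constructor
  · rintro ⟨h1, h2⟩
    refine ⟨negAff P (act w⁻¹ a), ⟨(isPosAff_negAff b _).2 h2, ?_⟩, ?_⟩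
    · rw [act_negAff, act_act_inv, isPosAff_negAff]; exact not_not.2 h1
    · simp [act_negAff, act_act_inv]
  · rintro ⟨c, ⟨h1, h2⟩, rfl⟩
    refine ⟨(isPosAff_negAff b _).2 h2, ?_⟩
    rw [Function.comp_apply, act_negAff, act_inv_act, isPosAff_negAff]
    exact not_not.2 h1

lemma length_one : length b (1 : ExtWeyl P) = 0 := by
  rw [length, invSet_one, Set.ncard_empty]

lemma length_eq_zero_iff (w : ExtWeyl P) :
    length b w = 0 ↔ ∀ a, IsPosAff b a → IsPosAff b (act w a) := by
  rw [length, Set.ncard_eq_zero (invSet_finite b w), Set.eq_empty_iff_forall_notMem]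
  simp only [invSet, Set.mem_ofPred_eq, not_and, not_not]

lemma isPosAff_act_iff_of_length_eq_zero {w : ExtWeyl P} (hw : length b w = 0) (a : AffRoot ι) :
    IsPosAff b (act w a) ↔ IsPosAff b a := by
  refine ⟨fun h => ?_, (length_eq_zero_iff b w).1 hw a⟩
  have := (length_eq_zero_iff b w⁻¹).1 (by rw [length_inv, hw]) _ h
  rwa [act_inv_act] at this

lemma length_mul_of_length_eq_zero_left {v w : ExtWeyl P} (hv : length b v = 0) :
    length b (v * w) = length b w := by
  rw [length_mul_of_forall, hv, zero_add]
  intro a _ h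
  rwa [act_mul, isPosAff_act_iff_of_length_eq_zero b hv]

lemma length_mul_of_length_eq_zero_right {v w : ExtWeyl P} (hw : length b w = 0) :
    length b (v * w) = length b v := by
  rw [length_mul_of_forall, hw, add_zero]
  intro a h1 h
  rw [isPosAff_act_iff_of_length_eq_zero b hw] at h
  exact absurd h1 h

lemma isPosAff_fin_iff (i : ι) : IsPosAff b (i, 0) ↔ b.IsPos i := by simp [IsPosAff]

lemma length_fin (w : P.weylGroup) : length b (fin w) = length₀ b w := by
  rw [length, length₀, ← Set.ncard_image_of_injective {i | b.IsPos i ∧ ¬ b.IsPos (w • i)}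
    (f := fun i => ((i, 0) : AffRoot ι)) (fun i j h => congrArg Prod.fst h)]
  congr 1
  ext ⟨i, r⟩
  simp only [invSet, act_fin, Set.mem_ofPred_eq, Set.mem_image, Prod.mk.injEq]
  constructor
  · rintro ⟨h1, h2⟩
    have hr : r = 0 := by
      simp only [IsPosAff] at h1 h2
      by_contra
      omega
    subst hr
    exact ⟨i, ⟨(isPosAff_fin_iff b _).1 h1, fun h => h2 ((isPosAff_fin_iff b _).2 h)⟩, rfl, rfl⟩
  · rintro ⟨j, ⟨h1, h2⟩, rfl, rfl⟩
    exact ⟨(isPosAff_fin_iff b _).2 h1, fun h => h2 ((isPosAff_fin_iff b _).1 h)⟩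

variable [P.IsCrystallographic] [P.IsReduced]

lemma simpleRoot_mem_invSet (j : Option b.support) :
    simpleRoot b j ∈ invSet b (simpleRefl b j) := by
  rw [invSet_simpleRefl]; rfl

lemma isPosAff_simpleRoot (j : Option b.support) : IsPosAff b (simpleRoot b j) :=
  (simpleRoot_mem_invSet b j).1

lemma length_simpleRefl (j : Option b.support) : length b (simpleRefl b j) = 1 := by
  rw [length, invSet_simpleRefl, Set.ncard_singleton]

variable [P.IsRootSystem]

lemma act_simpleRefl_self (j : Option b.support) :
    act (simpleRefl b j) (simpleRoot b j) = negAff P (simpleRoot b j) := act_affRefl_self _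

lemma simpleRefl_mul_self (j : Option b.support) : simpleRefl b j * simpleRefl b j = 1 :=
  affRefl_mul_self _

lemma simpleRefl_inv (j : Option b.support) : (simpleRefl b j)⁻¹ = simpleRefl b j :=
  affRefl_inv _

lemma simpleRefl_mul_cancel (j : Option b.support) (w : ExtWeyl P) :
    simpleRefl b j * (simpleRefl b j * w) = w := by
  rw [← mul_assoc, simpleRefl_mul_self, one_mul]

lemma length_simpleRefl_mul {j : Option b.support} {w : ExtWeyl P}
    (h : IsPosAff b (act w⁻¹ (simpleRoot b j))) :
    length b (simpleRefl b j * w) = length b w + 1 := by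
  rw [length_mul_of_forall, length_simpleRefl, add_comm]
  intro a h1 h2 h3
  have h4 : ¬ IsPosAff b (act (simpleRefl b j) (negAff P (act w a))) := by
    rw [act_negAff, isPosAff_negAff, ← act_mul]; exact not_not.2 h3
  have h5 : negAff P (act w a) ∈ invSet b (simpleRefl b j) :=
    ⟨(isPosAff_negAff b _).2 h2, h4⟩
  rw [invSet_simpleRefl, Set.mem_singleton_iff] at h5
  rw [← h5, act_negAff, act_inv_act, isPosAff_negAff] at h
  exact h h1

lemma length_simpleRefl_mul_of_neg {j : Option b.support} {w : ExtWeyl P}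
    (h : ¬ IsPosAff b (act w⁻¹ (simpleRoot b j))) :
    length b w = length b (simpleRefl b j * w) + 1 := by
  rw [← length_simpleRefl_mul, simpleRefl_mul_cancel]
  rw [mul_inv_rev, act_mul, simpleRefl_inv, act_simpleRefl_self, act_negAff, isPosAff_negAff]
  exact h

lemma length_mul_simpleRefl {j : Option b.support} {w : ExtWeyl P}
    (h : IsPosAff b (act w (simpleRoot b j))) :
    length b (w * simpleRefl b j) = length b w + 1 := by
  rw [← length_inv, mul_inv_rev, simpleRefl_inv, length_simpleRefl_mul b (by rwa [inv_inv]),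
    length_inv]

lemma length_mul_simpleRefl_of_neg {j : Option b.support} {w : ExtWeyl P}
    (h : ¬ IsPosAff b (act w (simpleRoot b j))) :
    length b w = length b (w * simpleRefl b j) + 1 := by
  rw [← length_inv b (w * _), mul_inv_rev, simpleRefl_inv, ← length_simpleRefl_mul_of_neg b,
    length_inv]
  rwa [inv_inv]

end LengthFunction

/-! ### The highest root and the fundamental alcove -/

section HighestRoot

variable {P : RootPairing ι ℝ M N} (b : P.Base) [Fintype ι] [Nonempty ι] [P.IsCrystallographic]
  [P.IsReduced]

lemma pair_pos_of_isPos {y : Cowt P} (hy : ∀ j ∈ b.support, 0 < pair y j) {i : ι}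
    (hi : b.IsPos i) : 0 < pair y i := by
  refine hi.induction_on_add hy fun i j l h1 h2 h3 => ?_
  rw [pair_of_root_eq y (i := i) (j := j) (c := 1) (d := 1) (by rw [h1]; module)]
  have := hy j h3
  omega

lemma isPos_of_pair_pos {y : Cowt P} (hy : ∀ j ∈ b.support, 0 < pair y j) {i : ι}
    (hi : 0 < pair y i) : b.IsPos i := by
  by_contra h
  have := pair_pos_of_isPos b hy ((isPos_negIndex b i).2 h)
  rw [pair_negIndex] at this
  omega

/-- If the pairing were negative, either `α_i + α_j` would be a root with a larger value of `y`, or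
`α_i = -α_j` and `y` would be larger on `α_j`. -/
lemma pairingIn_nonneg_of_maximal {y : Cowt P} (hy : ∀ j ∈ b.support, 0 < pair y j) {i : ι}
    (hi : ∀ l, pair y l ≤ pair y i) {j : ι} (hj : j ∈ b.support) : 0 ≤ P.pairingIn ℤ i j := by
  by_contra! h
  have hj0 := hy j hj
  by_cases hne : P.root i = -P.root j
  · have h1 := pair_of_root_eq y (i := j) (j := j) (l := i) (c := -1) (d := 0) (by rw [hne]; module)
    have := hi j
    omega
  · obtain ⟨l, hl⟩ := P.root_add_root_mem_of_pairingIn_neg h hne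
    have h1 := pair_of_root_eq y (i := i) (j := j) (l := l) (c := 1) (d := 1) (by rw [hl]; module)
    have := hi l
    omega

variable [P.IsIrreducible]

/-- In an irreducible root system two dominant roots have positive pairing. -/
lemma pairingIn_pos_of_dominant {i l : ι} (hi : b.IsPos i)
    (hi' : ∀ j ∈ b.support, 0 ≤ P.pairingIn ℤ i j) (hl : ∀ j ∈ b.support, 0 ≤ P.pairingIn ℤ l j) :
    0 < P.pairingIn ℤ i l := by
  obtain ⟨f, hsupp, hf1, hf⟩ := b.exists_root_eq_sum_int i
  have hf0 : 0 < f := by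
    refine hf1.resolve_right fun hn => ?_
    rw [Base.isPos_iff, Base.height_eq_sum hf] at hi
    exact absurd hi (not_lt.2 (Finset.sum_nonpos fun i _ => hn.le i))
  have hsum (m : ι) : P.pairingIn ℤ i m = ∑ j ∈ b.support, f j * P.pairingIn ℤ j m := by
    have := pair_eq_sum b (corootCowt m) hf
    simpa only [pair_coroot] using this
  have hsgn (j m : ι) (h : 0 ≤ P.pairingIn ℤ j m) : 0 ≤ P.pairingIn ℤ m j := by
    by_contra! h'
    rw [P.pairingIn_lt_zero_iff] at h'
    omega
  have hnn : ∀ j ∈ b.support, 0 ≤ f j * P.pairingIn ℤ j l := fun j hj =>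
    mul_nonneg (hf0.le j) (hsgn l j (hl j hj))
  by_contra! hcon
  have hz : ∀ j ∈ b.support, f j * P.pairingIn ℤ j l = 0 := by
    rw [← Finset.sum_eq_zero_iff_of_nonneg hnn]
    exact le_antisymm (by rw [← hsum]; exact hcon) (Finset.sum_nonneg hnn)
  -- The span of the simple roots occurring in `α_i` turns out to be stable under all reflections,
  -- hence is everything by irreducibility; but `α_l^∨` vanishes on it.
  let S : Set ι := {j | j ∈ b.support ∧ f j ≠ 0}
  have hS : S.Nonempty := by
    by_contra hS
    apply P.ne_zero i
    rw [hf]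
    refine Finset.sum_eq_zero fun j hj => ?_
    have : f j = 0 := by
      by_contra h
      exact hS ⟨j, hj, h⟩
    rw [this, zero_smul]
  have hinv : ∀ m, Submodule.span ℝ (P.root '' S) ∈ Module.End.invtSubmodule (P.reflection m) := by
    rw [← b.forall_mem_support_invtSubmodule_iff]
    intro m hm
    by_cases hmS : m ∈ S
    · exact Submodule.mem_invtSubmodule_reflection_of_mem _ _
        (Submodule.subset_span ⟨m, hmS, rfl⟩)
    · rw [Module.End.mem_invtSubmodule, Submodule.span_le]
      rintro _ ⟨j, hj, rfl⟩
      have hfm : f m = 0 := by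
        by_contra h
        exact hmS ⟨hm, h⟩
      -- These terms are nonpositive, and their sum is `⟨α_i, α_m^∨⟩ ≥ 0`; so each of them vanishes.
      have hle : ∀ j ∈ b.support, f j * P.pairingIn ℤ j m ≤ 0 := fun j hj => by
        by_cases hjm : j = m
        · rw [hjm, hfm, zero_mul]
        · exact mul_nonpos_of_nonneg_of_nonpos (hf0.le j) (b.pairingIn_le_zero_of_ne hjm hj hm)
      have hz : ∀ j ∈ b.support, f j * P.pairingIn ℤ j m = 0 := by
        rw [← Finset.sum_eq_zero_iff_of_nonpos hle]
        exact le_antisymm (Finset.sum_nonpos hle) (by rw [← hsum]; exact hi' m hm)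
      have hjm : P.pairingIn ℤ j m = 0 := (mul_eq_zero.1 (hz j hj.1)).resolve_left hj.2
      have : P.reflection m (P.root j) = P.root j := by
        rw [reflection_apply_root' ℤ, hjm, zero_smul, sub_zero]
      change P.reflection m (P.root j) ∈ Submodule.span ℝ (P.root '' S)
      rw [this]
      exact Submodule.subset_span ⟨j, hj, rfl⟩
  have htop := IsIrreducible.eq_top_of_invtSubmodule_reflection _ hinv (by
    obtain ⟨j, hj⟩ := hS
    exact fun h => P.ne_zero j ((Submodule.eq_bot_iff _).1 h _ (Submodule.subset_span ⟨j, hj, rfl⟩)))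
  have hker : Submodule.span ℝ (P.root '' S) ≤ LinearMap.ker (P.coroot' l) := by
    rw [Submodule.span_le]
    rintro _ ⟨j, hj, rfl⟩
    have h0 : P.pairingIn ℤ j l = 0 := (mul_eq_zero.1 (hz j hj.1)).resolve_left hj.2
    change P.coroot' l (P.root j) = 0
    rw [P.root_coroot'_eq_pairing, ← P.algebraMap_pairingIn ℤ, h0, map_zero]
  rw [htop] at hker
  have : P.coroot' l (P.root l) = 0 := hker Submodule.mem_top
  rw [P.root_coroot'_eq_pairing, pairing_same] at this
  norm_num at this

variable (P) in
lemma exists_pair_eq_height : ∃ ρ : Cowt P, ∀ i, pair ρ i = b.height i := by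
  obtain ⟨ρ, hρ⟩ := exists_cowt b fun _ => 1
  refine ⟨ρ, fun i => ?_⟩
  obtain ⟨f, -, -, hf⟩ := b.exists_root_eq_sum_int i
  rw [pair_eq_sum b ρ hf, Base.height_eq_sum hf]
  refine Finset.sum_congr rfl fun j hj => ?_
  rw [hρ ⟨j, hj⟩, mul_one]

lemma isPos_highest : b.IsPos (highest b) := by
  obtain ⟨j, hj⟩ := b.support_nonempty
  have := height_le_highest b j
  rw [Base.height_one_of_mem_support hj] at this
  exact lt_of_lt_of_le one_pos this

/-- The highest root is the only root maximising a strictly dominant functional. -/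
lemma eq_highest_of_maximal {y : Cowt P} (hy : ∀ j ∈ b.support, 0 < pair y j) {i : ι}
    (hi : ∀ l, pair y l ≤ pair y i) : i = highest b := by
  obtain ⟨ρ, hρ⟩ := exists_pair_eq_height P b
  have hρ0 : ∀ j ∈ b.support, 0 < pair ρ j := fun j hj => by
    rw [hρ, Base.height_one_of_mem_support hj]; exact one_pos
  have h1 := fun j (hj : j ∈ b.support) => pairingIn_nonneg_of_maximal b hy hi hj
  have h2 := fun j (hj : j ∈ b.support) => pairingIn_nonneg_of_maximal b hρ0 (i := highest b)
    (fun l => by rw [hρ, hρ]; exact height_le_highest b l) hj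
  have h3 := pairingIn_pos_of_dominant b (isPos_highest b) h2 h1
  by_contra hne
  -- As both roots are dominant, their difference `φ - α_i` is a root. It is positive because `φ`
  -- has maximal height, so `y` is larger on `φ` than on `α_i`.
  obtain ⟨l, hl⟩ := P.root_sub_root_mem_of_pairingIn_pos h3 (Ne.symm hne)
  have h4 (z : Cowt P) : pair z l = pair z (highest b) - pair z i := by
    rw [pair_of_root_eq z (i := highest b) (j := i) (c := 1) (d := -1) (by rw [hl]; module)]
    ring
  have h5 : b.IsPos l := by
    rw [Base.isPos_iff', ← hρ, h4, hρ, hρ]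
    have := height_le_highest b i
    omega
  have h6 := pair_pos_of_isPos b hy h5
  have := hi (highest b)
  rw [h4] at h6
  omega

lemma abs_height_le (i : ι) : -b.height (highest b) ≤ b.height i := by
  have h1 := height_le_highest b (P.reflectionPerm i i)
  have h2 : b.height (P.reflectionPerm i i) = -b.height i := b.height_reflectionPerm_self i
  omega

/-- With `h = ht φ + 1`, the right side is `h` times the value of `α + r c` at the point `ρ^∨ / h`
of the fundamental alcove. All heights lie strictly between `-h` and `h`, so the level decides
unless it is zero. -/
lemma isPosAff_iff (a : AffRoot ι) :
    IsPosAff b a ↔ 0 < a.2 * (b.height (highest b) + 1) + b.height a.1 := by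
  have h1 := height_le_highest b a.1
  have h2 := abs_height_le b a.1
  have h3 := isPos_highest b
  rw [Base.isPos_iff] at h3
  simp only [IsPosAff, Base.isPos_iff]
  rcases lt_trichotomy a.2 0 with h | h | h
  · have : a.2 * (b.height (highest b) + 1) ≤ -1 * (b.height (highest b) + 1) :=
      mul_le_mul_of_nonneg_right (by omega) (by omega)
    omega
  · simp [h]
  · have : 1 * (b.height (highest b) + 1) ≤ a.2 * (b.height (highest b) + 1) :=
      mul_le_mul_of_nonneg_right (by omega) (by omega)
    omega

/-- An element of the extended affine Weyl group which sends all simple affine roots to positive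
roots has length zero. -/
lemma length_eq_zero_of_simpleRoot {w : ExtWeyl P}
    (h : ∀ j, IsPosAff b (act w (simpleRoot b j))) : length b w = 0 := by
  obtain ⟨ρ, hρ⟩ := exists_pair_eq_height P b
  set H := b.height (highest b) with hH
  -- Chosen so that `r (H + 1) + ⟨y, α⟩` is the pullback along `w` of the functional that detects
  -- positivity.
  set y : Cowt P := w.right⁻¹ • (ρ - (H + 1) • w.left.toAdd) with hy
  have key (a : AffRoot ι) : IsPosAff b (act w a) ↔ 0 < a.2 * (H + 1) + pair y a.1 := by
    rw [isPosAff_iff, ← hH, hy, pair_smul, pair_sub, pair_zsmul, hρ, inv_inv]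
    simp only [act]
    ring_nf
  simp only [key] at h
  have h1 : ∀ j ∈ b.support, 0 < pair y j := fun j hj => by
    simpa [simpleRoot] using h (some ⟨j, hj⟩)
  have h0 := h none
  simp only [simpleRoot, pair_negIndex] at h0
  -- Now `y` is strictly dominant, so its largest value is attained at `φ`, where `h0` bounds it by
  -- `H + 1`. This controls all roots of positive level.
  obtain ⟨i, hi⟩ := Finite.exists_max (pair y)
  have h2 := eq_highest_of_maximal b h1 hi
  subst h2
  rw [length_eq_zero_iff]
  rintro ⟨l, r⟩ (hl | ⟨hr, hl⟩)
  · rw [key]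
    have h3 := hi (P.reflectionPerm l l)
    rw [pair_negIndex] at h3
    have h4 := isPos_highest b
    rw [Base.isPos_iff, ← hH] at h4
    have h5 : 1 * (H + 1) ≤ r * (H + 1) :=
      mul_le_mul_of_nonneg_right (by simp only at hl; omega) (by omega)
    simp only at *
    omega
  · rw [key]
    have h3 := pair_pos_of_isPos b h1 hl
    simp only at hr h3
    simp only [hr]
    omega

lemma exists_left_descent {w : ExtWeyl P} (h : length b w ≠ 0) :
    ∃ j, ¬ IsPosAff b (act w⁻¹ (simpleRoot b j)) := by
  by_contra! hcon
  rw [← length_inv] at h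
  exact h (length_eq_zero_of_simpleRoot b hcon)

/-- Induction on the length in the extended affine Weyl group. -/
lemma extWeyl_induction {p : ExtWeyl P → Prop} (h0 : ∀ w, length b w = 0 → p w)
    (h1 : ∀ j w, IsPosAff b (act w⁻¹ (simpleRoot b j)) → p w → p (simpleRefl b j * w))
    (w : ExtWeyl P) : p w := by
  induction hn : length b w generalizing w with
  | zero => exact h0 w hn
  | succ n ih =>
    obtain ⟨j, hj⟩ := exists_left_descent b (w := w) (by omega)
    have h2 := length_simpleRefl_mul_of_neg b hj
    rw [← simpleRefl_mul_cancel b j w]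
    refine h1 j _ ?_ (ih _ (by omega))
    rw [mul_inv_rev, act_mul, simpleRefl_inv, act_simpleRefl_self, act_negAff, isPosAff_negAff]
    exact hj

/-- Elements of length zero permute the simple affine roots. -/
lemma exists_act_simpleRoot_eq {w : ExtWeyl P} (hw : length b w = 0) (j : Option b.support) :
    ∃ i, act w (simpleRoot b j) = simpleRoot b i := by
  set a := act w (simpleRoot b j) with ha
  have ha0 : IsPosAff b a := (length_eq_zero_iff b w).1 hw _ (isPosAff_simpleRoot b j)
  -- The reflection in `a` is conjugate by an element of length zero to a simple one, so it has a
  -- single inversion. Both `a` and the simple root given by a descent are inversions, hence they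
  -- coincide.
  have hl : length b (affRefl a : ExtWeyl P) = 1 := by
    rw [ha, ← conj_affRefl, length_mul_of_length_eq_zero_right b (by rw [length_inv, hw]),
      length_mul_of_length_eq_zero_left b hw]
    exact length_simpleRefl b j
  obtain ⟨i, hi⟩ := exists_left_descent b (w := (affRefl a : ExtWeyl P)) (by omega)
  rw [affRefl_inv] at hi
  refine ⟨i, ?_⟩
  obtain ⟨c, hc⟩ := Set.ncard_eq_one.1 hl
  have h1 : a ∈ invSet b (affRefl a : ExtWeyl P) := by
    refine ⟨ha0, ?_⟩
    rw [act_affRefl_self, isPosAff_negAff]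
    exact not_not.2 ha0
  have h2 : simpleRoot b i ∈ invSet b (affRefl a : ExtWeyl P) := ⟨isPosAff_simpleRoot b i, hi⟩
  rw [hc, Set.mem_singleton_iff] at h1 h2
  rw [h1, h2]

lemma mul_simpleRefl_of_act_eq {w : ExtWeyl P} {i j : Option b.support}
    (h : act w (simpleRoot b j) = simpleRoot b i) :
    w * simpleRefl b j = simpleRefl b i * w := by
  rw [simpleRefl, mul_affRefl, h]; rfl

end HighestRoot

/-! ### Simple reflections and the exchange condition -/

section FiniteLength

variable {P : RootPairing ι ℝ M N} (b : P.Base) [Fintype ι] [Nonempty ι] [P.IsCrystallographic]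
  [P.IsReduced] [P.IsIrreducible]

lemma fin_simpleRefl₀ (j : b.support) : fin (simpleRefl₀ b j) = simpleRefl b (some j) :=
  (affRefl_fin _).symm

lemma simpleRefl₀_smul (j : b.support) (i : ι) :
    simpleRefl₀ b j • i = P.reflectionPerm j i := rfl

lemma simpleRefl₀_mul_self (j : b.support) : simpleRefl₀ b j * simpleRefl₀ b j = 1 :=
  ofIdx_mul_self _

lemma simpleRefl₀_inv (j : b.support) : (simpleRefl₀ b j)⁻¹ = simpleRefl₀ b j :=
  inv_eq_of_mul_eq_one_left (simpleRefl₀_mul_self b j)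

lemma simpleRefl₀_mul_cancel (j : b.support) (w : P.weylGroup) :
    simpleRefl₀ b j * (simpleRefl₀ b j * w) = w := by
  rw [← mul_assoc, simpleRefl₀_mul_self, one_mul]

lemma mul_simpleRefl₀_cancel (j : b.support) (w : P.weylGroup) :
    w * simpleRefl₀ b j * simpleRefl₀ b j = w := by
  rw [mul_assoc, simpleRefl₀_mul_self, mul_one]

lemma isPosAff_act_fin (w : P.weylGroup) (j : b.support) :
    IsPosAff b (act (fin w) (simpleRoot b (some j))) ↔ b.IsPos (w • (j : ι)) := by
  rw [act_fin]
  exact isPosAff_fin_iff b _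

lemma mul_ofIdx (w : P.weylGroup) (i : ι) :
    w * weylGroup.ofIdx P i = weylGroup.ofIdx P (w • i) * w := by
  apply weyl_ext
  intro j
  rw [mul_smul, mul_smul, ofIdx_smul_index, ofIdx_smul_index, smul_reflectionPerm]

lemma mul_simpleRefl₀_of_smul_eq {w : P.weylGroup} {i j : b.support} (h : w • (i : ι) = j) :
    w * simpleRefl₀ b i = simpleRefl₀ b j * w := by
  rw [simpleRefl₀, mul_ofIdx, h]; rfl

lemma isPos_simpleRefl₀_of_ne {j : b.support} {i : ι} (hi : b.IsPos i) (hne : i ≠ j) :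
    b.IsPos (simpleRefl₀ b j • i) := hi.reflectionPerm j.2 hne

lemma length₀_mul_simpleRefl₀ {w : P.weylGroup} {j : b.support} (h : b.IsPos (w • (j : ι))) :
    length₀ b (w * simpleRefl₀ b j) = length₀ b w + 1 := by
  rw [← length_fin, fin_mul, fin_simpleRefl₀, length_mul_simpleRefl b
    ((isPosAff_act_fin b w j).2 h), length_fin]

lemma length₀_mul_simpleRefl₀_of_neg {w : P.weylGroup} {j : b.support}
    (h : ¬ b.IsPos (w • (j : ι))) : length₀ b w = length₀ b (w * simpleRefl₀ b j) + 1 := by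
  rw [← length_fin, ← length_fin, fin_mul, fin_simpleRefl₀, ← length_mul_simpleRefl_of_neg b
    (fun h' => h ((isPosAff_act_fin b w j).1 h'))]

lemma length₀_inv (w : P.weylGroup) : length₀ b w⁻¹ = length₀ b w := by
  rw [← length_fin, ← length_fin, fin_inv, length_inv]

lemma length₀_simpleRefl₀_mul {w : P.weylGroup} {j : b.support} (h : b.IsPos (w⁻¹ • (j : ι))) :
    length₀ b (simpleRefl₀ b j * w) = length₀ b w + 1 := by
  rw [← length₀_inv, mul_inv_rev, simpleRefl₀_inv, length₀_mul_simpleRefl₀ b h, length₀_inv]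

lemma length₀_simpleRefl₀_mul_of_neg {w : P.weylGroup} {j : b.support}
    (h : ¬ b.IsPos (w⁻¹ • (j : ι))) : length₀ b w = length₀ b (simpleRefl₀ b j * w) + 1 := by
  rw [← length₀_inv b (_ * w), mul_inv_rev, simpleRefl₀_inv, ← length₀_mul_simpleRefl₀_of_neg b h,
    length₀_inv]

lemma mem_minReps_iff (I : Set b.support) (w : P.weylGroup) :
    w ∈ minReps b I ↔ ∀ i ∈ I, b.IsPos (w • (i : ι)) := by
  refine forall₂_congr fun i _ => ⟨fun h => ?_, fun h => ?_⟩
  · by_contra h'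
    have := length₀_mul_simpleRefl₀_of_neg b h'
    omega
  · rw [length₀_mul_simpleRefl₀ b h]; omega

lemma closure_simpleRefl₀ : Subgroup.closure (Set.range (simpleRefl₀ b)) = ⊤ := by
  have h (i : ι) : weylGroup.ofIdx P i ∈ Subgroup.closure (Set.range (simpleRefl₀ b)) := by
    have hc (i j : ι) : weylGroup.ofIdx P (P.reflectionPerm j i) =
        weylGroup.ofIdx P j * weylGroup.ofIdx P i * weylGroup.ofIdx P j := by
      rw [mul_ofIdx (weylGroup.ofIdx P j) i, ofIdx_smul_index, mul_assoc, ofIdx_mul_self, mul_one]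
    refine b.induction_reflect i
      (p := fun i => weylGroup.ofIdx P i ∈ Subgroup.closure (Set.range (simpleRefl₀ b))) (fun i hi => ?_) (fun i hi => ?_) fun i j hi hj => ?_
    · rw [hc]
      exact mul_mem (mul_mem hi hi) hi
    · exact Subgroup.subset_closure ⟨⟨i, hi⟩, rfl⟩
    · rw [hc]
      have := Subgroup.subset_closure (k := Set.range (simpleRefl₀ b)) ⟨⟨j, hj⟩, rfl⟩
      exact mul_mem (mul_mem this hi) this
  rw [eq_top_iff]
  rintro ⟨w, hw⟩ -
  induction hw using weylGroup.induction with
  | mem i => exact h i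
  | one => exact one_mem _
  | mul x y hx hy h1 h2 => exact mul_mem h1 h2

lemma exists_word (w : P.weylGroup) : ∃ l : List b.support, (l.map (simpleRefl₀ b)).prod = w := by
  have hw : w ∈ Subgroup.closure (Set.range (simpleRefl₀ b)) := by
    rw [closure_simpleRefl₀]; trivial
  induction hw using Subgroup.closure_induction_left with
  | one => exact ⟨[], rfl⟩
  | mul_left x hx y hy ih =>
    obtain ⟨j, rfl⟩ := hx
    obtain ⟨l, rfl⟩ := ih
    exact ⟨j :: l, by simp⟩
  | inv_mul_cancel x hx y hy ih =>
    obtain ⟨j, rfl⟩ := hx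
    obtain ⟨l, rfl⟩ := ih
    exact ⟨j :: l, by simp [simpleRefl₀_inv]⟩

/-- Applying the letters from the right, `α_i` first becomes negative at some letter `s_t`, and just
before it equals `α_t`. Moving `s_i` through to that place cancels the letter. -/
lemma exchange (l : List b.support) {i : b.support}
    (h : ¬ b.IsPos ((l.map (simpleRefl₀ b)).prod • (i : ι))) :
    ∃ l' : List b.support, l'.length + 1 = l.length ∧
      (l'.map (simpleRefl₀ b)).prod = (l.map (simpleRefl₀ b)).prod * simpleRefl₀ b i := by
  induction l with
  | nil =>
    simp only [List.map_nil, List.prod_nil, one_smul] at h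
    exact absurd (Base.isPos_of_mem_support i.2) h
  | cons t l ih =>
    by_cases h1 : b.IsPos ((l.map (simpleRefl₀ b)).prod • (i : ι))
    · have h2 : (l.map (simpleRefl₀ b)).prod • (i : ι) = t := by
        by_contra hne
        apply h
        rw [List.map_cons, List.prod_cons, mul_smul]
        exact isPos_simpleRefl₀_of_ne b h1 hne
      refine ⟨l, rfl, ?_⟩
      rw [List.map_cons, List.prod_cons, mul_assoc, mul_simpleRefl₀_of_smul_eq b h2,
        simpleRefl₀_mul_cancel]
    · obtain ⟨l', h2, h3⟩ := ih h1
      exact ⟨t :: l', by simp [h2], by simp [h3, mul_assoc]⟩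

/-- An element of the Weyl group which preserves positivity of all simple roots is trivial. -/
lemma eq_one_of_isPos_smul {w : P.weylGroup} (h : ∀ j : b.support, b.IsPos (w • (j : ι))) :
    w = 1 := by
  classical
  have hex : ∃ n, ∃ l : List b.support, l.length = n ∧ (l.map (simpleRefl₀ b)).prod = w := by
    obtain ⟨l, hl⟩ := exists_word b w
    exact ⟨_, l, rfl, hl⟩
  obtain ⟨l, hl, hw⟩ := Nat.find_spec hex
  rcases List.eq_nil_or_concat l with rfl | ⟨l₀, i, rfl⟩
  · exact hw.symm
  · exfalso
    simp only [List.concat_eq_append, List.map_append, List.prod_append, List.map_cons, List.map_nil,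
      List.prod_cons, List.prod_nil, mul_one] at hw
    -- Since `w α_i` is positive, the word without its last letter `s_i` makes `α_i` negative;
    -- exchange then gives a word for `w` shorter than the minimal one.
    have h1 : ¬ b.IsPos ((l₀.map (simpleRefl₀ b)).prod • (i : ι)) := by
      rw [← isPos_negIndex, ← smul_negIndex, ← simpleRefl₀_smul, ← mul_smul, hw]
      exact h i
    obtain ⟨l', h2, h3⟩ := exchange b l₀ h1
    have := Nat.find_min' hex ⟨l', rfl, h3.trans hw⟩
    simp at hl
    omega

lemma exists_right_descent₀ {w : P.weylGroup} (h : w ≠ 1) :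
    ∃ j : b.support, ¬ b.IsPos (w • (j : ι)) := by
  by_contra! hcon
  exact h (eq_one_of_isPos_smul b hcon)

lemma length₀_one : length₀ b (1 : P.weylGroup) = 0 := by
  rw [← length_fin, fin_one, length_one]

lemma length₀_eq_zero_iff {w : P.weylGroup} : length₀ b w = 0 ↔ w = 1 := by
  refine ⟨fun h => ?_, fun h => by rw [h, length₀_one]⟩
  by_contra hne
  obtain ⟨j, hj⟩ := exists_right_descent₀ b hne
  have := length₀_mul_simpleRefl₀_of_neg b hj
  omega

/-- Induction on the length in the finite Weyl group. -/
lemma weyl_induction {p : P.weylGroup → Prop} (h0 : p 1)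
    (h1 : ∀ j w, b.IsPos (w⁻¹ • ((j : b.support) : ι)) → p w → p (simpleRefl₀ b j * w))
    (w : P.weylGroup) : p w := by
  induction hn : length₀ b w generalizing w with
  | zero => rwa [(length₀_eq_zero_iff b).1 hn]
  | succ n ih =>
    obtain ⟨j, hj⟩ := exists_right_descent₀ b (w := w⁻¹) (fun h => by
      rw [inv_eq_one] at h; rw [h, length₀_one] at hn; omega)
    have h2 := length₀_simpleRefl₀_mul_of_neg b hj
    rw [← simpleRefl₀_mul_cancel b j w]
    refine h1 j _ ?_ (ih _ (by omega))
    rw [mul_inv_rev, mul_smul, simpleRefl₀_inv, simpleRefl₀_smul, smul_negIndex, isPos_negIndex]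
    exact hj

end FiniteLength

/-! ### Alternating words and rank two root coordinates -/

section Alternating

/-- The alternating word `x y x ⋯` with `n` letters. -/
def alt {G : Type*} [Monoid G] (x y : G) : ℕ → G
  | 0 => 1
  | n + 1 => x * alt y x n

/-- The letter following the alternating word `x y x ⋯` with `n` letters. -/
def altNext {α : Type*} (x y : α) : ℕ → α
  | 0 => x
  | n + 1 => altNext y x n

lemma alt_succ' {G α : Type*} [Monoid G] (f : α → G) (x y : α) (n : ℕ) :
    alt (f x) (f y) (n + 1) = alt (f x) (f y) n * f (altNext x y n) := by
  induction n generalizing x y with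
  | zero => simp [alt, altNext]
  | succ n ih => rw [alt, ih, ← mul_assoc]; rfl

lemma altNext_eq_or {α : Type*} (x y : α) (n : ℕ) : altNext x y n = x ∨ altNext x y n = y := by
  induction n generalizing x y with
  | zero => exact Or.inl rfl
  | succ n ih => exact (ih y x).symm

/-- Coordinates, with respect to two simple roots with Cartan integers `C`, `C'`, of the roots
obtained from alternating words in the two reflections. -/
def altCoord (C C' : ℤ) : ℕ → ℤ × ℤ
  | 0 => (1, 0)
  | n + 1 => (-(altCoord C' C n).2 - (altCoord C' C n).1 * C, (altCoord C' C n).1)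

/-- The order of the product of two simple reflections with Cartan integers `C`, `C'`. -/
def IsCoxeterOrder (C C' : ℤ) (m : ℕ) : Prop :=
  (C = 0 ∧ C' = 0 ∧ m = 2) ∨ (C = -1 ∧ C' = -1 ∧ m = 3) ∨ (C = -1 ∧ C' = -2 ∧ m = 4) ∨
    (C = -2 ∧ C' = -1 ∧ m = 4) ∨ (C = -1 ∧ C' = -3 ∧ m = 6) ∨ (C = -3 ∧ C' = -1 ∧ m = 6)

lemma IsCoxeterOrder.symm {C C' : ℤ} {m : ℕ} (h : IsCoxeterOrder C C' m) :
    IsCoxeterOrder C' C m := by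
  unfold IsCoxeterOrder at *; tauto

lemma IsCoxeterOrder.altCoord_nonneg {C C' : ℤ} {m : ℕ} (h : IsCoxeterOrder C C' m) {n : ℕ}
    (hn : n < m) : 0 ≤ (altCoord C C' n).1 ∧ 0 ≤ (altCoord C C' n).2 := by
  rcases h with ⟨rfl, rfl, rfl⟩ | ⟨rfl, rfl, rfl⟩ | ⟨rfl, rfl, rfl⟩ | ⟨rfl, rfl, rfl⟩ |
    ⟨rfl, rfl, rfl⟩ | ⟨rfl, rfl, rfl⟩ <;> interval_cases n <;> simp [altCoord]

/-- The two alternating words enumerate the positive roots of a rank two system in opposite orders,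
which is checked in each of the six cases. -/
lemma IsCoxeterOrder.altCoord_reverse {C C' : ℤ} {m : ℕ} (h : IsCoxeterOrder C C' m) {n : ℕ}
    (hn : n < m) : altCoord C C' n = (altCoord C' C (m - 1 - n)).swap := by
  rcases h with ⟨rfl, rfl, rfl⟩ | ⟨rfl, rfl, rfl⟩ | ⟨rfl, rfl, rfl⟩ | ⟨rfl, rfl, rfl⟩ |
    ⟨rfl, rfl, rfl⟩ | ⟨rfl, rfl, rfl⟩ <;> interval_cases n <;> simp [altCoord]

end Alternating

/-! ### Dihedral subgroups of the affine Weyl group -/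

section RankTwo

variable {P : RootPairing ι ℝ M N}

variable (P) in
/-- The affine root `d` is the combination `m a + n c` of the affine roots `a` and `c`. -/
def HasCoord (a c d : AffRoot ι) (x : ℤ × ℤ) : Prop :=
  P.root d.1 = x.1 • P.root a.1 + x.2 • P.root c.1 ∧ d.2 = x.1 * a.2 + x.2 * c.2

lemma HasCoord.swap {a c d : AffRoot ι} {x : ℤ × ℤ} (h : HasCoord P a c d x) :
    HasCoord P c a d x.swap :=
  ⟨by rw [h.1, add_comm]; rfl, by rw [h.2, add_comm]; rfl⟩

lemma HasCoord.unique {a c d d' : AffRoot ι} {x : ℤ × ℤ} (h : HasCoord P a c d x)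
    (h' : HasCoord P a c d' x) : d = d' :=
  Prod.ext (P.root.injective (h.1.trans h'.1.symm)) (h.2.trans h'.2.symm)

lemma HasCoord.act {a c d : AffRoot ι} {x : ℤ × ℤ} (h : HasCoord P a c d x) (w : ExtWeyl P) :
    HasCoord P (act w a) (act w c) (act w d) x := by
  have hz (n : ℤ) (v : M) : w.right • (n • v) = n • (w.right • v) :=
    map_zsmul (DistribSMul.toAddMonoidHom M w.right) n v
  have h1 : P.root (w.right • d.1) =
      x.1 • P.root (w.right • a.1) + x.2 • P.root (w.right • c.1) := by
    rw [root_smul, h.1, smul_add, hz, hz, root_smul, root_smul]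
  refine ⟨h1, ?_⟩
  simp only [AffHecke.act]
  rw [pair_of_root_eq _ h1, h.2]
  ring

variable [P.IsCrystallographic]

lemma HasCoord.reflLeft {a c d : AffRoot ι} {x : ℤ × ℤ} (h : HasCoord P a c d x) :
    HasCoord P a c (AffHecke.act (affRefl (P := P) a) d)
      (-x.1 - x.2 * P.pairingIn ℤ c.1 a.1, x.2) := by
  have hp : P.pairingIn ℤ d.1 a.1 = x.1 * 2 + x.2 * P.pairingIn ℤ c.1 a.1 := by
    have := pair_of_root_eq (corootCowt a.1) h.1
    rw [pair_coroot, pair_coroot, pair_coroot, pairingIn_same] at this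
    exact this
  rw [act_affRefl, hp]
  constructor
  · simp only
    rw [root_reflectionPerm_eq, hp, h.1]
    module
  · simp only
    rw [h.2]
    ring

variable (b : P.Base) [Fintype ι] [Nonempty ι] [P.IsReduced] [P.IsIrreducible]

/-- By `isPosAff_iff`, positivity is the sign of a linear functional; the coordinates are not both
zero because a root is nonzero. -/
lemma HasCoord.isPosAff {a c d : AffRoot ι} {x : ℤ × ℤ} (h : HasCoord P a c d x)
    (hx : 0 ≤ x.1 ∧ 0 ≤ x.2) (ha : IsPosAff b a) (hc : IsPosAff b c) : IsPosAff b d := by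
  obtain ⟨ρ, hρ⟩ := exists_pair_eq_height P b
  simp only [isPosAff_iff, ← hρ] at ha hc ⊢
  generalize pair ρ (highest b) = H at ha hc ⊢
  rw [pair_of_root_eq ρ h.1, h.2]
  have h1 : (x.1 * a.2 + x.2 * c.2) * (H + 1) +
      (x.1 * pair ρ a.1 + x.2 * pair ρ c.1) =
      x.1 * (a.2 * (H + 1) + pair ρ a.1) + x.2 * (c.2 * (H + 1) + pair ρ c.1) := by ring
  rw [h1]
  have h2 : x.1 ≠ 0 ∨ x.2 ≠ 0 := by
    by_contra! h0
    apply P.ne_zero d.1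
    rw [h.1, h0.1, h0.2]
    simp
  rcases h2 with h2 | h2
  · have := mul_pos (lt_of_le_of_ne hx.1 h2.symm) ha
    have := mul_nonneg hx.2 hc.le
    omega
  · have := mul_pos (lt_of_le_of_ne hx.2 h2.symm) hc
    have := mul_nonneg hx.1 ha.le
    omega

lemma HasCoord.not_isPosAff {a c d : AffRoot ι} {x : ℤ × ℤ} (h : HasCoord P a c d x)
    (hx : 0 ≤ x.1 ∧ 0 ≤ x.2) (ha : ¬ IsPosAff b a) (hc : ¬ IsPosAff b c) : ¬ IsPosAff b d := by
  rw [← isPosAff_negAff] at *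
  refine HasCoord.isPosAff b (x := x) ⟨?_, ?_⟩ hx ha hc
  · simp only [negAff, root_negIndex, h.1]
    module
  · simp only [negAff, h.2]
    ring

/-- The Cartan integer `⟨a_i, a_j^∨⟩` of two simple affine roots. -/
def cartan (i j : Option b.support) : ℤ :=
  P.pairingIn ℤ (simpleRoot b i).1 (simpleRoot b j).1

/-- The root obtained by applying an alternating word in `s_i` and `s_j` to the next simple
root. -/
def altRoot (i j : Option b.support) (n : ℕ) : AffRoot ι :=
  AffHecke.act (alt (simpleRefl b i) (simpleRefl b j) n) (simpleRoot b (altNext i j n))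

lemma altRoot_zero (i j : Option b.support) : altRoot b i j 0 = simpleRoot b i := act_one _

lemma altRoot_succ (i j : Option b.support) (n : ℕ) :
    altRoot b i j (n + 1) = AffHecke.act (simpleRefl b i) (altRoot b j i n) := by
  rw [altRoot, alt, act_mul]; rfl

lemma hasCoord_altRoot (i j : Option b.support) (n : ℕ) :
    HasCoord P (simpleRoot b i) (simpleRoot b j) (altRoot b i j n)
      (altCoord (cartan b j i) (cartan b i j) n) := by
  induction n generalizing i j with
  | zero => exact ⟨by simp [altRoot_zero, altCoord], by simp [altRoot_zero, altCoord]⟩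
  | succ n ih =>
    rw [altRoot_succ]
    exact (ih j i).swap.reflLeft

variable {b}

lemma altRoot_reverse {i j : Option b.support} {m : ℕ}
    (h : IsCoxeterOrder (cartan b j i) (cartan b i j) m) {n : ℕ} (hn : n < m) :
    altRoot b i j n = altRoot b j i (m - 1 - n) := by
  have h1 := hasCoord_altRoot b i j n
  rw [h.altCoord_reverse hn] at h1
  exact h1.unique (hasCoord_altRoot b j i (m - 1 - n)).swap

/-- For odd `m` both words have the same middle root, and equating the two expressions of its
reflection gives the relation. For even `m` a middle root is fixed by `s_j`, which therefore
commutes with the reflection in it. -/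
lemma alt_simpleRefl_comm {i j : Option b.support} {m : ℕ}
    (h : IsCoxeterOrder (cartan b j i) (cartan b i j) m) :
    alt (simpleRefl b i) (simpleRefl b j) m = alt (simpleRefl b j) (simpleRefl b i) m := by
  have key (d : AffRoot ι) (hd : act (simpleRefl b j) d = d) :
      simpleRefl b j * affRefl d = affRefl d * simpleRefl b j := by
    rw [mul_affRefl, hd]
  have hrefl (n : ℕ) : affRefl (altRoot b i j n) = alt (simpleRefl b i) (simpleRefl b j) n *
      simpleRefl b (altNext i j n) * (alt (simpleRefl b i) (simpleRefl b j) n)⁻¹ := by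
    rw [altRoot, ← conj_affRefl]; rfl
  have hinv := simpleRefl_inv b
  rcases h with ⟨h1, h2, rfl⟩ | ⟨h1, h2, rfl⟩ | ⟨h1, h2, rfl⟩ | ⟨h1, h2, rfl⟩ |
    ⟨h1, h2, rfl⟩ | ⟨h1, h2, rfl⟩
  · have h3 := altRoot_reverse (b := b) (i := i) (j := j) (m := 2) (n := 0)
      (by simp [IsCoxeterOrder, h1, h2]) (by norm_num)
    have := key _ ((altRoot_succ b j i 0).symm.trans h3.symm)
    rw [hrefl] at this
    simpa [alt, altNext] using this.symm
  · have h3 := altRoot_reverse (b := b) (i := i) (j := j) (m := 3) (n := 1)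
      (by simp [IsCoxeterOrder, h1, h2]) (by norm_num)
    have := congrArg (affRefl (P := P)) h3
    rw [hrefl, altRoot, ← conj_affRefl] at this
    change _ = _ * simpleRefl b _ * _ at this
    simpa [alt, altNext, hinv, mul_assoc] using this
  · have h3 := altRoot_reverse (b := b) (i := i) (j := j) (m := 4) (n := 1)
      (by simp [IsCoxeterOrder, h1, h2]) (by norm_num)
    have := key _ ((altRoot_succ b j i 1).symm.trans h3.symm)
    rw [hrefl] at this
    simpa [alt, altNext, hinv, mul_assoc] using this.symm
  · have h3 := altRoot_reverse (b := b) (i := i) (j := j) (m := 4) (n := 1)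
      (by simp [IsCoxeterOrder, h1, h2]) (by norm_num)
    have := key _ ((altRoot_succ b j i 1).symm.trans h3.symm)
    rw [hrefl] at this
    simpa [alt, altNext, hinv, mul_assoc] using this.symm
  · have h3 := altRoot_reverse (b := b) (i := i) (j := j) (m := 6) (n := 2)
      (by simp [IsCoxeterOrder, h1, h2]) (by norm_num)
    have := key _ ((altRoot_succ b j i 2).symm.trans h3.symm)
    rw [hrefl] at this
    simpa [alt, altNext, hinv, mul_assoc] using this.symm
  · have h3 := altRoot_reverse (b := b) (i := i) (j := j) (m := 6) (n := 2)
      (by simp [IsCoxeterOrder, h1, h2]) (by norm_num)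
    have := key _ ((altRoot_succ b j i 2).symm.trans h3.symm)
    rw [hrefl] at this
    simpa [alt, altNext, hinv, mul_assoc] using this.symm

variable (b) in
-- The only case beyond the finite base involves the affine node `-φ`, where the sign comes from the
-- dominance of `φ`.
lemma cartan_nonpos {i j : Option b.support} (hij : i ≠ j) : cartan b i j ≤ 0 := by
  have hdom (j : b.support) : 0 ≤ P.pairingIn ℤ (highest b) j := by
    obtain ⟨ρ, hρ⟩ := exists_pair_eq_height P b
    refine pairingIn_nonneg_of_maximal b (y := ρ) (fun j hj => ?_) (fun l => ?_) j.2
    · rw [hρ, Base.height_one_of_mem_support hj]; exact one_pos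
    · rw [hρ, hρ]; exact height_le_highest b l
  have h0 (j : b.support) : cartan b none (some j) ≤ 0 := by
    have h1 := hdom j
    have h2 : cartan b none (some j) = -P.pairingIn ℤ (highest b) j := by
      simp [cartan, simpleRoot]
    omega
  have hsgn (i j : Option b.support) (h : cartan b i j ≤ 0) : cartan b j i ≤ 0 := by
    by_contra! h'
    rw [cartan, P.zero_lt_pairingIn_iff'] at h'
    exact absurd h' (not_lt.2 h)
  rcases i with _ | i <;> rcases j with _ | j
  · exact absurd rfl hij
  · exact h0 j
  · exact hsgn _ _ (h0 i)
  · exact b.pairingIn_le_zero_of_ne (fun h => hij (by rw [Subtype.ext h])) i.2 j.2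

/-- If two simple reflections both decrease the length on the left, they generate a finite
dihedral group. -/
lemma exists_isCoxeterOrder {i j : Option b.support} (hij : i ≠ j) {w : ExtWeyl P}
    (hi : ¬ IsPosAff b (act w (simpleRoot b i))) (hj : ¬ IsPosAff b (act w (simpleRoot b j))) :
    ∃ m, IsCoxeterOrder (cartan b j i) (cartan b i j) m := by
  have h1 := cartan_nonpos b hij
  have h2 := cartan_nonpos b hij.symm
  have h3 := P.pairingIn_pairingIn_mem_set_of_isCrystal_of_isRed (simpleRoot b j).1
    (simpleRoot b i).1
  change (cartan b j i, cartan b i j) ∈ _ at h3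
  -- This excludes the infinite dihedral group. There `a_i + a_j` would be a positive multiple of
  -- `c`, which `w` fixes, so `w a_i` and `w a_j` could not both be negative.
  have h4 : ¬ (cartan b i j = -2 ∧ cartan b j i = -2) := by
    intro h
    have h5 := (P.pairingIn_neg_two_neg_two_iff ℤ _ _).1 h
    have h6 : (simpleRoot b j).1 = P.reflectionPerm (simpleRoot b i).1 (simpleRoot b i).1 := by
      apply P.root.injective
      rw [root_negIndex, h5, neg_neg]
    have h7 : 0 < (simpleRoot b i).2 + (simpleRoot b j).2 := by
      rcases i with _ | i <;> rcases j with _ | j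
      · exact absurd rfl hij
      · simp [simpleRoot]
      · simp [simpleRoot]
      · exfalso
        have h8 : P.root (i : ι) = -P.root (j : ι) := h5
        have h9 : (i : ι) = P.reflectionPerm (j : ι) (j : ι) := by
          apply P.root.injective
          rw [root_negIndex, h8]
        have := Base.isPos_of_mem_support i.2
        rw [h9, isPos_negIndex] at this
        exact this (Base.isPos_of_mem_support j.2)
    simp only [IsPosAff, AffHecke.act, h6, smul_negIndex, pair_negIndex, not_or] at hi hj
    omega
  simp only [Set.mem_insert_iff, Set.mem_singleton_iff, Prod.mk.injEq, Prod.mk_zero_zero,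
    Prod.mk_eq_zero, Prod.mk_one_one, Prod.mk_eq_one] at h3
  have h5 : (cartan b j i = 0 ∧ cartan b i j = 0) ∨ (cartan b j i = -1 ∧ cartan b i j = -1) ∨
      (cartan b j i = -1 ∧ cartan b i j = -2) ∨ (cartan b j i = -2 ∧ cartan b i j = -1) ∨
      (cartan b j i = -1 ∧ cartan b i j = -3) ∨ (cartan b j i = -3 ∧ cartan b i j = -1) := by
    omega
  rcases h5 with h | h | h | h | h | h
  · exact ⟨2, by simp [IsCoxeterOrder, h]⟩
  · exact ⟨3, by simp [IsCoxeterOrder, h]⟩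
  · exact ⟨4, by simp [IsCoxeterOrder, h]⟩
  · exact ⟨4, by simp [IsCoxeterOrder, h]⟩
  · exact ⟨6, by simp [IsCoxeterOrder, h]⟩
  · exact ⟨6, by simp [IsCoxeterOrder, h]⟩

lemma IsCoxeterOrder.pos {C C' : ℤ} {m : ℕ} (h : IsCoxeterOrder C C' m) : 0 < m := by
  unfold IsCoxeterOrder at h; omega

end RankTwo

/-! ### Matsumoto's theorem for the extended affine Weyl group -/

section Matsumoto

variable {P : RootPairing ι ℝ M N} [P.IsCrystallographic] {b : P.Base} [Fintype ι] [Nonempty ι]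
  [P.IsReduced] [P.IsIrreducible] {A : Type*} [Monoid A]

variable (b) in
lemma length_mul_le (v w : ExtWeyl P) : length b (v * w) ≤ length b v + length b w := by
  have hset : invSet b (v * w) ⊆ invSet b w ∪ act w⁻¹ '' invSet b v := by
    rintro a ⟨h1, h2⟩
    by_cases h3 : IsPosAff b (act w a)
    · exact Or.inr ⟨act w a, ⟨h3, by rwa [← act_mul]⟩, act_inv_act w a⟩
    · exact Or.inl ⟨h1, h3⟩
  refine (Set.ncard_le_ncard hset ((invSet_finite b w).union ((invSet_finite b v).image _))).trans
    ((Set.ncard_union_le _ _).trans ?_)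
  rw [Set.ncard_image_of_injective _ (act_injective _), add_comm]
  rfl

open Classical in
/-- The product of generators along a chosen reduced expression. -/
def wordLift (b : P.Base) (T : Option b.support → A) (O : ExtWeyl P → A) :
    ℕ → ExtWeyl P → A
  | 0, w => O w
  | n + 1, w => if h : length b w ≠ 0 then
      T (exists_left_descent b h).choose *
        wordLift b T O n (simpleRefl b (exists_left_descent b h).choose * w) else O w

/-- A function satisfying the braid relations extends to the extended affine Weyl group. -/
lemma exists_lift_of_braid (T : Option b.support → A) (O : ExtWeyl P → A)
    (hT : ∀ i j m, i ≠ j → IsCoxeterOrder (cartan b j i) (cartan b i j) m →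
      alt (T i) (T j) m = alt (T j) (T i) m) :
    ∃ F : ExtWeyl P → A, (∀ w, length b w = 0 → F w = O w) ∧
      ∀ j w, IsPosAff b (act w⁻¹ (simpleRoot b j)) → F (simpleRefl b j * w) = T j * F w := by
  let F : ExtWeyl P → A := fun w => wordLift b T O (length b w) w
  have hF0 (w : ExtWeyl P) (hw : length b w = 0) : F w = O w := by simp [F, hw, wordLift]
  have hF1 (w : ExtWeyl P) (hw : length b w ≠ 0) : ∃ j,
      ¬ IsPosAff b (act w⁻¹ (simpleRoot b j)) ∧ F w = T j * F (simpleRefl b j * w) := by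
    obtain ⟨n, hn⟩ := Nat.exists_eq_succ_of_ne_zero hw
    refine ⟨(exists_left_descent b hw).choose, (exists_left_descent b hw).choose_spec, ?_⟩
    have h1 := length_simpleRefl_mul_of_neg b (exists_left_descent b hw).choose_spec
    have h2 : length b (simpleRefl b (exists_left_descent b hw).choose * w) = n := by omega
    have h3 (l : ℕ) (hl : l = n + 1) : wordLift b T O l w =
        T (exists_left_descent b hw).choose *
          wordLift b T O n (simpleRefl b (exists_left_descent b hw).choose * w) := by
      rw [hl, wordLift, dif_pos hw]
    simp only [F, h2]
    exact h3 _ hn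
  -- The chosen first descent can be replaced by any other one; this is the independence of the
  -- reduced expression, by induction on the length.
  have key : ∀ n w, length b w = n → ∀ j, ¬ IsPosAff b (act w⁻¹ (simpleRoot b j)) →
      F w = T j * F (simpleRefl b j * w) := by
    intro n
    induction n using Nat.strong_induction_on with
    | _ n ih =>
    intro w hw j hj
    have hlj := length_simpleRefl_mul_of_neg b hj
    obtain ⟨i, hi, hFi⟩ := hF1 w (by omega)
    have hli := length_simpleRefl_mul_of_neg b hi
    by_cases hij : i = j
    · rw [hFi, hij]
    obtain ⟨m, hm⟩ := exists_isCoxeterOrder hij hi hj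
    -- With two descents `i`, `j`, all `m` letters of either alternating word can be peeled off `w`,
    -- each subsequent letter being a descent because the roots in question are nonnegative
    -- combinations of `a_i` and `a_j`. After the first letter the induction hypothesis applies. The
    -- braid relation then compares the two complete words.
    have chain (i j : Option b.support) (hi : ¬ IsPosAff b (act w⁻¹ (simpleRoot b i)))
        (hj : ¬ IsPosAff b (act w⁻¹ (simpleRoot b j)))
        (hm : IsCoxeterOrder (cartan b j i) (cartan b i j) m) (r : ℕ) (hr : r < m) :
        T i * F (simpleRefl b i * w) = alt (T i) (T j) (r + 1) *
          F ((alt (simpleRefl b i) (simpleRefl b j) (r + 1))⁻¹ * w) ∧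
        length b ((alt (simpleRefl b i) (simpleRefl b j) (r + 1))⁻¹ * w) < n := by
      induction r with
      | zero =>
        simp only [alt, mul_one, simpleRefl_inv]
        exact ⟨trivial, by have := length_simpleRefl_mul_of_neg b hi; omega⟩
      | succ r ihr =>
        obtain ⟨h1, h2⟩ := ihr (by omega)
        set v := (alt (simpleRefl b i) (simpleRefl b j) (r + 1))⁻¹ * w with hv
        have h3 : ¬ IsPosAff b (act v⁻¹ (simpleRoot b (altNext i j (r + 1)))) := by
          rw [hv, mul_inv_rev, inv_inv, act_mul]
          exact ((hasCoord_altRoot b i j (r + 1)).act w⁻¹).not_isPosAff b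
            (hm.altCoord_nonneg hr) hi hj
        have h4 : (alt (simpleRefl b i) (simpleRefl b j) (r + 1 + 1))⁻¹ * w =
            simpleRefl b (altNext i j (r + 1)) * v := by
          rw [alt_succ' (simpleRefl b) i j (r + 1), mul_inv_rev, simpleRefl_inv, hv, mul_assoc]
        have h5 := length_simpleRefl_mul_of_neg b h3
        refine ⟨?_, by rw [h4]; omega⟩
        rw [h1, ih _ h2 v rfl _ h3, h4, alt_succ' T i j (r + 1), mul_assoc]
    have h1 := (chain i j hi hj hm (m - 1) (Nat.sub_lt hm.pos one_pos)).1
    have h2 := (chain j i hj hi hm.symm (m - 1) (Nat.sub_lt hm.pos one_pos)).1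
    rw [show m - 1 + 1 = m from Nat.sub_add_cancel hm.pos] at h1 h2
    rw [hFi, h1, h2, hT i j m hij hm, alt_simpleRefl_comm hm]
  refine ⟨F, hF0, fun j w h => ?_⟩
  rw [key _ (simpleRefl b j * w) rfl j, simpleRefl_mul_cancel]
  rw [mul_inv_rev, act_mul, simpleRefl_inv, act_simpleRefl_self, act_negAff, isPosAff_negAff]
  exact not_not.2 h

/-- Multiplicativity, for additive lengths, of a function built from reduced expressions. -/
lemma map_mul_of_length_add {T : Option b.support → A} {O : ExtWeyl P → A} {F : ExtWeyl P → A}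
    (hF0 : ∀ w, length b w = 0 → F w = O w)
    (hF1 : ∀ j w, IsPosAff b (act w⁻¹ (simpleRoot b j)) → F (simpleRefl b j * w) = T j * F w)
    (hO : ∀ v w, length b v = 0 → length b w = 0 → O (v * w) = O v * O w)
    (hOT : ∀ w i j, length b w = 0 → act w (simpleRoot b j) = simpleRoot b i →
      O w * T j = T i * O w)
    {v w : ExtWeyl P} (h : length b (v * w) = length b v + length b w) :
    F (v * w) = F v * F w := by
  induction v using extWeyl_induction b with
  | h0 v hv =>
    clear h
    induction w using extWeyl_induction b with
    | h0 w hw =>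
      rw [hF0 _ hv, hF0 _ hw, ← hO v w hv hw, hF0]
      rw [length_mul_of_length_eq_zero_left b hv, hw]
    | h1 j w hj ih =>
      obtain ⟨i, hi⟩ := exists_act_simpleRoot_eq b hv j
      have h1 : IsPosAff b (act (v * w)⁻¹ (simpleRoot b i)) := by
        rw [mul_inv_rev, act_mul, ← hi, act_inv_act]; exact hj
      rw [← mul_assoc, mul_simpleRefl_of_act_eq b hi, mul_assoc, hF1 i _ h1, ih, hF1 j w hj,
        hF0 v hv, ← mul_assoc, ← mul_assoc, hOT v i j hv hi]
  | h1 j v hj ih =>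
    have h1 := length_mul_le b v w
    have h2 := length_simpleRefl_mul b hj
    rw [mul_assoc] at h
    -- In the negative case `s_j` lengthens `v` but shortens `v * w`, which contradicts the
    -- additivity of lengths.
    by_cases h3 : IsPosAff b (act (v * w)⁻¹ (simpleRoot b j))
    · have h4 := length_simpleRefl_mul b h3
      rw [mul_assoc, hF1 j _ h3, ih (by omega), hF1 j v hj, mul_assoc]
    · have h4 := length_simpleRefl_mul_of_neg b h3
      omega

end Matsumoto

/-! ### Demazure–Lusztig operators in a skew group algebra -/

section SkewBraid

open SkewMonoidAlgebra

variable {F G : Type*} [Field F] [Group G] [MulSemiringAction G F]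

/-- The Demazure–Lusztig operator `κ + (κ - h / (1 - x)) (s - 1)`. -/
def dlOp (s : G) (κ h x : F) : SkewMonoidAlgebra F G :=
  single 1 (h * (1 - x)⁻¹) + single s (κ - h * (1 - x)⁻¹)

lemma dlOp_eq (s : G) (κ h x : F) :
    dlOp s κ h x = singleOneRingHom (G := G) (h * (1 - x)⁻¹) +
      singleOneRingHom (G := G) (κ - h * (1 - x)⁻¹) * single s 1 := by
  simp [dlOp, singleOneRingHom, single_mul_single]

lemma single_mul_singleOne (s : G) (f : F) :
    single s 1 * singleOneRingHom (G := G) f =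
      singleOneRingHom (MulSemiringAction.toRingHom G F s f) * single s 1 := by
  simp [singleOneRingHom, single_mul_single]

/-- The partial fraction relation that supplies the hypotheses `r..` of the rank two identities. -/
lemma inv_one_sub_mul {u v : F} (hu : u ≠ 1) (hv : v ≠ 1) (huv : u * v ≠ 1) :
    (1 - u)⁻¹ * (1 - v)⁻¹ = (1 - u * v)⁻¹ * ((1 - u)⁻¹ + (1 - v)⁻¹ - 1) := by
  have h1 : 1 - u ≠ 0 := sub_ne_zero.2 hu.symm
  have h2 : 1 - v ≠ 0 := sub_ne_zero.2 hv.symm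
  have h3 : 1 - u * v ≠ 0 := sub_ne_zero.2 huv.symm
  field_simp
  ring

lemma inv_one_sub_inv {u : F} (hu : u ≠ 1) (hu0 : u ≠ 0) : (1 - u⁻¹)⁻¹ = 1 - (1 - u)⁻¹ := by
  have h1 : 1 - u ≠ 0 := sub_ne_zero.2 hu.symm
  have h2 : 1 - u⁻¹ ≠ 0 := by
    intro h
    apply hu
    rw [sub_eq_zero] at h
    rw [← inv_inv u, ← h, inv_one]
  have h3 : u - 1 ≠ 0 := sub_ne_zero.2 hu
  field_simp
  ring

lemma smul_ne_one_of_ne_one (s : G) {u : F} (hu : u ≠ 1) : s • u ≠ 1 := fun h => hu (by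
  rw [← inv_smul_smul s u, h, smul_one])

lemma toRingHom_inv_one_sub (s : G) (u : F) :
    MulSemiringAction.toRingHom G F s (1 - u)⁻¹ = (1 - s • u)⁻¹ := by
  rw [MulSemiringAction.toRingHom_apply, smul_inv'', smul_sub, smul_one]

variable {s t : G} {x y ks hs kt ht : F}

/-- The spherical part of the braid relation between two Demazure–Lusztig operators. -/
lemma alt_dlOp_mul_one_add {p r m : ℕ} (hm : IsCoxeterOrder (-r) (-p) m)
    (hss : s * s = 1) (htt : t * t = 1) (hbr : alt s t m = alt t s m)
    (hx : x ≠ 1) (hy : y ≠ 1) (hx0 : x ≠ 0) (hy0 : y ≠ 0)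
    (hsx : s • x = x⁻¹) (hsy : s • y = y * x ^ p) (hty : t • y = y⁻¹) (htx : t • x = x * y ^ r)
    (hsk : s • ks = ks) (htk : t • ks = ks) (hsh : s • hs = hs) (hth : t • hs = hs)
    (hsk' : s • kt = kt) (htk' : t • kt = kt) (hsh' : s • ht = ht) (hth' : t • ht = ht)
    (hA : m = 3 → ks = kt ∧ hs = ht) :
    alt (dlOp s ks hs x) (dlOp t kt ht y) m * (1 + single s 1) =
      alt (dlOp t kt ht y) (dlOp s ks hs x) m * (1 + single s 1) := by
  set i := singleOneRingHom (k := F) (G := G) with hi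
  set S : SkewMonoidAlgebra F G := single s 1 with hSdef
  set T : SkewMonoidAlgebra F G := single t 1 with hTdef
  have hS : ∀ f, S * i f = i (MulSemiringAction.toRingHom G F s f) * S := single_mul_singleOne s
  have hT : ∀ f, T * i f = i (MulSemiringAction.toRingHom G F t f) * T := single_mul_singleOne t
  have hSS : S * S = 1 := by simp [hSdef, single_mul_single, hss]
  have hTT : T * T = 1 := by simp [hTdef, single_mul_single, htt]
  -- The element `1 + S` plays the role of the `S`-invariant vector.
  have hv : S * (1 + S) = 1 + S := by rw [mul_add, hSS, mul_one, add_comm]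
  have hST : alt S T m = alt T S m := by
    have h (a c : G) (n : ℕ) :
        alt (single a (1 : F)) (single c (1 : F)) n = single (alt a c n) (1 : F) := by
      induction n generalizing a c with
      | zero => rfl
      | succ n ih => rw [alt, ih, single_mul_single, alt, one_mul, smul_one]
    rw [h, h, hbr]
  have hσ : ∀ f, MulSemiringAction.toRingHom G F s (MulSemiringAction.toRingHom G F s f) = f :=
    fun f => by simp [← mul_smul, hss]
  have hτ : ∀ f, MulSemiringAction.toRingHom G F t (MulSemiringAction.toRingHom G F t f) = f :=
    fun f => by simp [← mul_smul, htt]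
  -- The word ending in the operator of `s` loses its last letter at the cost of the scalar `ks`, so
  -- the braid relation becomes the scalar action established in rank two.
  have hTs : dlOp s ks hs x * (1 + S) = i ks * (1 + S) := by
    rw [dlOp_eq, add_mul, mul_assoc, ← hSdef, hv, ← add_mul, ← map_add]
    congr 2
    ring
  have hcomm (z : F) (hz : s • z = z) (hz' : t • z = z) :
      (∀ X, dlOp s ks hs x * (i z * X) = i z * (dlOp s ks hs x * X)) ∧
      (∀ X, dlOp t kt ht y * (i z * X) = i z * (dlOp t kt ht y * X)) := by
    constructor <;> intro X <;> rw [dlOp_eq, ← mul_assoc, ← mul_assoc] <;> congr 1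
    · rw [add_mul, mul_assoc, ← hSdef, hS, MulSemiringAction.toRingHom_apply, hz, mul_add,
        ← mul_assoc, ← mul_assoc, ← map_mul, ← map_mul, ← map_mul, ← map_mul, mul_comm z, mul_comm z]
    · rw [add_mul, mul_assoc, ← hTdef, hT, MulSemiringAction.toRingHom_apply, hz', mul_add,
        ← mul_assoc, ← mul_assoc, ← map_mul, ← map_mul, ← map_mul, ← map_mul, mul_comm z, mul_comm z]
  obtain ⟨hc1, hc2⟩ := hcomm ks hsk htk
  have hs10 : MulSemiringAction.toRingHom G F s (1 - x)⁻¹ = 1 - (1 - x)⁻¹ := by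
    rw [toRingHom_inv_one_sub, hsx, inv_one_sub_inv hx hx0]
  have ht01 : MulSemiringAction.toRingHom G F t (1 - y)⁻¹ = 1 - (1 - y)⁻¹ := by
    rw [toRingHom_inv_one_sub, hty, inv_one_sub_inv hy hy0]
  have hsx' := smul_ne_one_of_ne_one t hx
  have hty' := smul_ne_one_of_ne_one s hy
  have hSc (Z : SkewMonoidAlgebra F G) : S * (S * Z) = Z := by rw [← mul_assoc, hSS, one_mul]
  have hS3 (h : alt S T 4 = alt T S 4) :
      S * (T * (S * (T * (1 + S)))) = T * (S * (T * (1 + S))) := by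
    simp only [alt, mul_one] at h
    simp only [mul_add, mul_one, ← h, hSc]
    rw [add_comm]
  have hS5 (h : alt S T 6 = alt T S 6) :
      S * (T * (S * (T * (S * (T * (1 + S)))))) = T * (S * (T * (S * (T * (1 + S))))) := by
    simp only [alt, mul_one] at h
    simp only [mul_add, mul_one, ← h, hSc]
    rw [add_comm]
  rcases hm with ⟨h1, h2, rfl⟩ | ⟨h1, h2, rfl⟩ | ⟨h1, h2, rfl⟩ | ⟨h1, h2, rfl⟩ |
    ⟨h1, h2, rfl⟩ | ⟨h1, h2, rfl⟩
  · obtain rfl : r = 0 := by omega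
    obtain rfl : p = 0 := by omega
    rw [pow_zero, mul_one] at hsy htx
    have e3 : s • (1 - y)⁻¹ = (1 - y)⁻¹ := by rw [smul_inv'', smul_sub, smul_one, hsy]
    have e4 : t • (1 - x)⁻¹ = (1 - x)⁻¹ := by rw [smul_inv'', smul_sub, smul_one, htx]
    have hst : s * t = t * s := by simpa [alt] using hbr
    simp only [alt, mul_one]
    congr 1
    simp only [dlOp, add_mul, mul_add, single_mul_single, one_mul, mul_one, one_smul, smul_mul',
      smul_sub, e3, e4, hsh', hsk', hth, htk, hst, mul_comm (ht * (1 - y)⁻¹),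
      mul_comm (kt - ht * (1 - y)⁻¹)]
    abel
  · obtain rfl : r = 1 := by omega
    obtain rfl : p = 1 := by omega
    obtain ⟨rfl, rfl⟩ := hA rfl
    rw [pow_one] at hsy htx
    rw [htx] at hsx'
    have hT2 : T * (S * (T * (1 + S))) = S * (T * (1 + S)) := by
      simp only [alt, mul_one] at hST
      have : T * (S * (T * S)) = S * T := by rw [hST, ← mul_assoc T T, hTT, one_mul]
      simp only [mul_add, mul_one, this, ← hST]
      rw [add_comm]
    have key := spherical_A2 (i := i) hS hT hSS hTT hv hτ (ks := ks) (hs := hs) hsk htk hsh hth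
      (t10 := (1 - x)⁻¹) (t01 := (1 - y)⁻¹) (t11 := (1 - x * y)⁻¹) hT2
      (by rw [toRingHom_inv_one_sub, hsy, mul_comm]) (by rw [toRingHom_inv_one_sub, htx]) ht01
      (by rw [toRingHom_inv_one_sub, smul_mul', htx, hty, mul_inv_cancel_right₀ hy0])
      (inv_one_sub_mul hx hy hsx')
    simp only [alt, mul_one, mul_assoc, hTs]
    rw [hc2, hc1, dlOp_eq, dlOp_eq]
    exact key.symm
  · obtain rfl : r = 1 := by omega
    obtain rfl : p = 2 := by omega
    rw [pow_one] at htx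
    rw [htx] at hsx'
    rw [hsy] at hty'
    have e21 : x * (x * y) ≠ 1 := by rwa [← mul_assoc, ← sq, mul_comm]
    have key := spherical_B2_of_sq (i := i) hS hT hSS hTT hv hσ hsk hsk' htk htk' hsh hsh' hth hth'
      (t10 := (1 - x)⁻¹) (t01 := (1 - y)⁻¹) (t11 := (1 - x * y)⁻¹) (t21 := (1 - x * (x * y))⁻¹)
      (hS3 hST) hs10
      (by rw [toRingHom_inv_one_sub, hsy]; congr 2; ring)
      (by rw [toRingHom_inv_one_sub, smul_mul', hsx, hsy]; congr 2; field_simp)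
      (by rw [toRingHom_inv_one_sub, smul_mul', smul_mul', hsx, hsy]; congr 2; field_simp)
      (by rw [toRingHom_inv_one_sub, htx]) ht01
      (by rw [toRingHom_inv_one_sub, smul_mul', htx, hty]; congr 2; field_simp)
      (by rw [toRingHom_inv_one_sub, smul_mul', smul_mul', htx, hty]; congr 2; field_simp)
      (inv_one_sub_mul hx hy hsx') (inv_one_sub_mul hx hsx' e21)
    simp only [alt, mul_one, mul_assoc, hTs]
    rw [hc2, hc1, hc2, dlOp_eq, dlOp_eq]
    exact key
  · obtain rfl : r = 2 := by omega
    obtain rfl : p = 1 := by omega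
    rw [pow_one] at hsy
    rw [htx] at hsx'
    rw [hsy, mul_comm] at hty'
    have e12 : y * (x * y) ≠ 1 := by rwa [mul_comm, mul_assoc, ← sq]
    have key := spherical_B2_of_sq' (i := i) hS hT hSS hTT hv hσ hsk hsk' htk htk' hsh hsh' hth hth'
      (t10 := (1 - x)⁻¹) (t01 := (1 - y)⁻¹) (t11 := (1 - x * y)⁻¹) (t12 := (1 - y * (x * y))⁻¹)
      (hS3 hST) hs10
      (by rw [toRingHom_inv_one_sub, hsy, mul_comm])
      (by rw [toRingHom_inv_one_sub, smul_mul', hsx, hsy]; congr 2; field_simp)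
      (by rw [toRingHom_inv_one_sub, smul_mul', smul_mul', hsx, hsy]; congr 2; field_simp)
      (by rw [toRingHom_inv_one_sub, htx]; congr 2; ring) ht01
      (by rw [toRingHom_inv_one_sub, smul_mul', htx, hty]; congr 2; field_simp)
      (by rw [toRingHom_inv_one_sub, smul_mul', smul_mul', htx, hty]; congr 2; field_simp)
      (inv_one_sub_mul hx hy hty') (inv_one_sub_mul hy hty' e12)
    simp only [alt, mul_one, mul_assoc, hTs]
    rw [hc2, hc1, hc2, dlOp_eq, dlOp_eq]
    exact key
  · obtain rfl : r = 1 := by omega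
    obtain rfl : p = 3 := by omega
    rw [pow_one] at htx
    rw [htx] at hsx'
    rw [hsy] at hty'
    -- The exponentials of the remaining roots differ from `1` as images under `s` or `t` of ones
    -- already treated.
    have e21 : x * (x * y) ≠ 1 := by
      have := smul_ne_one_of_ne_one s hsx'
      rw [smul_mul', hsx, hsy] at this
      convert this using 1
      field_simp
    have e31 : x * (x * (x * y)) ≠ 1 := by convert hty' using 1; ring
    have e32 : x * y * (x * (x * y)) ≠ 1 := by
      have := smul_ne_one_of_ne_one t e31
      simp only [smul_mul', htx, hty] at this
      convert this using 1
      field_simp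
    have e32' : y * (x * (x * (x * y))) = x * y * (x * (x * y)) := by ring
    have key := spherical_G2_of_cube (i := i) hS hT hSS hTT hv hσ hsk hsk' htk htk' hsh hsh' hth hth'
      (t10 := (1 - x)⁻¹) (t01 := (1 - y)⁻¹) (t11 := (1 - x * y)⁻¹) (t21 := (1 - x * (x * y))⁻¹)
      (t31 := (1 - x * (x * (x * y)))⁻¹) (t32 := (1 - x * y * (x * (x * y)))⁻¹)
      (hS5 hST) hs10
      (by rw [toRingHom_inv_one_sub, hsy]; congr 2; ring)
      (by rw [toRingHom_inv_one_sub, smul_mul', hsx, hsy]; congr 2; field_simp)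
      (by rw [toRingHom_inv_one_sub, smul_mul', smul_mul', hsx, hsy]; congr 2; field_simp)
      (by simp only [toRingHom_inv_one_sub, smul_mul', hsx, hsy]; congr 2; field_simp)
      (by simp only [toRingHom_inv_one_sub, smul_mul', hsx, hsy]; congr 2; field_simp)
      (by rw [toRingHom_inv_one_sub, htx]) ht01
      (by rw [toRingHom_inv_one_sub, smul_mul', htx, hty]; congr 2; field_simp)
      (by rw [toRingHom_inv_one_sub, smul_mul', smul_mul', htx, hty]; congr 2; field_simp)
      (by simp only [toRingHom_inv_one_sub, smul_mul', htx, hty]; congr 2; field_simp)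
      (by simp only [toRingHom_inv_one_sub, smul_mul', htx, hty]; congr 2; field_simp)
      (inv_one_sub_mul hx hy hsx') (inv_one_sub_mul hx hsx' e21) (inv_one_sub_mul hx e21 e31)
      (inv_one_sub_mul hsx' e21 e32) (by rw [← e32', inv_one_sub_mul hy e31 (by rwa [e32'])])
    simp only [alt, mul_one, mul_assoc, hTs]
    rw [hc2, hc1, hc2, hc1, hc2, dlOp_eq, dlOp_eq]
    simpa only [mul_assoc] using key
  · obtain rfl : r = 3 := by omega
    obtain rfl : p = 1 := by omega
    rw [pow_one] at hsy
    rw [htx] at hsx'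
    rw [hsy, mul_comm] at hty'
    have e12 : y * (x * y) ≠ 1 := by
      have := smul_ne_one_of_ne_one t hty'
      rw [smul_mul', htx, hty] at this
      convert this using 1
      field_simp
    have e13 : y * (y * (x * y)) ≠ 1 := by convert hsx' using 1; ring
    have e23 : x * y * (y * (x * y)) ≠ 1 := by
      have := smul_ne_one_of_ne_one s e13
      simp only [smul_mul', hsx, hsy] at this
      convert this using 1
      field_simp
    have e23' : x * (y * (y * (x * y))) = x * y * (y * (x * y)) := by ring
    have key := spherical_G2_of_cube' (i := i) hS hT hSS hTT hv hσ hsk hsk' htk htk' hsh hsh' hth hth'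
      (t10 := (1 - x)⁻¹) (t01 := (1 - y)⁻¹) (t11 := (1 - x * y)⁻¹) (t12 := (1 - y * (x * y))⁻¹)
      (t13 := (1 - y * (y * (x * y)))⁻¹) (t23 := (1 - x * y * (y * (x * y)))⁻¹)
      (hS5 hST) hs10
      (by rw [toRingHom_inv_one_sub, hsy, mul_comm])
      (by rw [toRingHom_inv_one_sub, smul_mul', hsx, hsy]; congr 2; field_simp)
      (by rw [toRingHom_inv_one_sub, smul_mul', smul_mul', hsx, hsy]; congr 2; field_simp)
      (by simp only [toRingHom_inv_one_sub, smul_mul', hsx, hsy]; congr 2; field_simp)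
      (by simp only [toRingHom_inv_one_sub, smul_mul', hsx, hsy]; congr 2; field_simp)
      (by rw [toRingHom_inv_one_sub, htx]; congr 2; ring) ht01
      (by rw [toRingHom_inv_one_sub, smul_mul', htx, hty]; congr 2; field_simp)
      (by rw [toRingHom_inv_one_sub, smul_mul', smul_mul', htx, hty]; congr 2; field_simp)
      (by simp only [toRingHom_inv_one_sub, smul_mul', htx, hty]; congr 2; field_simp)
      (by simp only [toRingHom_inv_one_sub, smul_mul', htx, hty]; congr 2; field_simp)
      (inv_one_sub_mul hx hy hty') (inv_one_sub_mul hy hty' e12) (inv_one_sub_mul hy e12 e13)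
      (inv_one_sub_mul hty' e12 e23) (by rw [← e23', inv_one_sub_mul hx e13 (by rwa [e23'])])
    simp only [alt, mul_one, mul_assoc, hTs]
    rw [hc2, hc1, hc2, hc1, hc2, dlOp_eq, dlOp_eq]
    simpa only [mul_assoc] using key

end SkewBraid

/-! ### Exponentials of affine roots and the operators `T_j` -/

section ExpRoot

variable {P : RootPairing ι ℝ M N} [P.IsCrystallographic] {b : P.Base} [Fintype ι] [Nonempty ι]
  [P.IsReduced] [P.IsIrreducible] (q : QParam b)

lemma form_symm (x y : N) : form b x y = form b y x := by
  simp only [form, corootForm_apply_apply]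
  congr 2
  exact Finset.sum_congr rfl fun i _ => mul_comm _ _

lemma form_zsmul_left (n : ℤ) (x y : N) : form b (n • x) y = n * form b x y := by
  simp only [form, map_zsmul, LinearMap.smul_apply, zsmul_eq_mul]
  ring

lemma form_neg_right (x y : N) : form b x (-y) = -form b x y := by
  simp [form, neg_div]

/-- The reflection in `α_i` preserves the form, negates `α_i^∨`, and subtracts `⟨x, α_i⟩ α_i^∨` from
`x`. -/
lemma form_coroot (x : Cowt P) (i : ι) :
    form b x (P.coroot i) = pair x i * (form b (P.coroot i) (P.coroot i) / 2) := by
  have h := QParam.form_smul (b := b) (weylGroup.ofIdx P i) x (corootCowt i)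
  have h1 : ((weylGroup.ofIdx P i • corootCowt (P := P) i : Cowt P) : N) = -P.coroot i := by
    rw [smul_corootCowt, ofIdx_smul_index, corootCowt_negIndex]; rfl
  have h2 : ((weylGroup.ofIdx P i • x : Cowt P) : N) = (x : N) + (-pair x i) • P.coroot i := by
    rw [ofIdx_smul_cowt, sub_eq_add_neg, neg_smul]; rfl
  rw [h1, h2, form_neg_right, QParam.form_add_left, form_zsmul_left] at h
  have h3 : ((corootCowt (P := P) i : Cowt P) : N) = P.coroot i := rfl
  rw [h3] at h
  push_cast at h
  linarith

/-- Every root is primitive on `P^∨`, being conjugate to a simple one. Together with `form_coroot`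
this makes `m ⟨α^∨, α^∨⟩ / 2` an integer, so the floor in `qpow` does not distort the powers of `q`
attached to affine roots. -/
lemma exists_pair_eq_one (b : P.Base) (i : ι) : ∃ x : Cowt P, pair x i = 1 := by
  refine b.induction_reflect i (p := fun i => ∃ x : Cowt P, pair x i = 1) ?_ ?_ ?_
  · rintro i ⟨x, hx⟩
    exact ⟨-x, by rw [pair_negIndex, pair_neg, hx]; norm_num⟩
  · intro i hi
    obtain ⟨x, hx⟩ := exists_cowt b fun _ => 1
    exact ⟨x, hx ⟨i, hi⟩⟩
  · rintro i j ⟨x, hx⟩ hj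
    refine ⟨weylGroup.ofIdx P j • x, ?_⟩
    rw [pair_smul, ← ofIdx_smul_index, inv_smul_smul, hx]

lemma exists_rootExp (i : ι) :
    ∃ n : ℤ, q.m * (form b (P.coroot i) (P.coroot i) / 2) = n := by
  obtain ⟨x, hx⟩ := exists_pair_eq_one b i
  obtain ⟨z, hz⟩ := q.exists_int x (corootCowt i)
  refine ⟨z, ?_⟩
  rw [← hz]
  change _ = (q.m : ℝ) * form b x (P.coroot i)
  rw [form_coroot, hx, Int.cast_one, one_mul]

/-- The integer `m ⟨α^∨, α^∨⟩ / 2`. -/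
def rootExp (i : ι) : ℤ := (exists_rootExp q i).choose

lemma rootExp_spec (i : ι) :
    q.m * (form b (P.coroot i) (P.coroot i) / 2) = rootExp q i := (exists_rootExp q i).choose_spec

lemma rootExp_smul (w : P.weylGroup) (i : ι) : rootExp q (w • i) = rootExp q i := by
  have h := QParam.form_smul (b := b) w (corootCowt i) (corootCowt i)
  rw [smul_corootCowt] at h
  have h1 := rootExp_spec q (w • i)
  have h2 : form b (P.coroot (w • i)) (P.coroot (w • i)) = form b (P.coroot i) (P.coroot i) := h
  rw [h2, rootExp_spec] at h1
  exact_mod_cast h1.symm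

lemma qpow_rootExp (r : ℤ) (i : ι) :
    q.qpow (r * (form b (P.coroot i) (P.coroot i) / 2)) = (q.root : ℂ) ^ (r * rootExp q i) := by
  have : (q.m : ℝ) * (r * (form b (P.coroot i) (P.coroot i) / 2)) = ((r * rootExp q i : ℤ) : ℝ) := by
    push_cast
    rw [← rootExp_spec]
    ring
  rw [QParam.qpow, this, Int.floor_intCast]

lemma qpair_corootCowt (x : Cowt P) (i : ι) :
    q.qpair x (corootCowt i) = (q.root : ℂ) ^ (-pair x i * rootExp q i) := by
  rw [← qpow_rootExp, QParam.qpair]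
  congr 1
  change -form b x (P.coroot i) = _
  rw [form_coroot]
  push_cast
  ring

lemma pairingIn_mul_rootExp (i j : ι) :
    P.pairingIn ℤ i j * rootExp q i = P.pairingIn ℤ j i * rootExp q j := by
  have h1 := form_coroot (b := b) (corootCowt j) i
  have h2 := form_coroot (b := b) (corootCowt i) j
  rw [pair_coroot] at h1 h2
  have h3 := form_symm (b := b) (P.coroot i) (P.coroot j)
  have h4 : (P.pairingIn ℤ i j : ℝ) * (form b (P.coroot i) (P.coroot i) / 2) =
      P.pairingIn ℤ j i * (form b (P.coroot j) (P.coroot j) / 2) :=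
    h1.symm.trans (h3.symm.trans h2)
  have h5 := rootExp_spec q i
  have h6 := rootExp_spec q j
  have : ((P.pairingIn ℤ i j * rootExp q i : ℤ) : ℝ) = (P.pairingIn ℤ j i * rootExp q j : ℤ) := by
    push_cast
    rw [← h5, ← h6]
    linear_combination (q.m : ℝ) * h4
  exact_mod_cast this

/-- The monomials `q^{n/m} e^x` in `ℂ(T)`. -/
def qmono : Multiplicative (Cowt P × ℤ) →* RatFun q where
  toFun z := algebraMap (Reg P) (RatFun q) (AddMonoidAlgebra.single z.toAdd.1
    ((q.root : ℂ) ^ z.toAdd.2))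
  map_one' := by
    rw [toAdd_one, Prod.fst_zero, Prod.snd_zero, zpow_zero]
    exact map_one _
  map_mul' y z := by
    rw [← map_mul, AddMonoidAlgebra.single_mul_single, toAdd_mul, Prod.fst_add, Prod.snd_add,
      zpow_add₀ q.root.ne_zero]

lemma expRoot_eq (a : AffRoot ι) :
    expRoot q a = qmono q (.ofAdd (corootCowt a.1, a.2 * rootExp q a.1)) := by
  rw [expRoot, qpow_rootExp]; rfl

lemma qmono_ne_zero (z : Multiplicative (Cowt P × ℤ)) : qmono q z ≠ 0 := by
  intro h
  have : qmono q (z * z⁻¹) = 0 := by rw [map_mul, h, zero_mul]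
  rw [mul_inv_cancel, map_one] at this
  exact one_ne_zero this

lemma qmono_inv (z : Multiplicative (Cowt P × ℤ)) : qmono q z⁻¹ = (qmono q z)⁻¹ := by
  refine eq_inv_of_mul_eq_one_left ?_
  rw [← map_mul, inv_mul_cancel, map_one]

lemma smul_expRoot (w : ExtWeyl P) (a : AffRoot ι) :
    w • expRoot q a = expRoot q (act w a) := by
  rw [expRoot, qpow_rootExp, smul_algebraMap_reg, QParam.regAct_single, smul_corootCowt,
    qpair_corootCowt, ← zpow_add₀ q.root.ne_zero, expRoot_eq]
  simp only [act, rootExp_smul]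
  rw [← add_mul, ← sub_eq_add_neg]
  rfl

lemma expRoot_ne_zero (a : AffRoot ι) : expRoot q a ≠ 0 := by
  rw [expRoot_eq]; exact qmono_ne_zero q _

lemma expRoot_negAff (a : AffRoot ι) : expRoot q (negAff P a) = (expRoot q a)⁻¹ := by
  rw [expRoot_eq, expRoot_eq, ← qmono_inv]
  congr 1
  apply Multiplicative.toAdd.injective
  simp only [negAff, ← ofIdx_smul_index, rootExp_smul, toAdd_ofAdd, toAdd_inv,
    Prod.neg_mk, neg_mul]
  rw [ofIdx_smul_index, corootCowt_negIndex]

lemma expRoot_affRefl (a c : AffRoot ι) {p : ℕ} (hp : P.pairingIn ℤ a.1 c.1 = -p) :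
    expRoot q (act (affRefl (P := P) a) c) = expRoot q c * expRoot q a ^ p := by
  rw [act_affRefl, expRoot_eq, expRoot_eq, expRoot_eq, ← map_pow, ← map_mul]
  congr 1
  apply Multiplicative.toAdd.injective
  simp only [← ofIdx_smul_index, rootExp_smul, toAdd_ofAdd, toAdd_mul, toAdd_pow, Prod.mk_add_mk,
    Prod.smul_mk, Prod.mk.injEq]
  constructor
  · rw [← smul_corootCowt, ofIdx_smul_cowt, pair_coroot, hp, neg_smul, sub_neg_eq_add, natCast_zsmul]
  · have := pairingIn_mul_rootExp q a.1 c.1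
    rw [hp] at this
    rw [nsmul_eq_mul]
    linear_combination a.2 * this

lemma corootCowt_ne_zero (i : ι) : corootCowt (P := P) i ≠ 0 := by
  intro h
  have := pair_coroot (P := P) i i
  rw [h, pair_zero, pairingIn_same] at this
  norm_num at this

/-- A nonzero multiple of a monomial with nonzero exponent is not constant, whatever `q` is. So no
denominator and no c-function vanishes, even at roots of unity. -/
lemma expRoot_ne_algebraMap (a : AffRoot ι) (z : ℂ) :
    expRoot q a ≠ algebraMap ℂ (RatFun q) z := by
  intro h
  rw [IsScalarTower.algebraMap_apply ℂ (Reg P) (RatFun q), expRoot] at h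
  have h1 := IsFractionRing.injective (Reg P) (RatFun q) h
  rw [AddMonoidAlgebra.coe_algebraMap] at h1
  have h2 := congrArg (fun f : Reg P => f.coeff (corootCowt a.1)) h1
  simp only [AddMonoidAlgebra.coeff_single, Function.comp_apply, Finsupp.single_eq_same,
    Finsupp.single_eq_of_ne (corootCowt_ne_zero (P := P) a.1), QParam.qpow] at h2
  exact zpow_ne_zero _ q.root.ne_zero h2

lemma expRoot_ne_one (a : AffRoot ι) : expRoot q a ≠ 1 := by
  have := expRoot_ne_algebraMap q a 1
  rwa [map_one] at this

lemma smul_const (w : ExtWeyl P) (z : ℂ) :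
    w • algebraMap ℂ (RatFun q) z = algebraMap ℂ (RatFun q) z := by
  rw [Algebra.algebraMap_eq_smul_one, smul_comm, smul_one]

variable (k : Mult P)

lemma mult_act (w : ExtWeyl P) (a : AffRoot ι) : k.1 (act w a) = k.1 a := k.2 w a

lemma constRoot_act (w : ExtWeyl P) (a : AffRoot ι) : constRoot q k (act w a) = constRoot q k a := by
  rw [constRoot, mult_act, constRoot]

lemma smul_constRoot (w : ExtWeyl P) (a : AffRoot ι) : w • constRoot q k a = constRoot q k a :=
  smul_const q w _

lemma constRoot_ne_zero (a : AffRoot ι) : constRoot q k a ≠ 0 := by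
  simp [constRoot]

lemma smul_cFun (w : ExtWeyl P) (a : AffRoot ι) : w • cFun q k a = cFun q k (act w a) := by
  simp only [cFun, div_eq_mul_inv, smul_mul', smul_sub, smul_inv'', smul_one, smul_expRoot,
    smul_constRoot, constRoot_act]

lemma cFun_ne_zero (a : AffRoot ι) : cFun q k a ≠ 0 := by
  have h := constRoot_ne_zero q k a
  refine div_ne_zero (fun h0 => ?_) (sub_ne_zero.2 (expRoot_ne_one q a).symm)
  apply expRoot_ne_algebraMap q a ((k.1 a : ℂ)⁻¹ * (k.1 a : ℂ)⁻¹)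
  rw [map_mul, map_inv₀]
  change _ = (constRoot q k a)⁻¹ * (constRoot q k a)⁻¹
  rw [sub_eq_zero] at h0
  field_simp
  field_simp at h0
  linear_combination -h0

/-- The parameter `h = k - k⁻¹`. -/
def hConst (a : AffRoot ι) : RatFun q := constRoot q k a - (constRoot q k a)⁻¹

lemma cFun_eq (a : AffRoot ι) :
    cFun q k a = constRoot q k a - hConst q k a * (1 - expRoot q a)⁻¹ := by
  have h := constRoot_ne_zero q k a
  have h1 : 1 - expRoot q a ≠ 0 := sub_ne_zero.2 (expRoot_ne_one q a).symm
  rw [cFun, hConst]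
  field_simp
  ring

lemma smul_hConst (w : ExtWeyl P) (a : AffRoot ι) : w • hConst q k a = hConst q k a := by
  rw [hConst, smul_sub, smul_inv'', smul_constRoot]

lemma hConst_act (w : ExtWeyl P) (a : AffRoot ι) : hConst q k (act w a) = hConst q k a := by
  rw [hConst, constRoot_act, hConst]

/-- The operator `T_j` in `ℂ(T) #_q W`. -/
def opT (j : Option b.support) : Smash q :=
  dlOp (simpleRefl b j) (constRoot q k (simpleRoot b j)) (hConst q k (simpleRoot b j))
    (expRoot q (simpleRoot b j))

open SkewMonoidAlgebra

lemma opT_eq (j : Option b.support) :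
    opT q k j = single 1 (hConst q k (simpleRoot b j) * (1 - expRoot q (simpleRoot b j))⁻¹) +
      single (simpleRefl b j) (cFun q k (simpleRoot b j)) := by
  rw [opT, dlOp, cFun_eq]

lemma opT_eq_demazure (j : Option b.support) :
    opT q k j = algebraMap ℂ (Smash q) (k.1 (simpleRoot b j) : ℂ) +
      ofFun q (cFun q k (simpleRoot b j)) * (ofW q (simpleRefl b j) - 1) := by
  rw [opT_eq, mul_sub, mul_one, ofFun, ofW, single_mul_single, one_mul, one_smul, mul_one,
    SkewMonoidAlgebra.coe_algebraMap, Function.comp_apply]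
  change _ = single 1 (constRoot q k (simpleRoot b j)) + _
  have : constRoot q k (simpleRoot b j) = hConst q k (simpleRoot b j) *
      (1 - expRoot q (simpleRoot b j))⁻¹ + cFun q k (simpleRoot b j) := by rw [cFun_eq]; ring
  nth_rewrite 1 [this]
  rw [single_add]
  abel

lemma ofW_mul (v w : ExtWeyl P) : ofW q (v * w) = ofW q v * ofW q w := by
  rw [ofW, ofW, ofW, single_mul_single, one_mul, smul_one]

lemma ofW_mul_opT {w : ExtWeyl P} {i j : Option b.support}
    (h : act w (simpleRoot b j) = simpleRoot b i) : ofW q w * opT q k j = opT q k i * ofW q w := by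
  have h1 := mul_simpleRefl_of_act_eq b h
  rw [opT_eq, opT_eq, mul_add, add_mul, ofW]
  simp only [single_mul_single, one_mul, mul_one, smul_one, smul_mul', smul_hConst, smul_inv'',
    smul_sub, smul_expRoot, smul_cFun, h, h1]
  rw [← h, hConst_act]

lemma opT_quadratic (j : Option b.support) :
    (opT q k j - algebraMap ℂ (Smash q) (k.1 (simpleRoot b j) : ℂ)) *
      (opT q k j + algebraMap ℂ (Smash q) ((k.1 (simpleRoot b j) : ℂ)⁻¹)) = 0 := by
  have h1 : opT q k j - algebraMap ℂ (Smash q) (k.1 (simpleRoot b j) : ℂ) =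
      single (simpleRefl b j) (cFun q k (simpleRoot b j)) - single 1 (cFun q k (simpleRoot b j)) := by
    rw [opT_eq_demazure, add_sub_cancel_left, mul_sub, mul_one, ofFun, ofW, single_mul_single,
      one_mul, one_smul, mul_one]
  have h2 : algebraMap ℂ (Smash q) ((k.1 (simpleRoot b j) : ℂ)⁻¹) =
      single 1 ((constRoot q k (simpleRoot b j))⁻¹) := by
    rw [SkewMonoidAlgebra.coe_algebraMap, Function.comp_apply, map_inv₀]; rfl
  rw [h1, h2, opT_eq]
  simp only [sub_mul, mul_add, single_mul_single, one_mul, mul_one, one_smul, smul_mul',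
    smul_hConst, smul_inv'', smul_sub, smul_one, smul_expRoot, smul_cFun, act_simpleRefl_self,
    simpleRefl_mul_self, expRoot_negAff, smul_constRoot]
  rw [inv_one_sub_inv (expRoot_ne_one q _) (expRoot_ne_zero q _)]
  -- Moving the coefficient past `s_j` replaces the c-function of `a_j` by that of `-a_j`; the
  -- quadratic relation comes down to the sum of the two being `k_j + k_j⁻¹`.
  have h3 : cFun q k (negAff P (simpleRoot b j)) = (constRoot q k (simpleRoot b j))⁻¹ +
      hConst q k (simpleRoot b j) * (1 - expRoot q (simpleRoot b j))⁻¹ := by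
    rw [cFun_eq, expRoot_negAff, inv_one_sub_inv (expRoot_ne_one q _) (expRoot_ne_zero q _),
      ← act_affRefl_self, constRoot_act, hConst_act]
    simp only [hConst]
    ring
  rw [h3]
  set c := cFun q k (simpleRoot b j) with hc
  set κ := constRoot q k (simpleRoot b j) with hκ
  set h := hConst q k (simpleRoot b j) with hh
  set u := (1 - expRoot q (simpleRoot b j))⁻¹ with hu
  have hc' : c = κ - h * u := cFun_eq q k _
  have hh' : h = κ - κ⁻¹ := rfl
  have e2 : single (simpleRefl b j) (c * (h * (1 - u))) + single (simpleRefl b j) (c * κ⁻¹) =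
      single (simpleRefl b j) (c * c) := by
    rw [← single_add]; congr 1; rw [hc', hh']; ring
  have e3 : single (1 : ExtWeyl P) (c * (h * u)) + single 1 (c * κ⁻¹) =
      single 1 (c * (κ⁻¹ + h * u)) := by
    rw [← single_add]; congr 1; ring
  rw [← e3, ← e2]
  abel

end ExpRoot

/-! ### Leading terms and the braid relations -/

section LeadingTerm

open SkewMonoidAlgebra

variable {P : RootPairing ι ℝ M N} [P.IsCrystallographic] {b : P.Base} [Fintype ι] [Nonempty ι]
  [P.IsReduced] [P.IsIrreducible] (q : QParam b) (k : Mult P)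

lemma coeff_mul_opT (X : Smash q) (j : Option b.support) (w : ExtWeyl P) :
    (X * opT q k j).coeff w =
      X.coeff w * w • (hConst q k (simpleRoot b j) * (1 - expRoot q (simpleRoot b j))⁻¹) +
      X.coeff (w * simpleRefl b j) * (w * simpleRefl b j) • cFun q k (simpleRoot b j) := by
  rw [opT_eq, mul_add, coeff_add, Finsupp.add_apply, coeff_mul_single_one, coeff_mul_single,
    simpleRefl_inv]

/-- `f w` is the leading term of `X`. -/
def IsLeadingTerm (X : Smash q) (w : ExtWeyl P) (f : RatFun q) : Prop :=
  X.coeff w = f ∧ ∀ v, length b w ≤ length b v → v ≠ w → X.coeff v = 0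

variable {q}

/-- Right multiplication by `s_j` changes the length by one, so only the leading element can reach
the new top length; its coefficient acquires the c-function of the root which becomes negative. -/
lemma IsLeadingTerm.mul_opT {X : Smash q} {w : ExtWeyl P} {f : RatFun q}
    (h : IsLeadingTerm q X w f) {j : Option b.support}
    (hj : IsPosAff b (act w (simpleRoot b j))) :
    IsLeadingTerm q (X * opT q k j) (w * simpleRefl b j)
      (f * cFun q k (act w (simpleRoot b j))) := by
  have hl := length_mul_simpleRefl b hj
  constructor
  · rw [coeff_mul_opT, mul_assoc, simpleRefl_mul_self, mul_one, h.1, smul_cFun,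
      h.2 (w * simpleRefl b j) (by omega), zero_mul, zero_add]
    intro h0
    rw [h0] at hl
    omega
  · intro v hv hne
    rw [coeff_mul_opT, h.2 v (by omega) (fun h0 => by rw [h0] at hv; omega), zero_mul, zero_add,
      h.2 (v * simpleRefl b j), zero_mul]
    · by_cases h1 : IsPosAff b (act v (simpleRoot b j))
      · rw [length_mul_simpleRefl b h1]; omega
      · have := length_mul_simpleRefl_of_neg b h1
        omega
    · intro h0
      apply hne
      rw [← h0, mul_assoc, simpleRefl_mul_self, mul_one]

lemma isLeadingTerm_ofW (w : ExtWeyl P) : IsLeadingTerm q (ofW q w) w 1 := by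
  classical
  constructor
  · simp [ofW]
  · intro v _ hne
    simp [ofW, hne.symm]

lemma isLeadingTerm_alt {i j : Option b.support} {m : ℕ}
    (hm : IsCoxeterOrder (cartan b j i) (cartan b i j) m) {n : ℕ} (hn : n ≤ m) :
    IsLeadingTerm q (alt (opT q k i) (opT q k j) n) (alt (simpleRefl b i) (simpleRefl b j) n)
      (∏ r ∈ Finset.range n, cFun q k (altRoot b i j r)) := by
  induction n with
  | zero => exact isLeadingTerm_ofW 1
  | succ n ih =>
    rw [alt_succ' (opT q k) i j, alt_succ' (simpleRefl b) i j, Finset.prod_range_succ]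
    refine (ih (by omega)).mul_opT k ?_
    exact (hasCoord_altRoot b i j n).isPosAff b (hm.altCoord_nonneg hn) (isPosAff_simpleRoot b i)
      (isPosAff_simpleRoot b j)

lemma coeff_alt_eq_zero (i j : Option b.support) (n : ℕ) {w : ExtWeyl P}
    (hw : w ∉ Subgroup.closure {simpleRefl b i, simpleRefl b j}) :
    (alt (opT q k i) (opT q k j) n).coeff w = 0 := by
  classical
  induction n generalizing w with
  | zero =>
    have : w ≠ 1 := fun h => hw (h ▸ one_mem _)
    simp [alt, this.symm]
  | succ n ih =>
    rw [alt_succ' (opT q k) i j, coeff_mul_opT, ih hw, zero_mul, zero_add, ih, zero_mul]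
    intro h
    apply hw
    have h1 : simpleRefl b (altNext i j n) ∈
        Subgroup.closure {simpleRefl b i, simpleRefl b j} := by
      rcases altNext_eq_or i j n with h | h <;> rw [h] <;> exact Subgroup.subset_closure (by simp)
    rw [← mul_one w, ← simpleRefl_mul_self b (altNext i j n), ← mul_assoc]
    exact mul_mem h h1

/-- When the order is three, `s_i a_j = s_j a_i`. Hence the two roots are conjugate and carry the
same parameter. -/
lemma exists_act_eq_of_cartan {i j : Option b.support} (h1 : cartan b j i = -1)
    (h2 : cartan b i j = -1) : ∃ w : ExtWeyl P, act w (simpleRoot b i) = simpleRoot b j := by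
  refine ⟨(simpleRefl b i)⁻¹ * simpleRefl b j, ?_⟩
  have h4 := altRoot_reverse (b := b) (i := j) (j := i) (m := 3) (n := 1)
    (by simp [IsCoxeterOrder, h1, h2]) (by norm_num)
  rw [altRoot_succ, altRoot_zero, altRoot_succ, altRoot_zero] at h4
  rw [act_mul, h4, act_inv_act]

/-- The braid relations for the operators `T_j`. -/
lemma alt_opT_comm {i j : Option b.support} {m : ℕ}
    (hm : IsCoxeterOrder (cartan b j i) (cartan b i j) m) :
    alt (opT q k i) (opT q k j) m = alt (opT q k j) (opT q k i) m := by
  have main (i j : Option b.support) (hm : IsCoxeterOrder (cartan b j i) (cartan b i j) m) :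
      alt (opT q k i) (opT q k j) m * (1 + single (simpleRefl b i) 1) =
      alt (opT q k j) (opT q k i) m * (1 + single (simpleRefl b i) 1) := by
    have hp : ∃ p : ℕ, cartan b i j = -p :=
      ⟨(-cartan b i j).toNat, by unfold IsCoxeterOrder at hm; omega⟩
    have hr : ∃ r : ℕ, cartan b j i = -r :=
      ⟨(-cartan b j i).toNat, by unfold IsCoxeterOrder at hm; omega⟩
    obtain ⟨p, hp⟩ := hp
    obtain ⟨r, hr⟩ := hr
    have hA : m = 3 → constRoot q k (simpleRoot b i) = constRoot q k (simpleRoot b j) ∧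
        hConst q k (simpleRoot b i) = hConst q k (simpleRoot b j) := by
      intro h3
      obtain ⟨w, hw⟩ := exists_act_eq_of_cartan (b := b) (i := i) (j := j)
        (by unfold IsCoxeterOrder at hm; omega) (by unfold IsCoxeterOrder at hm; omega)
      rw [← hw, constRoot_act, hConst_act]
      exact ⟨rfl, rfl⟩
    refine alt_dlOp_mul_one_add (p := p) (r := r) (by rw [← hr, ← hp]; exact hm)
      (simpleRefl_mul_self b i) (simpleRefl_mul_self b j) (alt_simpleRefl_comm hm)
      (expRoot_ne_one q _) (expRoot_ne_one q _) (expRoot_ne_zero q _) (expRoot_ne_zero q _)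
      (by rw [smul_expRoot, act_simpleRefl_self, expRoot_negAff])
      (by rw [smul_expRoot]; exact expRoot_affRefl q _ _ hp)
      (by rw [smul_expRoot, act_simpleRefl_self, expRoot_negAff])
      (by rw [smul_expRoot]; exact expRoot_affRefl q _ _ hr)
      (smul_constRoot q k _ _) (smul_constRoot q k _ _) (smul_hConst q k _ _) (smul_hConst q k _ _)
      (smul_constRoot q k _ _) (smul_constRoot q k _ _) (smul_hConst q k _ _) (smul_hConst q k _ _)
      hA
  rw [← sub_eq_zero]
  set D := alt (opT q k i) (opT q k j) m - alt (opT q k j) (opT q k i) m with hD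
  have hDi : D * (1 + single (simpleRefl b i) 1) = 0 := by rw [hD, sub_mul, main i j hm, sub_self]
  have hDj : D * (1 + single (simpleRefl b j) 1) = 0 := by
    rw [hD, sub_mul, main j i hm.symm, sub_self]
  -- Vanishing of `D (1 + s_l)` ties the coefficient at `w s_l` to that at `w`, so zeros propagate
  -- along right multiplication.
  have hstep (l : Option b.support) (h : D * (1 + single (simpleRefl b l) 1) = 0)
      (w : ExtWeyl P) (hw : D.coeff w = 0) : D.coeff (w * simpleRefl b l) = 0 := by
    have := congrArg (fun X : Smash q => X.coeff (w * simpleRefl b l)) h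
    simpa [mul_add, coeff_mul_single, mul_assoc, simpleRefl_mul_self, hw] using this
  set w₀ := alt (simpleRefl b i) (simpleRefl b j) m with hw₀
  -- Both words have as top coefficient a product of c-functions over the same roots, listed in
  -- opposite orders.
  have htop : D.coeff w₀ = 0 := by
    have h1 := (isLeadingTerm_alt (q := q) k hm le_rfl).1
    have h2 := (isLeadingTerm_alt (q := q) k hm.symm le_rfl).1
    rw [← alt_simpleRefl_comm hm] at h2
    rw [hD, coeff_sub, Finsupp.sub_apply, h1, h2, sub_eq_zero, ← Finset.prod_range_reflect]
    refine Finset.prod_congr rfl fun r hr => ?_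
    rw [altRoot_reverse hm (by rw [Finset.mem_range] at hr; omega)]
    congr 2
    rw [Finset.mem_range] at hr
    omega
  have hmem : w₀ ∈ Subgroup.closure {simpleRefl b i, simpleRefl b j} := by
    by_contra h
    have h1 := (isLeadingTerm_alt (q := q) k hm le_rfl).1
    rw [coeff_alt_eq_zero k i j m h] at h1
    exact Finset.prod_ne_zero_iff.2 (fun r _ => cFun_ne_zero q k _) h1.symm
  have hall (g : ExtWeyl P) (hg : g ∈ Subgroup.closure {simpleRefl b i, simpleRefl b j}) :
      D.coeff (w₀ * g) = 0 := by
    induction hg using Subgroup.closure_induction_right with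
    | one => rw [mul_one]; exact htop
    | mul_right x hx y hy ih =>
      rw [← mul_assoc]
      rcases hy with rfl | rfl
      · exact hstep i hDi _ ih
      · exact hstep j hDj _ ih
    | mul_inv_cancel x hx y hy ih =>
      rw [← mul_assoc]
      rcases hy with rfl | rfl
      · rw [simpleRefl_inv]; exact hstep i hDi _ ih
      · rw [simpleRefl_inv]; exact hstep j hDj _ ih
  apply SkewMonoidAlgebra.ext
  intro w
  rw [coeff_zero, Finsupp.zero_apply]
  by_cases hw : w ∈ Subgroup.closure {simpleRefl b i, simpleRefl b j}
  · have := hall (w₀⁻¹ * w) (mul_mem (inv_mem hmem) hw)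
    rwa [mul_inv_cancel_left] at this
  · rw [hD, coeff_sub, Finsupp.sub_apply, coeff_alt_eq_zero k i j m hw,
      coeff_alt_eq_zero k j i m (by rwa [Set.pair_comm]), sub_zero]

end LeadingTerm

/-! ### The Hecke algebra: universal property and invertibility of `T_w` -/

section HeckeBasic

variable {P : RootPairing ι ℝ M N} [P.IsCrystallographic] (b : P.Base) [Fintype ι] [Nonempty ι]
  (k : Mult P)

lemma heckeT_one : heckeT b k 1 = 1 :=
  (RingQuot.mkAlgHom_rel ℂ HeckeRel.one).trans (map_one (RingQuot.mkAlgHom ℂ (HeckeRel b k)))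

lemma heckeT_mul {v w : ExtWeyl P} (h : length b (v * w) = length b v + length b w) :
    heckeT b k (v * w) = heckeT b k v * heckeT b k w := by
  rw [heckeT, heckeT, heckeT]
  exact ((map_mul (RingQuot.mkAlgHom ℂ (HeckeRel b k)) _ _).symm.trans
    (RingQuot.mkAlgHom_rel ℂ (HeckeRel.mul v w h))).symm

lemma heckeT_quadratic (j : Option b.support) :
    (heckeT b k (simpleRefl b j) - algebraMap ℂ _ (k.1 (simpleRoot b j) : ℂ)) *
      (heckeT b k (simpleRefl b j) + algebraMap ℂ _ ((k.1 (simpleRoot b j) : ℂ)⁻¹)) = 0 := by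
  have := RingQuot.mkAlgHom_rel ℂ (HeckeRel.quad (b := b) (k := k) j)
  rw [map_zero, map_mul, map_sub, map_add, AlgHom.commutes, AlgHom.commutes] at this
  exact this

/-- Extension of a map on the generators `T_w` to the Hecke algebra. -/
def heckeLift {A : Type*} [Ring A] [Algebra ℂ A] (F : ExtWeyl P → A) (h1 : F 1 = 1)
    (hm : ∀ v w, length b (v * w) = length b v + length b w → F (v * w) = F v * F w)
    (hq : ∀ j, (F (simpleRefl b j) - algebraMap ℂ A (k.1 (simpleRoot b j) : ℂ)) *
      (F (simpleRefl b j) + algebraMap ℂ A ((k.1 (simpleRoot b j) : ℂ)⁻¹)) = 0) :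
    Hecke b k →ₐ[ℂ] A :=
  RingQuot.liftAlgHom ℂ ⟨FreeAlgebra.lift ℂ F, by
    intro x y h
    induction h with
    | one => simp [h1]
    | mul v w h => simp [hm v w h]
    | quad j => simpa using hq j⟩

lemma heckeLift_heckeT {A : Type*} [Ring A] [Algebra ℂ A] (F : ExtWeyl P → A) (h1 : F 1 = 1)
    (hm : ∀ v w, length b (v * w) = length b v + length b w → F (v * w) = F v * F w)
    (hq : ∀ j, (F (simpleRefl b j) - algebraMap ℂ A (k.1 (simpleRoot b j) : ℂ)) *
      (F (simpleRefl b j) + algebraMap ℂ A ((k.1 (simpleRoot b j) : ℂ)⁻¹)) = 0)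
    (w : ExtWeyl P) : heckeLift b k F h1 hm hq (heckeT b k w) = F w := by
  rw [heckeLift, heckeT]
  erw [RingQuot.liftAlgHom_mkAlgHom_apply]
  simp

variable {b k}

lemma hecke_algHom_ext {A : Type*} [Ring A] [Algebra ℂ A] {f g : Hecke b k →ₐ[ℂ] A}
    (h : ∀ w, f (heckeT b k w) = g (heckeT b k w)) : f = g := by
  refine RingQuot.ringQuot_ext' ℂ f g ?_
  apply FreeAlgebra.hom_ext
  funext w
  exact h w

variable (b k)

lemma adjoin_heckeT : Algebra.adjoin ℂ (Set.range (heckeT b k)) = ⊤ := by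
  rw [eq_top_iff]
  rintro x -
  obtain ⟨y, rfl⟩ := RingQuot.mkAlgHom_surjective ℂ (HeckeRel b k) x
  induction y using FreeAlgebra.induction with
  | grade0 r => rw [AlgHom.commutes]; exact Subalgebra.algebraMap_mem _ _
  | grade1 w => exact Algebra.subset_adjoin ⟨w, rfl⟩
  | mul x y hx hy => rw [map_mul]; exact mul_mem hx hy
  | add x y hx hy => rw [map_add]; exact add_mem hx hy

/-- The scalar `k_j - k_j⁻¹`. -/
def hParam (a : AffRoot ι) : ℂ := (k.1 a : ℂ) - (k.1 a : ℂ)⁻¹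

lemma heckeT_sq (j : Option b.support) :
    heckeT b k (simpleRefl b j) * heckeT b k (simpleRefl b j) =
      hParam k (simpleRoot b j) • heckeT b k (simpleRefl b j) + 1 := by
  have h := heckeT_quadratic b k j
  have h0 : (k.1 (simpleRoot b j) : ℂ) ≠ 0 := Units.ne_zero _
  rw [sub_mul, mul_add, mul_add, ← map_mul, mul_inv_cancel₀ h0, map_one, ← Algebra.commutes,
    ← Algebra.smul_def, ← Algebra.smul_def] at h
  rw [hParam, sub_smul]
  have := sub_eq_zero.1 h
  rw [← eq_sub_iff_add_eq] at this
  rw [this]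
  abel

lemma heckeT_simple_mul_sub (j : Option b.support) :
    heckeT b k (simpleRefl b j) *
      (heckeT b k (simpleRefl b j) - algebraMap ℂ _ (hParam k (simpleRoot b j))) = 1 := by
  rw [mul_sub, heckeT_sq, ← Algebra.commutes, ← Algebra.smul_def, add_sub_cancel_left]

lemma heckeT_simple_sub_mul (j : Option b.support) :
    (heckeT b k (simpleRefl b j) - algebraMap ℂ _ (hParam k (simpleRoot b j))) *
      heckeT b k (simpleRefl b j) = 1 := by
  rw [sub_mul, heckeT_sq, ← Algebra.smul_def, add_sub_cancel_left]

lemma isUnit_heckeT_simple (j : Option b.support) : IsUnit (heckeT b k (simpleRefl b j)) :=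
  ⟨⟨_, _, heckeT_simple_mul_sub b k j, heckeT_simple_sub_mul b k j⟩, rfl⟩

variable [P.IsReduced] [P.IsIrreducible]

lemma heckeT_simple_mul {j : Option b.support} {w : ExtWeyl P}
    (h : IsPosAff b (act w⁻¹ (simpleRoot b j))) :
    heckeT b k (simpleRefl b j * w) = heckeT b k (simpleRefl b j) * heckeT b k w := by
  rw [heckeT_mul]
  rw [length_simpleRefl_mul b h, length_simpleRefl, add_comm]

lemma heckeT_mul_simple {j : Option b.support} {w : ExtWeyl P}
    (h : IsPosAff b (act w (simpleRoot b j))) :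
    heckeT b k (w * simpleRefl b j) = heckeT b k w * heckeT b k (simpleRefl b j) := by
  rw [heckeT_mul]
  rw [length_mul_simpleRefl b h, length_simpleRefl]

lemma isUnit_heckeT (w : ExtWeyl P) : IsUnit (heckeT b k w) := by
  induction w using extWeyl_induction b with
  | h0 w hw =>
    refine ⟨⟨heckeT b k w, heckeT b k w⁻¹, ?_, ?_⟩, rfl⟩ <;> rw [← heckeT_mul, ← heckeT_one]
    · simp
    · rw [mul_inv_cancel, length_one, length_inv, hw]
    · simp
    · rw [inv_mul_cancel, length_one, length_inv, hw]
  | h1 j w hj ih =>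
    rw [heckeT_simple_mul b k hj]
    exact (isUnit_heckeT_simple b k j).mul ih

end HeckeBasic

/-! ### The basic representation and linear independence of the `T_w` -/

section CherednikHom

open SkewMonoidAlgebra

variable {P : RootPairing ι ℝ M N} [P.IsCrystallographic] {b : P.Base} [Fintype ι] [Nonempty ι]
  [P.IsReduced] [P.IsIrreducible] (q : QParam b) (k : Mult P)

lemma exists_opW : ∃ F : ExtWeyl P → Smash q, (∀ w, length b w = 0 → F w = ofW q w) ∧
    (∀ j w, IsPosAff b (act w⁻¹ (simpleRoot b j)) → F (simpleRefl b j * w) = opT q k j * F w) ∧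
    ∀ v w, length b (v * w) = length b v + length b w → F (v * w) = F v * F w := by
  obtain ⟨F, h0, h1⟩ := exists_lift_of_braid (opT q k) (ofW q)
    fun i j m _ hm => alt_opT_comm (q := q) k hm
  refine ⟨F, h0, h1, fun v w h => ?_⟩
  exact map_mul_of_length_add h0 h1 (fun v w _ _ => ofW_mul q v w)
    (fun w i j _ h => ofW_mul_opT q k h) h

/-- The operators `T_w` in `ℂ(T) #_q W`. -/
def opW : ExtWeyl P → Smash q := (exists_opW q k).choose

lemma opW_of_length_eq_zero {w : ExtWeyl P} (hw : length b w = 0) : opW q k w = ofW q w :=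
  (exists_opW q k).choose_spec.1 w hw

lemma opW_mul {v w : ExtWeyl P} (h : length b (v * w) = length b v + length b w) :
    opW q k (v * w) = opW q k v * opW q k w := (exists_opW q k).choose_spec.2.2 v w h

lemma opW_one : opW q k 1 = 1 := opW_of_length_eq_zero q k (length_one b)

lemma opW_simpleRefl_mul {j : Option b.support} {w : ExtWeyl P}
    (h : IsPosAff b (act w⁻¹ (simpleRoot b j))) :
    opW q k (simpleRefl b j * w) = opT q k j * opW q k w := (exists_opW q k).choose_spec.2.1 j w h

lemma opW_simpleRefl (j : Option b.support) : opW q k (simpleRefl b j) = opT q k j := by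
  have := opW_simpleRefl_mul q k (j := j) (w := 1) (by
    rw [inv_one, act_one]; exact isPosAff_simpleRoot b j)
  rwa [mul_one, opW_one, mul_one] at this

/-- The algebra map `H(k) → ℂ(T) #_q W`. -/
def toSmash : Hecke b k →ₐ[ℂ] Smash q :=
  heckeLift b k (opW q k) (opW_one q k) (fun _ _ h => opW_mul q k h) fun j => by
    rw [opW_simpleRefl]; exact opT_quadratic q k j

lemma toSmash_heckeT (w : ExtWeyl P) : toSmash q k (heckeT b k w) = opW q k w :=
  heckeLift_heckeT b k _ _ _ _ w

lemma exists_isLeadingTerm_opW (w : ExtWeyl P) :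
    ∃ f, f ≠ 0 ∧ IsLeadingTerm q (opW q k w) w f := by
  obtain ⟨v, rfl⟩ : ∃ v : ExtWeyl P, v⁻¹ = w := ⟨w⁻¹, inv_inv w⟩
  induction v using extWeyl_induction b with
  | h0 v hv =>
    rw [opW_of_length_eq_zero q k (by rw [length_inv, hv])]
    exact ⟨1, one_ne_zero, isLeadingTerm_ofW _⟩
  | h1 j v hj ih =>
    obtain ⟨f, hf, hl⟩ := ih
    rw [mul_inv_rev, simpleRefl_inv, opW_mul, opW_simpleRefl]
    · exact ⟨_, mul_ne_zero hf (cFun_ne_zero q k _), hl.mul_opT k hj⟩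
    · rw [length_mul_simpleRefl b hj, length_simpleRefl]

/-- Among the terms of a relation take an element of maximal length: in the basic representation no
other term contributes to its coefficient, which is nonzero. -/
lemma linearIndependent_heckeT (q : QParam b) (k : Mult P) : LinearIndependent ℂ (heckeT b k) := by
  classical
  rw [linearIndependent_iff']
  intro s c hc
  by_contra! hcon
  have hne : (s.filter fun x => c x ≠ 0).Nonempty := by
    obtain ⟨x, hx, hx0⟩ := hcon
    exact ⟨x, Finset.mem_filter.2 ⟨hx, hx0⟩⟩
  obtain ⟨x, hx, hmax⟩ := Finset.exists_max_image _ (length b) hne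
  rw [Finset.mem_filter] at hx
  obtain ⟨f, hf, hl⟩ := exists_isLeadingTerm_opW q k x
  have h1 := congrArg (fun X : Smash q => X.coeff x) (congrArg (toSmash q k) hc)
  simp only [_root_.map_sum, map_smul, toSmash_heckeT, map_zero, coeff_zero, Finsupp.zero_apply] at h1
  have h2 : (∑ y ∈ s, c y • opW q k y).coeff x = ∑ y ∈ s, c y • (opW q k y).coeff x := by
    clear h1 hmax hne hcon hc hx
    induction s using Finset.induction_on with
    | empty => simp
    | insert y t hy ih => simp [Finset.sum_insert hy, coeff_add, coeff_smul, ih]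
  rw [h2, Finset.sum_eq_single x, hl.1] at h1
  · rcases smul_eq_zero.1 h1 with h3 | h3
    · exact hx.2 h3
    · exact hf h3
  · intro y hy hyx
    by_cases hcy : c y = 0
    · rw [hcy, zero_smul]
    · obtain ⟨g, -, hg⟩ := exists_isLeadingTerm_opW q k y
      rw [hg.2 x (hmax y (Finset.mem_filter.2 ⟨hy, hcy⟩)) hyx.symm, smul_zero]
  · intro h
    exact absurd hx.1 h

lemma ofFun_mem_diffAlg {f : RatFun q} (hf : f ∈ coeffAlg q k) : ofFun q f ∈ diffAlg q k :=
  Algebra.subset_adjoin (Or.inl ⟨f, hf, rfl⟩)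

lemma ofW_mem_diffAlg (w : ExtWeyl P) : ofW q w ∈ diffAlg q k :=
  Algebra.subset_adjoin (Or.inr ⟨w, rfl⟩)

lemma cFun_inv_mem (a : AffRoot ι) : cFun q k⁻¹ a ∈ coeffAlg q k := by
  rw [cFun, div_eq_mul_inv]
  refine mul_mem (sub_mem ?_ (mul_mem ?_ ?_)) ?_
  · have : (constRoot q k⁻¹ a)⁻¹ = algebraMap ℂ (RatFun q) ((((k⁻¹ : Mult P).1 a : ℂ))⁻¹) := by
      rw [constRoot, map_inv₀]
    rw [this]
    exact Subalgebra.algebraMap_mem _ _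
  · exact Subalgebra.algebraMap_mem _ _
  · exact Algebra.subset_adjoin (Or.inl (Or.inl ⟨_, rfl⟩))
  · exact Algebra.subset_adjoin (Or.inl (Or.inr ⟨a, rfl⟩))

lemma opW_mem_diffAlg (w : ExtWeyl P) : opW q k⁻¹ w ∈ diffAlg q k := by
  induction w using extWeyl_induction b with
  | h0 w hw => rw [opW_of_length_eq_zero q _ hw]; exact ofW_mem_diffAlg q k w
  | h1 j w hj ih =>
    rw [opW_simpleRefl_mul q _ hj, opT_eq_demazure]
    exact mul_mem (add_mem (Subalgebra.algebraMap_mem _ _) (mul_mem (ofFun_mem_diffAlg q k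
      (cFun_inv_mem q k _)) (sub_mem (ofW_mem_diffAlg q k _) (one_mem _)))) ih

lemma toSmash_mem_diffAlg (h : Hecke b k⁻¹) : toSmash q k⁻¹ h ∈ diffAlg q k := by
  have : h ∈ Algebra.adjoin ℂ (Set.range (heckeT b k⁻¹)) := by rw [adjoin_heckeT]; trivial
  induction this using Algebra.adjoin_induction with
  | mem x hx =>
    obtain ⟨w, rfl⟩ := hx
    rw [toSmash_heckeT]
    exact opW_mem_diffAlg q k w
  | algebraMap r => rw [AlgHom.commutes]; exact Subalgebra.algebraMap_mem _ _
  | add x y _ _ hx hy => rw [map_add]; exact add_mem hx hy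
  | mul x y _ _ hx hy => rw [map_mul]; exact mul_mem hx hy

/-- The basic representation of `H(k⁻¹)` by `q`-difference reflection operators. -/
theorem existsUnique_cherednikHom :
    ∃! π : Hecke b k⁻¹ →ₐ[ℂ] diffAlg q k, IsCherednikHom q k k⁻¹ π := by
  refine ⟨(toSmash q k⁻¹).codRestrict (diffAlg q k) (toSmash_mem_diffAlg q k), ⟨fun j => ?_,
    fun ω hω => ?_⟩, fun π hπ => ?_⟩
  · rw [AlgHom.coe_codRestrict, toSmash_heckeT, opW_simpleRefl, opT_eq_demazure]
  · rw [AlgHom.coe_codRestrict, toSmash_heckeT, opW_of_length_eq_zero q _ hω]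
  · apply hecke_algHom_ext
    intro w
    apply Subtype.ext
    rw [AlgHom.coe_codRestrict, toSmash_heckeT]
    induction w using extWeyl_induction b with
    | h0 w hw => rw [opW_of_length_eq_zero q _ hw, hπ.2 w hw]
    | h1 j w hj ih =>
      rw [heckeT_simple_mul b _ hj, map_mul, Subalgebra.coe_mul, ih, hπ.1 j,
        opW_simpleRefl_mul q _ hj, opT_eq_demazure]

end CherednikHom

/-! ### The finite Weyl group acting on regular functions and on the torus -/

section RegAction

variable {P : RootPairing ι ℝ M N}

/-- The action of `w ∈ W_0` on `ℂ[T]`: `w e^x = e^{wx}`. -/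
def regW (w : P.weylGroup) : Reg P →ₐ[ℂ] Reg P :=
  AddMonoidAlgebra.mapDomainAlgHom ℂ ℂ (DistribSMul.toAddMonoidHom (Cowt P) w)

/-- The regular function `e^x`. -/
def rexp (x : Cowt P) : Reg P := AddMonoidAlgebra.single x 1

@[simp] lemma regW_rexp (w : P.weylGroup) (x : Cowt P) : regW w (rexp x) = rexp (w • x) := by
  simp [regW, rexp, AddMonoidAlgebra.mapDomain_single]

lemma rexp_add (x y : Cowt P) : rexp (x + y) = rexp x * rexp y := by
  simp [rexp, AddMonoidAlgebra.single_mul_single]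

lemma rexp_zero : rexp (0 : Cowt P) = 1 := rfl

@[simp] lemma evalAt_rexp (t : Torus P) (x : Cowt P) : evalAt t (rexp x) = tpow t x := by
  simp [evalAt, rexp, tpow]

lemma reg_algHom_ext {A : Type*} [Semiring A] [Algebra ℂ A] {f g : Reg P →ₐ[ℂ] A}
    (h : ∀ x, f (rexp x) = g (rexp x)) : f = g :=
  AddMonoidAlgebra.algHom_ext h (Subsingleton.elim _ _)

lemma reg_induction {p : Reg P → Prop} (f : Reg P) (hx : ∀ x, p (rexp x))
    (ha : ∀ f g, p f → p g → p (f + g)) (hs : ∀ (c : ℂ) f, p f → p (c • f)) : p f :=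
  AddMonoidAlgebra.induction_on f hx ha hs

lemma isInv_iff (f : Reg P) : IsInv f ↔ ∀ w, regW w f = f := Iff.rfl

lemma regW_one (f : Reg P) : regW 1 f = f := by
  have : regW (1 : P.weylGroup) = AlgHom.id ℂ _ := reg_algHom_ext fun x => by simp
  rw [this]; rfl

lemma regW_mul (u v : P.weylGroup) (f : Reg P) : regW (u * v) f = regW u (regW v f) := by
  have : regW (u * v) = (regW u).comp (regW v) := reg_algHom_ext fun x => by simp [mul_smul]
  rw [this]; rfl

lemma tpow_torusAct (w : P.weylGroup) (t : Torus P) (x : Cowt P) :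
    tpow (torusAct w t) x = tpow t (w⁻¹ • x) := rfl

lemma evalAt_torusAct (w : P.weylGroup) (t : Torus P) (f : Reg P) :
    evalAt (torusAct w t) f = evalAt t (regW w⁻¹ f) := by
  have : evalAt (torusAct w t) = (evalAt t).comp (regW w⁻¹) :=
    reg_algHom_ext fun x => by simp [tpow_torusAct]
  rw [this]; rfl

lemma tpow_ext {s t : Torus P} (h : ∀ x, tpow s x = tpow t x) : s = t :=
  MonoidHom.ext fun x => Units.ext (h x.toAdd)

lemma torusAct_mul (u v : P.weylGroup) (t : Torus P) :
    torusAct (u * v) t = torusAct u (torusAct v t) :=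
  tpow_ext fun x => by simp [tpow_torusAct, mul_smul]

lemma torusAct_one (t : Torus P) : torusAct 1 t = t :=
  tpow_ext fun x => by simp [tpow_torusAct]

lemma tpow_add (t : Torus P) (x y : Cowt P) : tpow t (x + y) = tpow t x * tpow t y := by
  simp [tpow, ofAdd_add]

@[simp] lemma tpow_zero (t : Torus P) : tpow t 0 = 1 := by simp [tpow]

lemma tpow_ne_zero (t : Torus P) (x : Cowt P) : tpow t x ≠ 0 := Units.ne_zero _

@[simp] lemma tpow_neg (t : Torus P) (x : Cowt P) : tpow t (-x) = (tpow t x)⁻¹ := by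
  simp [tpow, ofAdd_neg]

end RegAction

/-! ### The elements `Y^x` and the Bernstein relation -/

section Bernstein

variable {P : RootPairing ι ℝ M N} [P.IsCrystallographic] (b : P.Base) [Fintype ι] [Nonempty ι]
  [P.IsReduced] [P.IsIrreducible] (k : Mult P)

variable {b} in
-- A dominant translation lowers levels only over positive finite roots. This bound on its
-- inversions yields the length additivities for products with dominant translations.
lemma neg_of_act_tau_neg {y : Cowt P} (hy : IsDominant b y) {a : AffRoot ι} (ha : IsPosAff b a)
    (h : ¬ IsPosAff b (act (tau y) a)) : b.IsPos a.1 ∧ a.2 < pair y a.1 := by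
  rw [act_tau] at h
  simp only [IsPosAff, not_or, not_and] at h ha
  have hneg : ¬ b.IsPos a.1 → pair y a.1 ≤ 0 := fun hn => by
    have := hy _ ((isPos_negIndex b a.1).2 hn)
    rw [pair_negIndex] at this
    omega
  by_cases hp : b.IsPos a.1
  · exact ⟨hp, by simp only [hp, not_true_eq_false, imp_false] at h; omega⟩
  · have := hneg hp
    simp only [hp, and_false, or_false] at ha
    omega

lemma heckeT_fin_mul_tau (w : P.weylGroup) {y : Cowt P} (hy : IsDominant b y) :
    heckeT b k (fin w * tau y) = heckeT b k (fin w) * heckeT b k (tau y) := by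
  refine heckeT_mul b k (length_mul_of_forall b fun a ha h => ?_)
  obtain ⟨h1, h2⟩ := neg_of_act_tau_neg hy ha h
  rw [act_mul, act_fin, act_tau]
  simp only [IsPosAff]
  omega

lemma heckeT_tau_add {x y : Cowt P} (hx : IsDominant b x) (hy : IsDominant b y) :
    heckeT b k (tau (x + y)) = heckeT b k (tau x) * heckeT b k (tau y) := by
  rw [tau_add]
  refine heckeT_mul b k (length_mul_of_forall b fun a ha h => ?_)
  obtain ⟨h1, h2⟩ := neg_of_act_tau_neg hy ha h
  have := hx _ h1
  rw [act_mul, act_tau, act_tau]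
  simp only [IsPosAff]
  omega

lemma IsDominant.add {x y : Cowt P} (hx : IsDominant b x) (hy : IsDominant b y) :
    IsDominant b (x + y) := fun i hi => by
  rw [pair_add]; exact add_nonneg (hx i hi) (hy i hi)

/-- This is the independence of `Y^x` from the chosen decomposition; it holds because the `T` of
dominant translations multiply, hence commute. -/
lemma heckeY_mul_heckeT {x y z : Cowt P} (hy : IsDominant b y) (hz : IsDominant b z)
    (h : x + z = y) : heckeY b k x * heckeT b k (tau z) = heckeT b k (tau y) := by
  obtain ⟨hy', hz', hx⟩ := (exists_dominant b x).choose_spec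
  rw [heckeY]
  set y' := (exists_dominant b x).choose.1
  set z' := (exists_dominant b x).choose.2
  have hu := isUnit_heckeT b k (tau z')
  have hc : heckeT b k (tau z') * heckeT b k (tau z) =
      heckeT b k (tau z) * heckeT b k (tau z') := by
    rw [← heckeT_tau_add b k hz' hz, ← heckeT_tau_add b k hz hz', add_comm]
  apply hu.mul_right_cancel
  rw [mul_assoc, ← hc, mul_assoc, Ring.inverse_mul_cancel_left _ _ hu,
    ← heckeT_tau_add b k hy' hz, ← heckeT_tau_add b k hy hz', ← h, hx]
  congr 2
  abel

lemma isDominant_zero : IsDominant b (0 : Cowt P) := fun i _ => by simp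

lemma heckeY_of_dominant {x : Cowt P} (hx : IsDominant b x) :
    heckeY b k x = heckeT b k (tau x) := by
  have := heckeY_mul_heckeT b k hx (isDominant_zero b) (add_zero x)
  rwa [tau_zero, heckeT_one, mul_one] at this

lemma heckeY_add (x y : Cowt P) : heckeY b k (x + y) = heckeY b k x * heckeY b k y := by
  obtain ⟨⟨x1, x2⟩, hx1, hx2, rfl⟩ := exists_dominant b x
  obtain ⟨⟨y1, y2⟩, hy1, hy2, rfl⟩ := exists_dominant b y
  simp only at *
  apply (isUnit_heckeT b k (tau (x2 + y2))).mul_right_cancel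
  rw [heckeY_mul_heckeT b k (hx1.add b hy1) (hx2.add b hy2) (by abel), add_comm x2 y2,
    heckeT_tau_add b k hy2 hx2, mul_assoc, ← mul_assoc (heckeY b k (y1 - y2)),
    heckeY_mul_heckeT b k hy1 hy2 (by abel), ← heckeT_tau_add b k hy1 hx2, add_comm y1 x2,
    heckeT_tau_add b k hx2 hy1, ← mul_assoc, heckeY_mul_heckeT b k hx1 hx2 (by abel),
    heckeT_tau_add b k hx1 hy1]

lemma heckeY_zero : heckeY b k 0 = 1 := by
  rw [heckeY_of_dominant b k (isDominant_zero b), tau_zero, heckeT_one]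

/-- The algebra map `f ↦ f(Y)`. -/
def fYHom : Reg P →ₐ[ℂ] Hecke b k :=
  AddMonoidAlgebra.lift ℂ (Hecke b k) (Cowt P)
    { toFun := fun x => heckeY b k x.toAdd
      map_one' := heckeY_zero b k
      map_mul' := fun x y => heckeY_add b k x.toAdd y.toAdd }

lemma fY_eq (f : Reg P) : fY b k f = fYHom b k f := by
  rw [fYHom, AddMonoidAlgebra.lift_apply]
  rfl

@[simp] lemma fYHom_rexp (x : Cowt P) : fYHom b k (rexp x) = heckeY b k x := by
  rw [fYHom, rexp, AddMonoidAlgebra.lift_single, one_smul]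
  rfl

lemma simpleRefl₀_smul_cowt (i : b.support) (x : Cowt P) :
    simpleRefl₀ b i • x = x - pair x i • corootCowt (i : ι) := ofIdx_smul_cowt _ _

lemma heckeT_simple_mul_heckeY_of_dominant {i : b.support} {x : Cowt P} (hx : IsDominant b x)
    (h : pair x i = 0) : heckeT b k (simpleRefl b (some i)) * heckeT b k (tau x) =
      heckeT b k (tau x) * heckeT b k (simpleRefl b (some i)) := by
  rw [← heckeT_mul_simple, ← fin_simpleRefl₀, ← heckeT_fin_mul_tau b k _ hx, fin_mul_tau,
    simpleRefl₀_smul_cowt, h, zero_smul, sub_zero]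
  rw [act_tau]
  simp only [simpleRoot, h, sub_zero]
  exact isPosAff_simpleRoot b (some i)

lemma heckeT_simple_commute_heckeY {i : b.support} {x : Cowt P} (h : pair x i = 0) :
    heckeT b k (simpleRefl b (some i)) * heckeY b k x =
      heckeY b k x * heckeT b k (simpleRefl b (some i)) := by
  -- This choice keeps `⟨z, α_i⟩ = 0`, so `x` becomes a difference of dominant coweights that are
  -- both orthogonal to `α_i`.
  obtain ⟨z, hz⟩ := exists_cowt b fun j => max 0 (-pair x j)
  have hz1 : IsDominant b z := isDominant_of_simple b _ fun j hj => by
    rw [hz ⟨j, hj⟩]; exact le_max_left _ _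
  have hy1 : IsDominant b (x + z) := isDominant_of_simple b _ fun j hj => by
    have := hz ⟨j, hj⟩
    simp only [pair_add] at *
    omega
  have hz2 : pair z i = 0 := by rw [hz]; simp [h]
  apply (isUnit_heckeT b k (tau z)).mul_right_cancel
  rw [mul_assoc, heckeY_mul_heckeT b k hy1 hz1 rfl, mul_assoc,
    heckeT_simple_mul_heckeY_of_dominant b k hz1 hz2, ← mul_assoc,
    heckeY_mul_heckeT b k hy1 hz1 rfl,
    heckeT_simple_mul_heckeY_of_dominant b k hy1 (by simp [h, hz2])]

/-- The coweight `μ = x + s_i x` is dominant and fixed by `s_i`, so `s_i τ(μ) = τ(x) s_i τ(x)`. The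
factorizations `s_i · τ(μ)`, `τ(x) s_i · τ(x)` and `τ(x) = τ(x) s_i · s_i` are all additive in
length, and the relation follows by cancelling units. -/
lemma heckeT_mul_heckeY_mul_heckeT {i : b.support} {x : Cowt P} (hx : IsDominant b x)
    (h : pair x i = 1) : heckeT b k (simpleRefl b (some i)) *
      heckeY b k (simpleRefl₀ b i • x) * heckeT b k (simpleRefl b (some i)) = heckeY b k x := by
  set s := simpleRefl b (some i) with hs
  set μ := simpleRefl₀ b i • x + x with hμ
  have hμ' : IsDominant b μ := isDominant_of_simple b _ fun j hj => by
    rw [hμ, simpleRefl₀_smul_cowt, h, one_smul]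
    by_cases hji : j = i
    · subst hji
      simp only [pair_add, pair_sub, pair_coroot, h, pairingIn_same]
      norm_num
    · simp only [pair_add, pair_sub, pair_coroot]
      have h1 := b.pairingIn_le_zero_of_ne hji hj i.2
      have h2 := hx j (Base.isPos_of_mem_support hj)
      omega
  have hneg : ¬ IsPosAff b (act (tau x) (simpleRoot b (some i))) := by
    rw [act_tau]
    simp only [simpleRoot, IsPosAff, h]
    omega
  have e1 : heckeT b k (tau x) = heckeT b k (tau x * s) * heckeT b k s := by
    have : tau x = tau x * s * s := by rw [mul_assoc, hs, simpleRefl_mul_self, mul_one]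
    conv_lhs => rw [this]
    refine heckeT_mul b k ?_
    rw [← this, length_mul_simpleRefl_of_neg b hneg, length_simpleRefl]
  have e2 : heckeT b k s * heckeT b k (tau μ) = heckeT b k (tau x * s) * heckeT b k (tau x) := by
    rw [hs, ← fin_simpleRefl₀, ← heckeT_fin_mul_tau b k _ hμ', ← heckeT_mul]
    · congr 1
      rw [mul_assoc, fin_mul_tau, fin_mul_tau, ← mul_assoc, ← tau_add, hμ, smul_add, ← mul_smul,
        simpleRefl₀_mul_self, one_smul]
    · refine length_mul_of_forall b fun a ha h' => ?_
      obtain ⟨h1, h2⟩ := neg_of_act_tau_neg hx ha h'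
      rw [act_mul, act_mul, act_tau, act_fin, act_tau]
      simp only [IsPosAff]
      by_cases hai : a.1 = i
      · have h3 : simpleRefl₀ b i • a.1 = P.reflectionPerm (i : ι) i := by
          rw [hai, simpleRefl₀_smul]
        rw [h3, isPos_negIndex, pair_negIndex, hai, h]
        have h4 : b.IsPos (i : ι) := hai ▸ h1
        rw [hai, h] at h2
        simp only [h4, not_true_eq_false, and_false, or_false]
        omega
      · have := hx _ (isPos_simpleRefl₀_of_ne b h1 hai)
        omega
  rw [heckeY_of_dominant b k hx, e1]
  congr 1
  apply (isUnit_heckeT b k (tau x)).mul_right_cancel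
  rw [mul_assoc, heckeY_mul_heckeT b k hμ' hx rfl, e2]

/-- The Bernstein relation. -/
theorem bernstein (i : b.support) (f : Reg P) :
    ∃ g, f - regW (simpleRefl₀ b i) f = (1 - rexp (-corootCowt (i : ι))) * g ∧
      heckeT b k (simpleRefl b (some i)) * fYHom b k f =
        fYHom b k (regW (simpleRefl₀ b i) f) * heckeT b k (simpleRefl b (some i)) +
          hParam k ((i : ι), 0) • fYHom b k g := by
  classical
  set T := heckeT b k (simpleRefl b (some i)) with hT
  set h := hParam k ((i : ι), 0) with hh
  -- The correction `g` obeys a twisted Leibniz rule, so the good `f` are closed under products. It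
  -- is enough to treat monomials orthogonal to `α_i` and the two monomials of `y` and `s_i y`,
  -- where `⟨y, α_i⟩ = 1`.
  set p : Reg P → Prop := fun f => ∃ g,
    f - regW (simpleRefl₀ b i) f = (1 - rexp (-corootCowt (i : ι))) * g ∧
      T * fYHom b k f = fYHom b k (regW (simpleRefl₀ b i) f) * T + h • fYHom b k g with hp
  have hinv1 : T * (T - algebraMap ℂ _ h) = 1 := heckeT_simple_mul_sub b k (some i)
  have hinv2 : (T - algebraMap ℂ _ h) * T = 1 := heckeT_simple_sub_mul b k (some i)
  have hmul : ∀ f1 f2, p f1 → p f2 → p (f1 * f2) := by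
    rintro f1 f2 ⟨g1, h1, h1'⟩ ⟨g2, h2, h2'⟩
    refine ⟨g1 * f2 + regW (simpleRefl₀ b i) f1 * g2, ?_, ?_⟩
    · rw [map_mul]; linear_combination f2 * h1 + regW (simpleRefl₀ b i) f1 * h2
    · rw [map_mul, map_mul, map_mul, ← mul_assoc, h1', add_mul, mul_assoc, h2', map_add, map_mul,
        map_mul, smul_add, mul_add, smul_mul_assoc, mul_smul_comm, mul_assoc]
      abel
  have hpow : ∀ f, p f → ∀ n : ℕ, p (f ^ n) := by
    intro f hf n
    induction n with
    | zero => exact ⟨0, by simp, by simp⟩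
    | succ n ih => rw [pow_succ]; exact hmul _ _ ih hf
  have h0 : ∀ x : Cowt P, pair x i = 0 → p (rexp x) := fun x hx => by
    have hsx : simpleRefl₀ b i • x = x := by rw [simpleRefl₀_smul_cowt, hx, zero_smul, sub_zero]
    refine ⟨0, ?_, ?_⟩
    · rw [regW_rexp, hsx, sub_self, mul_zero]
    · rw [regW_rexp, hsx, fYHom_rexp, map_zero, smul_zero, add_zero]
      exact heckeT_simple_commute_heckeY b k hx
  obtain ⟨y, hy⟩ := exists_cowt b fun j => if j = i then 1 else 0
  have hyi : pair y i = 1 := by rw [hy, if_pos rfl]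
  have hyd : IsDominant b y := isDominant_of_simple b _ fun j hj => by
    have := hy ⟨j, hj⟩
    simp only at this
    rw [this]
    split_ifs <;> norm_num
  have hsy : simpleRefl₀ b i • y = y - corootCowt (i : ι) := by
    rw [simpleRefl₀_smul_cowt, hyi, one_smul]
  have hssy : simpleRefl₀ b i • simpleRefl₀ b i • y = y := by
    rw [← mul_smul, simpleRefl₀_mul_self, one_smul]
  have hexp : rexp (simpleRefl₀ b i • y) = rexp (-corootCowt (i : ι)) * rexp y := by
    rw [hsy, ← rexp_add]; congr 1; abel
  have hrel := heckeT_mul_heckeY_mul_heckeT b k hyd hyi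
  rw [← hT] at hrel
  have hy1 : p (rexp y) := by
    refine ⟨rexp y, ?_, ?_⟩
    · rw [regW_rexp, hexp]; ring
    · rw [regW_rexp, fYHom_rexp, fYHom_rexp]
      have : heckeY b k (simpleRefl₀ b i • y) * T =
          (T - algebraMap ℂ _ h) * heckeY b k y := by
        rw [← hrel, ← mul_assoc, ← mul_assoc, hinv2, one_mul]
      rw [this, sub_mul, ← Algebra.smul_def, sub_add_cancel]
  have hy2 : p (rexp (simpleRefl₀ b i • y)) := by
    refine ⟨-rexp y, ?_, ?_⟩
    · rw [regW_rexp, hssy, hexp]; ring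
    · rw [regW_rexp, hssy, fYHom_rexp, fYHom_rexp, map_neg, fYHom_rexp]
      have : T * heckeY b k (simpleRefl₀ b i • y) =
          heckeY b k y * (T - algebraMap ℂ _ h) := by
        rw [← hrel, mul_assoc _ T, hinv1, mul_one]
      rw [this, mul_sub, ← Algebra.commutes, ← Algebra.smul_def, smul_neg, sub_eq_add_neg]
  have hnsmul : ∀ (n : ℕ) (x : Cowt P), rexp (n • x) = rexp x ^ n := fun n x => by
    induction n with
    | zero => rw [zero_smul, pow_zero, rexp_zero]
    | succ n ih => rw [succ_nsmul, rexp_add, ih, pow_succ]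
  refine reg_induction (p := p) f (fun x => ?_) ?_ ?_
  · obtain ⟨n, hn⟩ := Int.eq_nat_or_neg (pair x i)
    rcases hn with hn | hn
    · have : rexp x = rexp y ^ n * rexp (x - n • y) := by
        rw [← hnsmul, ← rexp_add]; congr 1; abel
      rw [this]
      exact hmul _ _ (hpow _ hy1 n) (h0 _ (by simp [hn, hyi]))
    · have : rexp x = rexp (simpleRefl₀ b i • y) ^ n *
          rexp (x - n • (simpleRefl₀ b i • y)) := by
        rw [← hnsmul, ← rexp_add]; congr 1; abel
      rw [this]
      refine hmul _ _ (hpow _ hy2 n) (h0 _ ?_)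
      simp [hn, hsy, hyi, pair_coroot, pairingIn_same]
  · rintro f1 f2 ⟨g1, h1, h1'⟩ ⟨g2, h2, h2'⟩
    refine ⟨g1 + g2, ?_, ?_⟩
    · rw [map_add]; linear_combination h1 + h2
    · rw [map_add, mul_add, h1', h2', map_add, map_add, map_add, add_mul, smul_add]
      abel
  · rintro c f1 ⟨g1, h1, h1'⟩
    refine ⟨c • g1, ?_, ?_⟩
    · rw [map_smul, ← smul_sub, h1, mul_smul_comm]
    · rw [map_smul, mul_smul_comm, h1', map_smul, map_smul, map_smul, smul_add, smul_mul_assoc,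
        smul_comm c h]

/-- The intertwining element `(1 - Y^{-α_i^∨}) T_i - (k_i - k_i⁻¹)`. -/
def intertwiner (i : b.support) : Hecke b k :=
  fYHom b k (1 - rexp (-corootCowt (i : ι))) * heckeT b k (simpleRefl b (some i)) -
    algebraMap ℂ _ (hParam k ((i : ι), 0))

/-- The factor `1 - Y^{-α_i^∨}` clears the denominator of the correction in the Bernstein relation,
and the subtracted constant cancels it. -/
lemma intertwiner_mul (i : b.support) (f : Reg P) :
    intertwiner b k i * fYHom b k f =
      fYHom b k (regW (simpleRefl₀ b i) f) * intertwiner b k i := by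
  obtain ⟨g, h1, h2⟩ := bernstein b k i f
  rw [intertwiner, sub_mul, mul_assoc, h2, mul_add, mul_sub, mul_smul_comm, ← map_mul, ← h1,
    ← Algebra.smul_def, ← Algebra.commutes, ← Algebra.smul_def, ← mul_assoc, ← mul_assoc,
    ← map_mul, ← map_mul, mul_comm (1 - _), map_sub, smul_sub]
  abel

end Bernstein

/-! ### The Bernstein basis and eigenfunctionals -/

section PBW

variable {P : RootPairing ι ℝ M N} [P.IsCrystallographic] (b : P.Base) [Fintype ι] [Nonempty ι]
  [P.IsReduced] [P.IsIrreducible] (k : Mult P)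

lemma heckeT_simpleRefl₀_mul {j : b.support} {w : P.weylGroup} (h : b.IsPos (w⁻¹ • (j : ι))) :
    heckeT b k (simpleRefl b (some j)) * heckeT b k (fin w) =
      heckeT b k (fin (simpleRefl₀ b j * w)) := by
  rw [fin_mul, fin_simpleRefl₀, heckeT_simple_mul]
  rw [← fin_inv, isPosAff_act_fin]
  exact h

lemma heckeT_simpleRefl₀_mul_of_neg {j : b.support} {w : P.weylGroup}
    (h : ¬ b.IsPos (w⁻¹ • (j : ι))) :
    heckeT b k (simpleRefl b (some j)) * heckeT b k (fin w) =
      hParam k ((j : ι), 0) • heckeT b k (fin w) + heckeT b k (fin (simpleRefl₀ b j * w)) := by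
  have h1 : b.IsPos ((simpleRefl₀ b j * w)⁻¹ • (j : ι)) := by
    rw [mul_inv_rev, simpleRefl₀_inv, mul_smul, simpleRefl₀_smul, smul_negIndex, isPos_negIndex]
    exact h
  have h2 := heckeT_simpleRefl₀_mul b k h1
  rw [simpleRefl₀_mul_cancel] at h2
  rw [← h2, ← mul_assoc, heckeT_sq, add_mul, one_mul, smul_mul_assoc]
  rfl

lemma heckeT_mul_simpleRefl₀ {j : b.support} {w : P.weylGroup} (h : b.IsPos (w • (j : ι))) :
    heckeT b k (fin w) * heckeT b k (simpleRefl b (some j)) =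
      heckeT b k (fin (w * simpleRefl₀ b j)) := by
  rw [fin_mul, fin_simpleRefl₀, heckeT_mul_simple]
  rw [isPosAff_act_fin]
  exact h

lemma heckeT_mul_simpleRefl₀_of_neg {j : b.support} {w : P.weylGroup}
    (h : ¬ b.IsPos (w • (j : ι))) :
    heckeT b k (fin w) * heckeT b k (simpleRefl b (some j)) =
      hParam k ((j : ι), 0) • heckeT b k (fin w) + heckeT b k (fin (w * simpleRefl₀ b j)) := by
  have h1 : b.IsPos ((w * simpleRefl₀ b j) • (j : ι)) := by
    rw [mul_smul, simpleRefl₀_smul, smul_negIndex, isPos_negIndex]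
    exact h
  have h2 := heckeT_mul_simpleRefl₀ b k h1
  rw [mul_simpleRefl₀_cancel] at h2
  rw [← h2, mul_assoc, heckeT_sq, mul_add, mul_one, mul_smul_comm]
  rfl

/-- The Bernstein basis elements `T_w Y^x`, `w ∈ W_0`, `x ∈ P^∨`. -/
def pbw (p : P.weylGroup × Cowt P) : Hecke b k := heckeT b k (fin p.1) * heckeY b k p.2

lemma heckeT_mul_fYHom_mem (w : P.weylGroup) (f : Reg P) :
    heckeT b k (fin w) * fYHom b k f ∈ Submodule.span ℂ (Set.range (pbw b k)) := by
  refine reg_induction (p := fun f => heckeT b k (fin w) * fYHom b k f ∈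
    Submodule.span ℂ (Set.range (pbw b k))) f (fun x => ?_) (fun f g hf hg => ?_) fun c f hf => ?_
  · rw [fYHom_rexp]
    exact Submodule.subset_span ⟨(w, x), rfl⟩
  · rw [map_add, mul_add]; exact add_mem hf hg
  · rw [map_smul, mul_smul_comm]; exact Submodule.smul_mem _ _ hf

lemma mul_fYHom_mem {x : Hecke b k} (hx : x ∈ Submodule.span ℂ (Set.range (pbw b k)))
    (f : Reg P) : x * fYHom b k f ∈ Submodule.span ℂ (Set.range (pbw b k)) := by
  induction hx using Submodule.span_induction with
  | mem x h =>
    obtain ⟨⟨w, y⟩, rfl⟩ := h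
    rw [pbw, mul_assoc, ← fYHom_rexp, ← map_mul]
    exact heckeT_mul_fYHom_mem b k w _
  | zero => rw [zero_mul]; exact zero_mem _
  | add x y _ _ hx hy => rw [add_mul]; exact add_mem hx hy
  | smul c x _ hx => rw [smul_mul_assoc]; exact Submodule.smul_mem _ _ hx

lemma heckeY_mul_simple (i : b.support) (x : Cowt P) :
    ∃ g, rexp (simpleRefl₀ b i • x) - rexp x = (1 - rexp (-corootCowt (i : ι))) * g ∧
      heckeY b k x * heckeT b k (simpleRefl b (some i)) =
        heckeT b k (simpleRefl b (some i)) * heckeY b k (simpleRefl₀ b i • x) -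
          hParam k ((i : ι), 0) • fYHom b k g := by
  obtain ⟨g, h1, h2⟩ := bernstein b k i (rexp (simpleRefl₀ b i • x))
  rw [regW_rexp, ← mul_smul, simpleRefl₀_mul_self, one_smul] at h1 h2
  refine ⟨g, h1, ?_⟩
  rw [fYHom_rexp, fYHom_rexp] at h2
  rw [h2, add_sub_cancel_right]

lemma mul_simple_mem {x : Hecke b k} (hx : x ∈ Submodule.span ℂ (Set.range (pbw b k)))
    (i : b.support) : x * heckeT b k (simpleRefl b (some i)) ∈
      Submodule.span ℂ (Set.range (pbw b k)) := by
  induction hx using Submodule.span_induction with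
  | mem x h =>
    obtain ⟨⟨w, y⟩, rfl⟩ := h
    obtain ⟨g, -, h2⟩ := heckeY_mul_simple b k i y
    rw [pbw, mul_assoc, h2, mul_sub, ← mul_assoc, mul_smul_comm, ← fYHom_rexp]
    refine sub_mem (mul_fYHom_mem b k ?_ _)
      (Submodule.smul_mem _ _ (heckeT_mul_fYHom_mem b k w g))
    have hw (u : P.weylGroup) : heckeT b k (fin u) ∈ Submodule.span ℂ (Set.range (pbw b k)) := by
      simpa using heckeT_mul_fYHom_mem b k u 1
    by_cases hp : b.IsPos (w • (i : ι))
    · rw [heckeT_mul_simpleRefl₀ b k hp]; exact hw _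
    · rw [heckeT_mul_simpleRefl₀_of_neg b k hp]
      exact add_mem (Submodule.smul_mem _ _ (hw _)) (hw _)
  | zero => rw [zero_mul]; exact zero_mem _
  | add x y _ _ hx hy => rw [add_mul]; exact add_mem hx hy
  | smul c x _ hx => rw [smul_mul_assoc]; exact Submodule.smul_mem _ _ hx

/-- The span is stable under right multiplication by `T_j`, hence also by its inverse `T_j - (k_j -
k_j⁻¹)`. -/
lemma mem_of_mul_heckeT_fin_mem (w : P.weylGroup) : ∀ x : Hecke b k,
    x * heckeT b k (fin w) ∈ Submodule.span ℂ (Set.range (pbw b k)) →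
      x ∈ Submodule.span ℂ (Set.range (pbw b k)) := by
  induction w using weyl_induction b with
  | h0 => intro x hx; simpa [heckeT_one] using hx
  | h1 j w hj ih =>
    intro x hx
    rw [← heckeT_simpleRefl₀_mul b k hj, ← mul_assoc] at hx
    have h1 := ih _ hx
    have h2 := sub_mem (mul_simple_mem b k h1 j)
      (Submodule.smul_mem _ (hParam k (simpleRoot b (some j))) h1)
    rwa [mul_assoc, ← mul_smul_comm, ← mul_sub, heckeT_sq, add_sub_cancel_left, mul_one] at h2

/-- Multiplying `ω` by the inverse of its finite part gives a dominant translation, with additive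
lengths. So `T_ω` is some `Y^x` times the inverse of a `T_w`, `w ∈ W_0`. -/
lemma mul_heckeT_mem_of_length_eq_zero {x : Hecke b k}
    (hx : x ∈ Submodule.span ℂ (Set.range (pbw b k))) {ω : ExtWeyl P} (hω : length b ω = 0) :
    x * heckeT b k ω ∈ Submodule.span ℂ (Set.range (pbw b k)) := by
  apply mem_of_mul_heckeT_fin_mem b k ω.right⁻¹
  have h1 : ω * fin ω.right⁻¹ = tau ω.left.toAdd := by
    have : ω = tau ω.left.toAdd * fin ω.right :=
      (SemidirectProduct.inl_left_mul_inr_right ω).symm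
    conv_lhs => rw [this]
    rw [fin_inv]
    exact mul_inv_cancel_right _ _
  have hd : IsDominant b ω.left.toAdd := fun i hi => by
    have h2 : IsPosAff b (act ω⁻¹ (i, 0)) := by
      rw [isPosAff_act_iff_of_length_eq_zero b (by rw [length_inv, hω]), isPosAff_fin_iff]
      exact hi
    have h3 : ω⁻¹ = fin ω.right⁻¹ * tau (-ω.left.toAdd) := by
      rw [tau_neg, ← h1, mul_inv_rev, ← mul_assoc, mul_inv_cancel, one_mul]
    rw [h3, act_mul, act_tau, act_fin, IsPosAff, pair_neg] at h2
    simp only at h2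
    omega
  rw [mul_assoc, ← heckeT_mul, h1, ← heckeY_of_dominant b k hd, ← fYHom_rexp]
  · exact mul_fYHom_mem b k hx _
  · rw [length_mul_of_length_eq_zero_left b hω, hω, zero_add]

/-- From `s_0 s_φ = τ(φ^∨)`, additive in length, `T_0` is `Y^{φ^∨}` times the inverse of `T_{s_φ}`.
-/
lemma mul_simple_none_mem {x : Hecke b k}
    (hx : x ∈ Submodule.span ℂ (Set.range (pbw b k))) :
    x * heckeT b k (simpleRefl b none) ∈ Submodule.span ℂ (Set.range (pbw b k)) := by
  set φ := highest b with hφ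
  apply mem_of_mul_heckeT_fin_mem b k (weylGroup.ofIdx P φ)
  have hd : IsDominant b (corootCowt φ) := isDominant_of_simple b _ fun j hj => by
    rw [pair_coroot]
    obtain ⟨ρ, hρ⟩ := exists_pair_eq_height P b
    have h1 : 0 ≤ P.pairingIn ℤ φ j := by
      refine pairingIn_nonneg_of_maximal b (y := ρ) (fun j hj => ?_) (fun l => ?_) hj
      · rw [hρ, Base.height_one_of_mem_support hj]; norm_num
      · rw [hρ, hρ]; exact height_le_highest b l
    rcases h1.lt_or_eq with h1 | h1
    · exact ((P.zero_lt_pairingIn_iff' ℤ).1 h1).le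
    · exact (P.pairingIn_eq_zero_iff.1 h1.symm).ge
  have h0 : simpleRefl b none * fin (weylGroup.ofIdx P φ) = tau (corootCowt φ) := by
    apply act_faithful
    rintro ⟨i, r⟩
    rw [act_mul, act_fin, simpleRefl, act_affRefl, act_tau, ofIdx_smul_index]
    have h2 : P.pairingIn ℤ (P.reflectionPerm φ i) (P.reflectionPerm φ φ) =
        P.pairingIn ℤ i φ := by
      have := pairingIn_smul_smul (weylGroup.ofIdx P φ) i φ
      rwa [ofIdx_smul_index, ofIdx_smul_index] at this
    simp only [simpleRoot, ← hφ, one_mul, h2, pair_coroot, Prod.mk.injEq, and_true]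
    apply P.root.injective
    rw [root_reflectionPerm_eq, h2, root_negIndex, root_reflectionPerm_eq]
    simp
  rw [mul_assoc, ← heckeT_simple_mul, h0, ← heckeY_of_dominant b k hd, ← fYHom_rexp]
  · exact mul_fYHom_mem b k hx _
  · rw [← fin_inv, act_fin]
    left
    simp [simpleRoot]

lemma span_pbw : Submodule.span ℂ (Set.range (pbw b k)) = ⊤ := by
  have h1 : ∀ w : ExtWeyl P, ∀ x ∈ Submodule.span ℂ (Set.range (pbw b k)),
      x * heckeT b k w ∈ Submodule.span ℂ (Set.range (pbw b k)) := by
    intro w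
    induction w using extWeyl_induction b with
    | h0 w hw => exact fun x hx => mul_heckeT_mem_of_length_eq_zero b k hx hw
    | h1 j w hj ih =>
      intro x hx
      rw [heckeT_simple_mul b k hj, ← mul_assoc]
      apply ih
      cases j with
      | none => exact mul_simple_none_mem b k hx
      | some j => exact mul_simple_mem b k hx j
  rw [eq_top_iff]
  rintro y -
  have hy : y ∈ Algebra.adjoin ℂ (Set.range (heckeT b k)) := by rw [adjoin_heckeT]; trivial
  suffices h : ∀ x ∈ Submodule.span ℂ (Set.range (pbw b k)),
      x * y ∈ Submodule.span ℂ (Set.range (pbw b k)) by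
    have := h 1 (by simpa [heckeT_one] using heckeT_mul_fYHom_mem b k 1 1)
    rwa [one_mul] at this
  induction hy using Algebra.adjoin_induction with
  | mem y hy => obtain ⟨w, rfl⟩ := hy; exact h1 w
  | algebraMap r =>
    intro x hx
    rw [← Algebra.commutes, ← Algebra.smul_def]
    exact Submodule.smul_mem _ _ hx
  | add y z _ _ hy hz => intro x hx; rw [mul_add]; exact add_mem (hy x hx) (hz x hx)
  | mul y z _ _ hy hz => intro x hx; rw [← mul_assoc]; exact hz _ (hy x hx)

variable {b} in
lemma exists_dominant_shift (s : Finset (Cowt P)) : ∃ z : Cowt P, ∀ x ∈ s, IsDominant b (x + z) := by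
  obtain ⟨z, hz⟩ := exists_cowt b fun j => ∑ x ∈ s, |pair x j|
  refine ⟨z, fun x hx => isDominant_of_simple b _ fun j hj => ?_⟩
  rw [pair_add, hz ⟨j, hj⟩]
  have := Finset.single_le_sum (f := fun x => |pair x j|) (fun i _ => abs_nonneg _) hx
  have h2 := neg_abs_le (pair x j)
  simp only at *
  omega

variable {b} in
-- Right multiplication by `Y^z` with `z` sufficiently dominant turns the finitely many `T_w Y^x` of
-- a relation into distinct elements `T_{w τ(x + z)}`.
lemma linearIndependent_pbw (q : QParam b) : LinearIndependent ℂ (pbw b k) := by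
  classical
  rw [linearIndependent_iff']
  intro s c hc
  obtain ⟨z, hz⟩ := exists_dominant_shift (b := b) (s.image Prod.snd)
  have hinj : Function.Injective fun p : P.weylGroup × Cowt P => fin p.1 * tau (p.2 + z) := by
    rintro ⟨u, x⟩ ⟨v, y⟩ h
    simp only [fin_mul_tau] at h
    have h1 := congrArg SemidirectProduct.right h
    have h2 := congrArg SemidirectProduct.left h
    simp only [tau, fin, SemidirectProduct.mul_right, SemidirectProduct.right_inl,
      SemidirectProduct.right_inr, one_mul] at h1
    subst h1
    have h3 : u • (x + z) = u • (y + z) := by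
      simpa [tau, fin] using h2
    simpa using h3
  have hli := (linearIndependent_heckeT q k).comp _ hinj
  rw [linearIndependent_iff'] at hli
  refine hli s c ?_
  rw [← zero_mul (heckeY b k z), ← hc, Finset.sum_mul]
  refine Finset.sum_congr rfl fun p hp => ?_
  have hd := hz p.2 (Finset.mem_image_of_mem _ hp)
  rw [Function.comp_apply, heckeT_fin_mul_tau b k _ hd, ← heckeY_of_dominant b k hd, heckeY_add,
    pbw, smul_mul_assoc, mul_assoc]

/-- A functional on `H(k)` which is an eigenvector, under right multiplication, of the `f(Y)` and
of the `T_j`, `j ∈ J`. -/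
theorem exists_eigenfunctional (q : QParam b) (J : Set b.support) (e : b.support → ℂ)
    (he : ∀ j, e j ≠ 0) (heh : ∀ j : b.support, hParam k ((j : ι), 0) = e j - (e j)⁻¹)
    (δ : Torus P) (hδ : ∀ j ∈ J, tpow δ (corootCowt (j : ι)) = e j ^ 2)
    (n : P.weylGroup → ℂ)
    (hn : ∀ w, ∀ j ∈ J, b.IsPos (w • (j : ι)) → n (w * simpleRefl₀ b j) = e j * n w) :
    ∃ θ : Hecke b k →ₗ[ℂ] ℂ, (∀ w, θ (heckeT b k (fin w)) = n w) ∧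
      (∀ x f, θ (x * fYHom b k f) = evalAt δ f * θ x) ∧
      ∀ x, ∀ j ∈ J, θ (x * heckeT b k (simpleRefl b (some j))) = e j * θ x := by
  let B := Module.Basis.mk (linearIndependent_pbw k q) (span_pbw b k).ge
  let θ : Hecke b k →ₗ[ℂ] ℂ := B.constr ℂ fun p => n p.1 * tpow δ p.2
  have hθ : ∀ w x, θ (heckeT b k (fin w) * heckeY b k x) = n w * tpow δ x := fun w x => by
    have := B.constr_basis ℂ (fun p => n p.1 * tpow δ p.2) (w, x)
    rwa [Module.Basis.mk_apply] at this
  have hB : ∀ {p : Hecke b k → Prop}, (∀ w x, p (heckeT b k (fin w) * heckeY b k x)) →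
      (∀ x y, p x → p y → p (x + y)) → (∀ (c : ℂ) x, p x → p (c • x)) → p 0 → ∀ x, p x := by
    intro p h1 h2 h3 h0 x
    have hx : x ∈ Submodule.span ℂ (Set.range (pbw b k)) := by rw [span_pbw]; trivial
    induction hx using Submodule.span_induction with
    | mem x h => obtain ⟨⟨w, y⟩, rfl⟩ := h; exact h1 w y
    | zero => exact h0
    | add x y _ _ hx hy => exact h2 _ _ hx hy
    | smul c x _ hx => exact h3 _ _ hx
  have hf : ∀ x f, θ (x * fYHom b k f) = evalAt δ f * θ x := by
    intro x f
    refine reg_induction (p := fun f => θ (x * fYHom b k f) = evalAt δ f * θ x) f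
      (fun y => ?_) (fun f g hf hg => ?_) fun c f hf => ?_
    · rw [fYHom_rexp, evalAt_rexp]
      refine hB (p := fun x => θ (x * heckeY b k y) = tpow δ y * θ x) (fun w z => ?_)
        (fun x z hx hz => ?_) (fun c x hx => ?_) (by simp) x
      · rw [mul_assoc, ← heckeY_add, hθ, hθ, tpow_add]; ring
      · rw [add_mul, map_add, map_add, hx, hz, mul_add]
      · rw [smul_mul_assoc, map_smul, map_smul, hx, mul_smul_comm]
    · rw [map_add, mul_add, map_add, hf, hg, map_add, add_mul]
    · rw [map_smul, mul_smul_comm, map_smul, hf, map_smul, smul_mul_assoc]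
  have h1 : ∀ w, θ (heckeT b k (fin w)) = n w := fun w => by
    have := hθ w 0
    rwa [heckeY_zero, mul_one, tpow_zero, mul_one] at this
  refine ⟨θ, h1, hf, fun x j hj => ?_⟩
  refine hB (p := fun x => θ (x * heckeT b k (simpleRefl b (some j))) = e j * θ x) (fun w y => ?_)
      (fun x z hx hz => ?_) (fun c x hx => ?_) (by simp) x
  · obtain ⟨g, hg1, hg2⟩ := heckeY_mul_simple b k j y
    have hν : θ (heckeT b k (fin w) * heckeT b k (simpleRefl b (some j))) = e j * n w := by
      by_cases hp : b.IsPos (w • (j : ι))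
      · rw [heckeT_mul_simpleRefl₀ b k hp, h1, hn w j hj hp]
      · rw [heckeT_mul_simpleRefl₀_of_neg b k hp, map_add, map_smul, h1, h1, heh]
        have h2 := hn (w * simpleRefl₀ b j) j hj (by
          rw [mul_smul, simpleRefl₀_smul, smul_negIndex, isPos_negIndex]; exact hp)
        rw [mul_simpleRefl₀_cancel] at h2
        rw [h2, smul_eq_mul]
        field_simp [he j]
        ring
    -- Here the condition on `δ` enters. The denominator takes the value `1 - e_j⁻²`, so `(e_j -
    -- e_j⁻¹) g(δ)` becomes `e_j` times a difference of values, which is exactly what the eigenvalue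
    -- equation for `T_j` requires.
    have hg3 := congrArg (evalAt δ) hg1
    rw [map_sub, map_mul, map_sub, map_one, evalAt_rexp, evalAt_rexp, evalAt_rexp, tpow_neg,
      hδ j hj] at hg3
    rw [mul_assoc, hg2, mul_sub, ← mul_assoc, mul_smul_comm, map_sub, map_smul, ← fYHom_rexp,
      hf, hf, hν, h1, hθ, evalAt_rexp, heh, smul_eq_mul]
    have h3 : (e j - (e j)⁻¹) * evalAt δ g =
        e j * (tpow δ (simpleRefl₀ b j • y) - tpow δ y) := by
      rw [hg3]; field_simp [he j]
    linear_combination -(n w) * h3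
  · rw [add_mul, map_add, map_add, hx, hz, mul_add]
  · rw [smul_mul_assoc, map_smul, map_smul, hx, mul_smul_comm]

end PBW

/-! ### Points of the torus fixed by a minimal coset representative -/

section Regularity

variable {P : RootPairing ι ℝ M N} [P.IsCrystallographic] (b : P.Base) [Fintype ι] [Nonempty ι]
  [P.IsReduced] [P.IsIrreducible]

variable {b} in
lemma pair_eq_of_mem_parabolicRoots {J : Set b.support} {i : ι} (hi : i ∈ parabolicRoots b J)
    {x y : Cowt P} (h : ∀ j ∈ J, pair x j = pair y j) : pair x i = pair y i := by
  have key : ∀ m ∈ AddSubgroup.closure ((fun j : b.support => P.root j) '' J),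
      P.flip.toLinearMap (x : N) m = P.flip.toLinearMap (y : N) m := by
    intro m hm
    induction hm using AddSubgroup.closure_induction with
    | mem m hm =>
      obtain ⟨j, hj, rfl⟩ := hm
      change P.root' j (x : N) = P.root' j (y : N)
      rw [pair_spec, pair_spec, h j hj]
    | zero => simp
    | add m n _ _ hm hn => rw [map_add, map_add, hm, hn]
    | neg m _ hm => rw [map_neg, map_neg, hm]
  have h2 : P.root' i (x : N) = P.root' i (y : N) := key _ hi
  rw [pair_spec, pair_spec] at h2
  exact_mod_cast h2

/-- On `R_0^J` the functional `w⁻¹ ρ` agrees with a coweight `y` having the same values on `J` and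
the value `1` on the other simple roots. This `y` is strictly dominant. -/
lemma isPos_smul_of_mem_parabolicRoots {J : Set b.support} {w : P.weylGroup}
    (hw : w ∈ minReps b J) {i : ι} (hi : i ∈ parabolicRoots b J) (hp : b.IsPos i) :
    b.IsPos (w • i) := by
  classical
  obtain ⟨ρ, hρ⟩ := exists_pair_eq_height P b
  have hρ1 : ∀ j ∈ b.support, 0 < pair ρ j := fun j hj => by
    rw [hρ, Base.height_one_of_mem_support hj]; norm_num
  obtain ⟨y, hy⟩ := exists_cowt b fun j => if j ∈ J then pair (w⁻¹ • ρ) j else 1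
  apply isPos_of_pair_pos b hρ1
  have h1 : pair ρ (w • i) = pair (w⁻¹ • ρ) i := by rw [pair_smul, inv_inv]
  rw [h1, pair_eq_of_mem_parabolicRoots hi (y := y) fun j hj => by rw [hy, if_pos hj]]
  refine pair_pos_of_isPos b (fun j hj => ?_) hp
  have := hy ⟨j, hj⟩
  simp only at this
  rw [this]
  split_ifs with hJ
  · rw [pair_smul, inv_inv]
    exact pair_pos_of_isPos b hρ1 ((mem_minReps_iff b J w).1 hw _ hJ)
  · norm_num

lemma cowt_ext_simple {x y : Cowt P} (h : ∀ j ∈ b.support, pair x j = pair y j) : x = y :=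
  cowt_ext fun i => by
    obtain ⟨f, -, -, hf⟩ := b.exists_root_eq_sum_int i
    rw [pair_eq_sum b x hf, pair_eq_sum b y hf]
    exact Finset.sum_congr rfl fun j hj => by rw [h j hj]

/-- The root `α_i`, as a homomorphism `P^∨ → ℤ`. -/
def rootHom (i : ι) : Cowt P →+ ℤ where
  toFun x := pair x i
  map_zero' := pair_zero i
  map_add' x y := pair_add x y i

@[simp] lemma rootHom_apply (i : ι) (x : Cowt P) : rootHom i x = pair x i := rfl

/-- The fundamental coweights. -/
lemma exists_fundamental : ∃ ω : b.support → Cowt P,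
    ∀ x : Cowt P, x = ∑ j : b.support, pair x j • ω j := by
  classical
  choose ω hω using fun i : b.support => exists_cowt b fun j => if j = i then (1 : ℤ) else 0
  refine ⟨ω, fun x => cowt_ext_simple b fun j hj => ?_⟩
  rw [← rootHom_apply j (∑ j : b.support, pair x j • ω j), map_sum]
  have h1 : ∀ i : b.support, rootHom j (pair x i • ω i) =
      if (⟨j, hj⟩ : b.support) = i then pair x j else 0 := fun i => by
    have := hω i ⟨j, hj⟩
    simp only at this
    rw [rootHom_apply, pair_zsmul, this]
    split_ifs with h
    · rw [← h, mul_one]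
    · rw [mul_zero]
  rw [Finset.sum_congr rfl fun i _ => h1 i]
  simp

lemma mem_closure_rootHom (b : P.Base) (μ : Cowt P →+ ℤ) :
    μ ∈ AddSubgroup.closure (Set.range (rootHom (P := P))) := by
  obtain ⟨ω, hω⟩ := exists_fundamental b
  have : μ = ∑ j : b.support, μ (ω j) • rootHom (j : ι) := by
    ext x
    rw [AddMonoidHom.finsetSum_apply]
    conv_lhs => rw [hω x]
    rw [map_sum]
    refine Finset.sum_congr rfl fun j _ => ?_
    rw [map_zsmul, AddMonoidHom.smul_apply, rootHom_apply, smul_eq_mul, smul_eq_mul, mul_comm]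
  rw [this]
  exact sum_mem fun j _ =>
    AddSubgroup.zsmul_mem _ (AddSubgroup.subset_closure (Set.mem_range_self (j : ι))) _

lemma rootHom_eq_of_root_eq {i j l : ι} (h : P.root l = P.root i + P.root j) :
    rootHom (P := P) l = rootHom i + rootHom j := by
  ext x
  have := pair_of_root_eq x (i := i) (j := j) (l := l) (c := 1) (d := 1) (by simp [h])
  simpa using this

lemma rootHom_neg (i : ι) : rootHom (P := P) (P.reflectionPerm i i) = -rootHom i := by
  ext x
  simp [pair_negIndex]

/-- A nonzero element of the root lattice is not this small. In a sum of roots, one with negative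
pairing against the first root `α_i` can be merged or cancelled with it, which shortens the sum. If
there is none, the value on `α_i^∨` is at least `2`. -/
lemma eq_zero_of_abs_le_one {l : List ι}
    (h : ∀ i, |(l.map (rootHom (P := P))).sum (corootCowt i)| ≤ 1) :
    (l.map (rootHom (P := P))).sum = 0 := by
  classical
  induction hn : l.length using Nat.strong_induction_on generalizing l with
  | _ n ih =>
    subst hn
    match l with
    | [] => rfl
    | i :: l =>
      by_cases hall : ∀ j ∈ l, 0 ≤ P.pairingIn ℤ j i
      · exfalso
        have h1 := h i
        have h2 : 0 ≤ (l.map (rootHom (P := P))).sum (corootCowt i) := by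
          clear h h1 ih
          induction l with
          | nil => simp
          | cons j l ihl =>
            rw [List.map_cons, List.sum_cons, AddMonoidHom.add_apply, rootHom_apply, pair_coroot]
            exact add_nonneg (hall j (by simp)) (ihl fun j hj => hall j (by simp [hj]))
        rw [List.map_cons, List.sum_cons, AddMonoidHom.add_apply, rootHom_apply, pair_coroot,
          pairingIn_same, abs_le] at h1
        omega
      · push Not at hall
        obtain ⟨j, hj, hneg⟩ := hall
        have hsum : (l.map (rootHom (P := P))).sum =
            rootHom j + ((l.erase j).map (rootHom (P := P))).sum := by
          rw [← List.sum_cons, ← List.map_cons]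
          exact ((List.perm_cons_erase hj).map _).sum_eq
        have hlen := List.length_erase_of_mem hj
        have hpos := List.length_pos_of_mem hj
        by_cases hji : P.root j = -P.root i
        · have h0 : rootHom (P := P) i + rootHom j = 0 := by
            have : j = P.reflectionPerm i i := P.root.injective (by rw [hji, root_negIndex])
            rw [this, rootHom_neg, add_neg_cancel]
          have e : ((i :: l).map (rootHom (P := P))).sum =
              ((l.erase j).map (rootHom (P := P))).sum := by
            rw [List.map_cons, List.sum_cons, hsum, ← add_assoc, h0, zero_add]
          rw [e] at h ⊢
          exact ih _ (by rw [hlen, List.length_cons]; omega) h rfl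
        · obtain ⟨m, hm⟩ := P.root_add_root_mem_of_pairingIn_neg hneg hji
          have e : ((i :: l).map (rootHom (P := P))).sum =
              ((m :: l.erase j).map (rootHom (P := P))).sum := by
            rw [List.map_cons, List.sum_cons, hsum, List.map_cons, List.sum_cons,
              rootHom_eq_of_root_eq hm]
            abel
          rw [e] at h ⊢
          exact ih _ (by rw [List.length_cons, hlen, List.length_cons]; omega) h rfl

lemma exists_list_sum_rootHom (b : P.Base) (μ : Cowt P →+ ℤ) : ∃ l : List ι, (l.map rootHom).sum = μ := by
  have hμ := mem_closure_rootHom b μ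
  induction hμ using AddSubgroup.closure_induction with
  | mem μ h => obtain ⟨i, rfl⟩ := h; exact ⟨[i], by simp⟩
  | zero => exact ⟨[], rfl⟩
  | add μ ν _ _ h1 h2 =>
    obtain ⟨l1, rfl⟩ := h1
    obtain ⟨l2, rfl⟩ := h2
    exact ⟨l1 ++ l2, by simp⟩
  | neg μ hμ h1 =>
    obtain ⟨l, rfl⟩ := h1
    clear hμ
    refine ⟨l.map fun i => P.reflectionPerm i i, ?_⟩
    induction l with
    | nil => simp
    | cons i l ih => rw [List.map_cons, List.map_cons, List.sum_cons, ih, List.map_cons,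
        List.sum_cons, rootHom_neg, neg_add]

/-- This is `2 (x, α_i) = x(α_i^∨) (α_i, α_i)` for the form `(x, y) = ∑ x(α_l^∨) y(α_l^∨)`. It
follows by averaging the sum with its image under the reflection in `α_i`. -/
lemma sum_mul_pairingIn (x : Cowt P →+ ℝ) (i : ι) :
    2 * ∑ l, x (corootCowt l) * P.pairingIn ℤ i l =
      x (corootCowt i) * ∑ l, (P.pairingIn ℤ i l : ℝ) ^ 2 := by
  have h1 : ∑ l, x (corootCowt l) * P.pairingIn ℤ i l =
      ∑ l, x (corootCowt (P.reflectionPerm i l)) * P.pairingIn ℤ i (P.reflectionPerm i l) :=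
    (Equiv.sum_comp (P.reflectionPerm i) fun l => x (corootCowt l) * (P.pairingIn ℤ i l : ℝ)).symm
  have h2 : ∀ l, x (corootCowt (P.reflectionPerm i l)) * P.pairingIn ℤ i (P.reflectionPerm i l) =
      -(x (corootCowt l) * P.pairingIn ℤ i l) +
        x (corootCowt i) * (P.pairingIn ℤ i l : ℝ) ^ 2 := fun l => by
    rw [← ofIdx_smul_index, ← smul_corootCowt, ofIdx_smul_cowt, pair_coroot, map_sub, map_zsmul]
    have h3 : P.pairingIn ℤ i (weylGroup.ofIdx P i • l) = -P.pairingIn ℤ i l := by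
      have := pairingIn_smul_smul (weylGroup.ofIdx P i) (P.reflectionPerm i i) l
      rw [smul_negIndex, ofIdx_smul_index i i, negIndex_negIndex] at this
      rw [this]
      simp
    rw [h3, zsmul_eq_mul]
    push_cast
    ring
  rw [Finset.sum_congr rfl fun l _ => h2 l, Finset.sum_add_distrib, Finset.sum_neg_distrib,
    ← Finset.mul_sum] at h1
  linarith

lemma sum_sq_pairingIn_pos (i : ι) : 0 < ∑ l, (P.pairingIn ℤ i l : ℝ) ^ 2 := by
  refine Finset.sum_pos' (fun l _ => sq_nonneg _) ⟨i, Finset.mem_univ _, ?_⟩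
  rw [pairingIn_same]; norm_num

/-- Bounded energy leaves only finitely many integer vectors. -/
lemma exists_isLeast_energy (x : ι → ℝ) {V : Set (ι → ℤ)} (hV : V.Nonempty) :
    ∃ m ∈ V, ∀ m' ∈ V, ∑ i, (x i + m i) ^ 2 ≤ ∑ i, (x i + m' i) ^ 2 := by
  obtain ⟨m₀, hm₀⟩ := hV
  set C := ∑ i, (x i + m₀ i) ^ 2 with hC
  have hC0 : 0 ≤ C := Finset.sum_nonneg fun i _ => sq_nonneg _
  set S := {m ∈ V | ∑ i, (x i + (m i : ℝ)) ^ 2 ≤ C} with hS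
  have hfin : S.Finite := by
    refine Set.Finite.subset (Set.Finite.pi' fun i =>
      Set.finite_Icc ⌈-x i - C - 1⌉ ⌊-x i + C + 1⌋) fun m hm i => ?_
    have h1 : (x i + m i) ^ 2 ≤ C := le_trans
      (Finset.single_le_sum (f := fun i => (x i + (m i : ℝ)) ^ 2) (fun i _ => sq_nonneg _)
        (Finset.mem_univ i)) hm.2
    rw [Set.mem_Icc, Int.ceil_le, Int.le_floor]
    constructor <;> nlinarith
  obtain ⟨m, hm, hmin⟩ := hfin.exists_minimalFor (fun m => ∑ i, (x i + (m i : ℝ)) ^ 2) S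
    ⟨m₀, hm₀, le_rfl⟩
  refine ⟨m, hm.1, fun m' hm' => ?_⟩
  by_cases h : ∑ i, (x i + (m' i : ℝ)) ^ 2 ≤ C
  · by_contra hlt
    exact hlt (hmin ⟨hm', h⟩ (not_le.1 hlt).le)
  · exact hm.2.trans (not_le.1 h).le

/-- Minimise the energy over all shifts by the root lattice. Subtracting `α_i` changes it by `(α_i,
α_i)(1 - y(α_i^∨))`, so `y(α_i^∨) ≤ 1` at the minimum. Equality is excluded by the hypothesis, and
`-α_i` gives the lower bound. -/
lemma exists_shift_abs_lt_one (x : Cowt P →+ ℝ) (hx : ∀ i (n : ℤ), x (corootCowt i) ≠ n) :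
    ∃ μ : Cowt P →+ ℤ, ∀ i, |x (corootCowt i) + μ (corootCowt i)| < 1 := by
  obtain ⟨m, ⟨μ, hμ⟩, hmin⟩ := exists_isLeast_energy (fun i => x (corootCowt i))
    (V := Set.range fun (μ : Cowt P →+ ℤ) i => μ (corootCowt i)) ⟨_, 0, rfl⟩
  refine ⟨μ, ?_⟩
  set y : Cowt P →+ ℝ := x + (Int.castAddHom ℝ).comp μ with hy
  have hle : ∀ i, y (corootCowt i) ≤ 1 := fun i => by
    have h1 := hmin _ ⟨μ - rootHom i, rfl⟩
    rw [← hμ] at h1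
    have h2 : ∀ l, (x (corootCowt l) + ((μ - rootHom i : Cowt P →+ ℤ) (corootCowt l) : ℤ)) ^ 2 =
        (x (corootCowt l) + (μ (corootCowt l) : ℤ)) ^ 2 - 2 * (y (corootCowt l) *
          P.pairingIn ℤ i l) + (P.pairingIn ℤ i l : ℝ) ^ 2 := fun l => by
      rw [hy, AddMonoidHom.sub_apply, rootHom_apply, pair_coroot]
      simp only [AddMonoidHom.add_apply, AddMonoidHom.comp_apply, Int.coe_castAddHom]
      push_cast
      ring
    simp only [h2] at h1
    rw [Finset.sum_add_distrib, Finset.sum_sub_distrib, ← Finset.mul_sum, sum_mul_pairingIn] at h1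
    have h3 := sum_sq_pairingIn_pos (P := P) i
    nlinarith
  have hne : ∀ i, y (corootCowt i) ≠ 1 := fun i h => by
    apply hx i (1 - μ (corootCowt i))
    have : y (corootCowt i) = x (corootCowt i) + μ (corootCowt i) := rfl
    push_cast
    linarith
  intro i
  change |y (corootCowt i)| < 1
  rw [abs_lt]
  refine ⟨?_, lt_of_le_of_ne (hle i) (hne i)⟩
  have := lt_of_le_of_ne (hle (P.reflectionPerm i i)) (hne _)
  rw [corootCowt_negIndex, map_neg] at this
  linarith

/-- The value at a coroot has the sign of the form against the corresponding root, and the form is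
additive along the expansion of a positive root in simple roots. -/
lemma nonneg_of_simple {x : Cowt P →+ ℝ} (hx : ∀ j ∈ b.support, 0 ≤ x (corootCowt j)) {i : ι}
    (hi : b.IsPos i) : 0 ≤ x (corootCowt i) := by
  have key : ∀ i, 0 ≤ x (corootCowt i) ↔ 0 ≤ ∑ l, x (corootCowt l) * P.pairingIn ℤ i l := by
    intro i
    have h1 := sum_mul_pairingIn x i
    have h2 := sum_sq_pairingIn_pos (P := P) i
    constructor <;> intro h <;> nlinarith
  obtain ⟨f, -, hf1, hf⟩ := b.exists_root_eq_sum_int i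
  have hf0 : 0 < f := by
    refine hf1.resolve_right fun hn => ?_
    rw [Base.isPos_iff, Base.height_eq_sum hf] at hi
    exact absurd hi (not_lt.2 (Finset.sum_nonpos fun i _ => hn.le i))
  rw [key]
  have h3 : ∑ l, x (corootCowt l) * P.pairingIn ℤ i l =
      ∑ j ∈ b.support, f j * ∑ l, x (corootCowt l) * P.pairingIn ℤ j l := by
    simp_rw [Finset.mul_sum]
    rw [Finset.sum_comm]
    refine Finset.sum_congr rfl fun l _ => ?_
    rw [← pair_coroot, pair_eq_sum b _ hf]
    push_cast
    rw [Finset.mul_sum]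
    refine Finset.sum_congr rfl fun j _ => ?_
    rw [pair_coroot]
    ring
  rw [h3]
  exact Finset.sum_nonneg fun j hj => mul_nonneg (by exact_mod_cast hf0.le j)
    ((key j).1 (hx j hj))

/-- If `x (u ρ)` is maximal, then `x ∘ u` is nonnegative on simple coroots. It is invariant under
`u⁻¹ w u`, which therefore preserves positivity of the simple roots and is trivial. -/
lemma eq_one_of_fixed_regular (b : P.Base) {x : Cowt P →+ ℝ} (hx : ∀ i, x (corootCowt i) ≠ 0)
    {w : P.weylGroup} (hw : ∀ y, x (w • y) = x y) : w = 1 := by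
  obtain ⟨ρ, hρ⟩ := exists_pair_eq_height P b
  obtain ⟨u, hu⟩ := Finite.exists_max fun u : P.weylGroup => x (u • ρ)
  have h1 : ∀ j ∈ b.support, 0 ≤ x.comp (DistribSMul.toAddMonoidHom (Cowt P) u) (corootCowt j) := by
    intro j hj
    have := hu (u * weylGroup.ofIdx P j)
    rw [mul_smul, ofIdx_smul_cowt, hρ, Base.height_one_of_mem_support hj, one_smul, smul_sub,
      map_sub] at this
    change 0 ≤ x (u • corootCowt j)
    linarith
  have h2 : u⁻¹ * w * u = 1 := by
    refine eq_one_of_isPos_smul b fun j => ?_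
    by_contra hn
    rw [← isPos_negIndex] at hn
    have h3 := nonneg_of_simple b h1 hn
    rw [corootCowt_negIndex, map_neg, ← smul_corootCowt] at h3
    change 0 ≤ -x (u • (u⁻¹ * w * u) • corootCowt (j : ι)) at h3
    rw [← mul_smul, ← mul_assoc, ← mul_assoc, mul_inv_cancel, one_mul, mul_smul, hw] at h3
    have h4 : 0 ≤ x (u • corootCowt (j : ι)) := h1 j j.2
    apply hx (u • (j : ι))
    rw [← smul_corootCowt]
    linarith
  have h3 : w = u * (u⁻¹ * w * u) * u⁻¹ := by group
  rw [h3, h2]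
  group

/-- The affine Weyl group `W_0 ⋉ Q` acts freely on its regular points. -/
lemma eq_one_of_integral (b : P.Base) {x : Cowt P →+ ℝ} (hx : ∀ i (n : ℤ), x (corootCowt i) ≠ n)
    {w : P.weylGroup} (hw : ∀ y, ∃ n : ℤ, x (w • y) - x y = n) : w = 1 := by
  obtain ⟨μ, hμ⟩ := exists_shift_abs_lt_one x hx
  set z : Cowt P →+ ℝ := x + (Int.castAddHom ℝ).comp μ with hz
  have hz' : ∀ y, z y = x y + μ y := fun y => rfl
  have hzw : ∀ y, ∃ n : ℤ, z (w • y) - z y = n := fun y => by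
    obtain ⟨n, hn⟩ := hw y
    refine ⟨n + μ (w • y) - μ y, ?_⟩
    rw [hz', hz']
    push_cast
    linarith
  choose ν hν using hzw
  let ν' : Cowt P →+ ℤ :=
    { toFun := ν
      map_zero' := by
        have := hν 0
        rw [smul_zero, sub_self] at this
        exact_mod_cast this.symm
      map_add' := fun y y' => by
        have h1 := hν (y + y')
        rw [smul_add, map_add, map_add] at h1
        have h2 : (ν (y + y') : ℝ) = ν y + ν y' := by rw [← h1, ← hν, ← hν]; ring
        exact_mod_cast h2 }
  have hν' : ∀ y, z (w • y) - z y = ν' y := hν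
  obtain ⟨l, hl⟩ := exists_list_sum_rootHom b ν'
  -- All values of `z` on coroots lie strictly between `-1` and `1`, so the integral difference `ν'`
  -- takes values of absolute value at most `1` on them. Being in the root lattice, it vanishes, and
  -- `z` is a regular point fixed by `w`.
  have h0 : ν' = 0 := by
    rw [← hl]
    apply eq_zero_of_abs_le_one
    intro i
    rw [hl]
    have h1 := hν' (corootCowt i)
    rw [smul_corootCowt] at h1
    have h2 := hμ i
    have h3 := hμ (w • i)
    rw [← hz', abs_lt] at h2 h3
    have h4 : |(ν' (corootCowt i) : ℝ)| < 2 := by rw [← h1, abs_lt]; constructor <;> linarith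
    have h5 : |ν' (corootCowt i)| < 2 := by exact_mod_cast h4
    omega
  refine eq_one_of_fixed_regular b (x := z) (fun i h => ?_) fun y => ?_
  · apply hx i (-μ (corootCowt i))
    rw [hz'] at h
    push_cast
    linarith
  · have := hν' y
    rw [h0] at this
    simpa [sub_eq_zero] using this

/-- Each `i` with `c i ≠ 0` and each integer exclude at most one `t`, so only countably many are
excluded. -/
lemma exists_avoid_integers (a c : ι → ℝ) : ∃ t : ℝ, ∀ i (n : ℤ), a i + t * c i = n → c i = 0 := by
  have hc : (⋃ (i : ι) (n : ℤ), {t : ℝ | a i + t * c i = n ∧ c i ≠ 0}).Countable := by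
    refine Set.countable_iUnion fun i => Set.countable_iUnion fun n =>
      Set.Subsingleton.countable ?_
    rintro t ⟨h1, h2⟩ t' ⟨h3, -⟩
    exact mul_right_cancel₀ h2 (by linarith)
  obtain ⟨t, ht⟩ := (hc.dense_compl ℝ).nonempty
  refine ⟨t, fun i n h => ?_⟩
  by_contra hne
  exact ht (Set.mem_iUnion₂.2 ⟨i, n, h, hne⟩)

lemma exists_log (b : P.Base) (δ : Torus P) : ∃ Z : Cowt P →+ ℂ, ∀ x, Complex.exp (Z x) = tpow δ x := by
  obtain ⟨ω, hω⟩ := exists_fundamental b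
  let Z : Cowt P →+ ℂ :=
    { toFun := fun x => ∑ j : b.support, (pair x j : ℂ) * Complex.log (tpow δ (ω j))
      map_zero' := by simp
      map_add' := fun x y => by simp [add_mul, Finset.sum_add_distrib] }
  refine ⟨Z, fun x => ?_⟩
  have h1 : Z x = ∑ j : b.support, (pair x j : ℂ) * Complex.log (tpow δ (ω j)) := rfl
  rw [h1, Complex.exp_sum]
  conv_rhs => rw [hω x]
  have h2 : ∀ s : Finset b.support, tpow δ (∑ j ∈ s, pair x j • ω j) =
      ∏ j ∈ s, tpow δ (pair x j • ω j) := fun s => by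
    classical
    induction s using Finset.induction_on with
    | empty => simp
    | insert j s hj ih => rw [Finset.sum_insert hj, Finset.prod_insert hj, tpow_add, ih]
  rw [h2]
  refine Finset.prod_congr rfl fun j _ => ?_
  rw [Complex.exp_int_mul, Complex.exp_log (tpow_ne_zero _ _)]
  simp [tpow, ofAdd_zsmul]

/-- Obtained by averaging over the reflection in `α_i`. It shows that `∑ ht(α) α` is strictly
positive on positive coroots. -/
lemma sum_height_mul_pairingIn (i : ι) :
    2 * ∑ l, b.height l * P.pairingIn ℤ l i = b.height i * ∑ l, P.pairingIn ℤ l i ^ 2 := by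
  obtain ⟨ρ, hρ⟩ := exists_pair_eq_height P b
  have h1 : ∑ l, b.height l * P.pairingIn ℤ l i = ∑ l, b.height (P.reflectionPerm i l) *
      P.pairingIn ℤ (P.reflectionPerm i l) i :=
    (Equiv.sum_comp (P.reflectionPerm i) fun l => b.height l * P.pairingIn ℤ l i).symm
  have h2 : ∀ l, b.height (P.reflectionPerm i l) * P.pairingIn ℤ (P.reflectionPerm i l) i =
      -(b.height l * P.pairingIn ℤ l i) + b.height i * P.pairingIn ℤ l i ^ 2 := fun l => by
    rw [← hρ, ← hρ, ← hρ, pair_reflectionPerm]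
    have h3 : P.pairingIn ℤ (P.reflectionPerm i l) i = -P.pairingIn ℤ l i := by
      rw [← pair_coroot, pair_reflectionPerm, pair_coroot, pair_coroot, pairingIn_same]
      ring
    rw [h3]
    ring
  rw [Finset.sum_congr rfl fun l _ => h2 l, Finset.sum_add_distrib, Finset.sum_neg_distrib,
    ← Finset.mul_sum] at h1
  linarith

/-- If `w ∈ W_0^J` fixes a point `δ` of the torus, and no root outside of `R_0^J` takes the value
`1` at `δ`, then `w = 1`. -/
theorem eq_one_of_torusAct_eq {δ : Torus P} {J : Set b.support} {w : P.weylGroup}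
    (hw : w ∈ minReps b J) (hfix : torusAct w δ = δ)
    (hreg : ∀ i, b.IsPos i → i ∉ parabolicRoots b J → tpow δ (corootCowt i) ≠ 1) : w = 1 := by
  obtain ⟨Z, hZ⟩ := exists_log b δ
  have hδw : ∀ x, tpow δ (w • x) = tpow δ x := fun x => by
    conv_rhs => rw [← inv_smul_smul w x, ← tpow_torusAct, hfix]
  have hπ := Real.pi_pos
  have hZw : ∀ x, ∃ n : ℤ, Z (w • x) = Z x + n * (2 * Real.pi * Complex.I) := fun x => by
    rw [← Complex.exp_eq_exp_iff_exists_int, hZ, hZ, hδw]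
  have hZre : ∀ x, (Z (w • x)).re = (Z x).re := fun x => by
    obtain ⟨n, hn⟩ := hZw x
    simp [hn]
  have hZim : ∀ x, ∃ n : ℤ, (Z (w • x)).im / (2 * Real.pi) - (Z x).im / (2 * Real.pi) = n :=
    fun x => by
      obtain ⟨n, hn⟩ := hZw x
      refine ⟨n, ?_⟩
      simp only [hn, Complex.add_im, Complex.mul_im, Complex.mul_re, Complex.intCast_re,
        Complex.intCast_im, Complex.I_re, Complex.I_im, Complex.ofReal_re, Complex.ofReal_im,
        Complex.re_ofNat, Complex.im_ofNat]
      field_simp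
      ring
  -- A generic real combination of `Im Z / 2π` and `Re Z` takes integer values on a coroot only when
  -- `δ` is `1` there; `w` still changes it by integers.
  obtain ⟨t, ht⟩ := exists_avoid_integers
    (fun i => (Z (corootCowt i)).im / (2 * Real.pi)) fun i => (Z (corootCowt i)).re
  let y : Cowt P →+ ℝ :=
    { toFun := fun x => (Z x).im / (2 * Real.pi) + t * (Z x).re
      map_zero' := by simp
      map_add' := fun x x' => by simp; ring }
  have hyd : ∀ x, y x = (Z x).im / (2 * Real.pi) + t * (Z x).re := fun x => rfl
  have hy1 : ∀ i (n : ℤ), y (corootCowt i) = n → tpow δ (corootCowt i) = 1 := fun i n h => by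
    have h0 := ht i n h
    rw [hyd, h0, mul_zero, add_zero] at h
    rw [← hZ, Complex.exp_eq_one_iff]
    refine ⟨n, Complex.ext ?_ ?_⟩
    · simp [h0]
    · simp only [Complex.mul_im, Complex.mul_re, Complex.intCast_re,
        Complex.intCast_im, Complex.I_re, Complex.I_im, Complex.ofReal_re, Complex.ofReal_im,
        Complex.re_ofNat, Complex.im_ofNat]
      rw [← h]
      field_simp
      ring
  let p₀ : Cowt P →+ ℝ :=
    { toFun := fun x => ((∑ l, b.height l * pair x l : ℤ) : ℝ)
      map_zero' := by simp
      map_add' := fun x x' => by simp [mul_add, Finset.sum_add_distrib] }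
  have hp₀ : ∀ i, b.IsPos i → 0 < p₀ (corootCowt i) := fun i hi => by
    change 0 < ((∑ l, b.height l * pair (corootCowt i) l : ℤ) : ℝ)
    rw [Int.cast_pos]
    simp_rw [pair_coroot]
    have h1 := sum_height_mul_pairingIn b i
    have h2 : 0 < ∑ l, P.pairingIn ℤ l i ^ 2 := by
      refine Finset.sum_pos' (fun l _ => sq_nonneg _) ⟨i, Finset.mem_univ _, ?_⟩
      rw [pairingIn_same]; norm_num
    have h3 : 0 < b.height i := hi
    nlinarith [mul_pos h3 h2]
  -- The sum over the cyclic group of `w` makes `p` invariant. It stays positive on the positive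
  -- coroots where `δ` is `1`: such roots lie in `R_0^J`, where `w` preserves positivity, so their
  -- whole `w`-orbit is positive.
  let p : Cowt P →+ ℝ := ∑ j ∈ Finset.range (orderOf w),
    p₀.comp (DistribSMul.toAddMonoidHom (Cowt P) (w ^ j))
  have hpd : ∀ x, p x = ∑ j ∈ Finset.range (orderOf w), p₀ (w ^ j • x) := fun x => by
    rw [AddMonoidHom.finsetSum_apply]; rfl
  have hpw : ∀ x, p (w • x) = p x := fun x => by
    rw [hpd, hpd]
    have h1 := Finset.sum_range_succ (fun j => p₀ (w ^ j • x)) (orderOf w)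
    rw [Finset.sum_range_succ', pow_orderOf_eq_one, pow_zero] at h1
    rw [← add_right_cancel h1]
    exact Finset.sum_congr rfl fun j _ => by rw [pow_succ, mul_smul]
  have hppos : ∀ i, b.IsPos i → tpow δ (corootCowt i) = 1 → 0 < p (corootCowt i) := by
    intro i hi h1
    have h2 : ∀ j : ℕ, b.IsPos (w ^ j • i) ∧ tpow δ (corootCowt (w ^ j • i)) = 1 := by
      intro j
      induction j with
      | zero => rw [pow_zero, one_smul]; exact ⟨hi, h1⟩
      | succ j ih =>
        rw [pow_succ', mul_smul, ← smul_corootCowt, hδw]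
        refine ⟨isPos_smul_of_mem_parabolicRoots b hw ?_ ih.1, ih.2⟩
        by_contra hn
        exact hreg _ ih.1 hn ih.2
    rw [hpd]
    refine Finset.sum_pos (fun j _ => ?_) (Finset.nonempty_range_iff.2 (orderOf_pos w).ne')
    rw [smul_corootCowt]
    exact hp₀ _ (h2 j).1
  -- A generic multiple of `p` removes the remaining integral values without affecting the
  -- integrality of the change under `w`.
  obtain ⟨ε, hε⟩ := exists_avoid_integers (fun i => y (corootCowt i)) fun i => p (corootCowt i)
  let x : Cowt P →+ ℝ :=
    { toFun := fun x => y x + ε * p x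
      map_zero' := by simp
      map_add' := fun x x' => by simp; ring }
  have hxd : ∀ z, x z = y z + ε * p z := fun z => rfl
  refine eq_one_of_integral b (x := x) (fun i n h => ?_) fun z => ?_
  · have h0 := hε i n h
    rw [hxd, h0, mul_zero, add_zero] at h
    have h1 := hy1 i n h
    by_cases hi : b.IsPos i
    · exact (hppos i hi h1).ne' h0
    · have := hppos _ ((isPos_negIndex b i).2 hi) (by rw [corootCowt_negIndex, tpow_neg, h1, inv_one])
      rw [corootCowt_negIndex, map_neg, h0] at this
      simp at this
  · obtain ⟨n, hn⟩ := hZim z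
    refine ⟨n, ?_⟩
    rw [hxd, hxd, hpw, hyd, hyd, hZre, ← hn]
    ring

end Regularity

/-! ### Parabolic subgroups and the representative `w̄_0` -/

section Parabolic

variable {P : RootPairing ι ℝ M N} [P.IsCrystallographic] (b : P.Base) [Fintype ι] [Nonempty ι]
  [P.IsReduced] [P.IsIrreducible]

variable {b}

lemma mem_parabolicRoots_iff {J : Set b.support} {i : ι} : i ∈ parabolicRoots b J ↔
    P.root i ∈ AddSubgroup.closure ((fun j : b.support => P.root j) '' J) := Iff.rfl

lemma mem_parabolicRoots_of_mem {J : Set b.support} {j : b.support} (hj : j ∈ J) :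
    (j : ι) ∈ parabolicRoots b J := AddSubgroup.subset_closure ⟨j, hj, rfl⟩

lemma negIndex_mem_parabolicRoots {J : Set b.support} {i : ι} :
    P.reflectionPerm i i ∈ parabolicRoots b J ↔ i ∈ parabolicRoots b J := by
  rw [mem_parabolicRoots_iff, mem_parabolicRoots_iff, root_negIndex, neg_mem_iff]

lemma simpleRefl₀_smul_mem_parabolicRoots {J : Set b.support} {j : b.support} (hj : j ∈ J) {i : ι}
    (hi : i ∈ parabolicRoots b J) : simpleRefl₀ b j • i ∈ parabolicRoots b J := by
  rw [mem_parabolicRoots_iff, simpleRefl₀_smul, root_reflectionPerm_eq]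
  exact sub_mem hi (AddSubgroup.zsmul_mem _ (mem_parabolicRoots_of_mem hj) _)

lemma smul_mem_parabolicRoots_iff {J : Set b.support} {x : P.weylGroup} (hx : x ∈ parabolic b J)
    (i : ι) : x • i ∈ parabolicRoots b J ↔ i ∈ parabolicRoots b J := by
  induction hx using Subgroup.closure_induction generalizing i with
  | mem x h =>
    obtain ⟨j, hj, rfl⟩ := h
    refine ⟨fun h => ?_, simpleRefl₀_smul_mem_parabolicRoots hj⟩
    have := simpleRefl₀_smul_mem_parabolicRoots hj h
    rwa [← mul_smul, simpleRefl₀_mul_self, one_smul] at this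
  | one => rw [one_smul]
  | mul x y _ _ hx hy => rw [mul_smul, hx, hy]
  | inv x _ hx => rw [← hx, smul_inv_smul]

lemma isPos_smul_iff_of_notMem {J : Set b.support} {x : P.weylGroup} (hx : x ∈ parabolic b J)
    {i : ι} (hi : i ∉ parabolicRoots b J) : b.IsPos (x • i) ↔ b.IsPos i := by
  induction hx using Subgroup.closure_induction generalizing i with
  | mem x h =>
    obtain ⟨j, hj, rfl⟩ := h
    have key : ∀ i, i ∉ parabolicRoots b J → b.IsPos i → b.IsPos (simpleRefl₀ b j • i) :=
      fun i hi hp => isPos_simpleRefl₀_of_ne b hp fun h => hi (h ▸ mem_parabolicRoots_of_mem hj)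
    refine ⟨fun h => ?_, key i hi⟩
    have := key _ (fun h' => hi ((smul_mem_parabolicRoots_iff
      (Subgroup.subset_closure ⟨j, hj, rfl⟩) i).1 h')) h
    rwa [← mul_smul, simpleRefl₀_mul_self, one_smul] at this
  | one => rw [one_smul]
  | mul x y hx' hy' hx hy =>
    rw [mul_smul, hx fun h => hi ((smul_mem_parabolicRoots_iff hy' i).1 h), hy hi]
  | inv x hx' hx =>
    rw [← hx, smul_inv_smul]
    exact fun h => hi ((smul_mem_parabolicRoots_iff (inv_mem hx') i).1 h)

lemma isPos_smul_iff_of_mem {J : Set b.support} {w : P.weylGroup} (hw : w ∈ minReps b J) {i : ι}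
    (hi : i ∈ parabolicRoots b J) : b.IsPos (w • i) ↔ b.IsPos i := by
  refine ⟨fun h => ?_, isPos_smul_of_mem_parabolicRoots b hw hi⟩
  by_contra hn
  have := isPos_smul_of_mem_parabolicRoots b hw (negIndex_mem_parabolicRoots.2 hi)
    ((isPos_negIndex b i).2 hn)
  rw [smul_negIndex, isPos_negIndex] at this
  exact this h

/-- The quotient `t⁻¹ u` preserves positivity: on `R_0^J` because both `u` and `t` do, and off
`R_0^J` because elements of `W_{0,J}` do. -/
lemma eq_of_mem_minReps {J : Set b.support} {u t : P.weylGroup} (hu : u ∈ minReps b J)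
    (ht : t ∈ minReps b J) (h : t⁻¹ * u ∈ parabolic b J) : u = t := by
  have h1 : t⁻¹ * u = 1 := by
    refine eq_one_of_isPos_smul b fun j => ?_
    have hj : b.IsPos (j : ι) := Base.isPos_of_mem_support j.2
    by_cases hJ : (j : ι) ∈ parabolicRoots b J
    · rw [← isPos_smul_iff_of_mem ht ((smul_mem_parabolicRoots_iff h _).2 hJ), ← mul_smul,
        mul_inv_cancel_left, isPos_smul_iff_of_mem hu hJ]
      exact hj
    · rwa [isPos_smul_iff_of_notMem h hJ]
  rw [inv_mul_eq_one] at h1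
  exact h1.symm

lemma minRep_spec (I : Set b.support) (w : P.weylGroup) :
    minRep b I w ∈ minReps b I ∧ (minRep b I w)⁻¹ * w ∈ parabolic b I := by
  refine Classical.epsilon_spec (p := fun u => u ∈ minReps b I ∧ u⁻¹ * w ∈ parabolic b I) ?_
  have : Nonempty {u : P.weylGroup // u⁻¹ * w ∈ parabolic b I} := ⟨⟨w, by simp⟩⟩
  obtain ⟨⟨u, hu⟩, hmin⟩ := Finite.exists_min
    fun u : {u : P.weylGroup // u⁻¹ * w ∈ parabolic b I} => length₀ b u.1
  refine ⟨u, fun i hi => ?_, hu⟩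
  have h1 := hmin ⟨u * simpleRefl₀ b i, by
    rw [mul_inv_rev, mul_assoc]
    exact mul_mem (inv_mem (Subgroup.subset_closure ⟨i, hi, rfl⟩)) hu⟩
  simp only at h1
  by_cases hp : b.IsPos (u • (i : ι))
  · rw [length₀_mul_simpleRefl₀ b hp]; omega
  · rw [length₀_mul_simpleRefl₀_of_neg b hp] at h1; omega

lemma not_isPos_longest_smul {i : ι} (hi : b.IsPos i) : ¬ b.IsPos (longest b • i) := by
  have hmax : ∀ u, length₀ b u ≤ length₀ b (longest b) :=
    (Finite.exists_max (length₀ b)).choose_spec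
  have hs : ∀ j : b.support, ¬ b.IsPos (longest b • (j : ι)) := fun j hj => by
    have := hmax (longest b * simpleRefl₀ b j)
    rw [length₀_mul_simpleRefl₀ b hj] at this
    omega
  obtain ⟨ρ, hρ⟩ := exists_pair_eq_height P b
  have h1 : 0 < pair (-((longest b)⁻¹ • ρ)) i := by
    refine pair_pos_of_isPos b (fun j hj => ?_) hi
    have h2 := hs ⟨j, hj⟩
    rw [← isPos_negIndex, Base.isPos_iff, ← hρ, pair_negIndex] at h2
    rw [pair_neg, pair_smul, inv_inv]
    exact h2
  rw [pair_neg, pair_smul, inv_inv, hρ] at h1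
  rw [Base.isPos_iff]
  omega

/-- The element `w̄_0` is `w_0` times an element of `W_{0,I}`, and the latter preserves positivity
off `R_0^I`. -/
lemma isPos_minRep_longest_smul_iff (I : Set b.support) {i : ι} (hi : b.IsPos i) :
    b.IsPos (minRep b I (longest b) • i) ↔ i ∈ parabolicRoots b I := by
  obtain ⟨h1, h2⟩ := minRep_spec I (longest b)
  by_cases hI : i ∈ parabolicRoots b I
  · simp only [hI, iff_true]
    exact isPos_smul_of_mem_parabolicRoots b h1 hI hi
  · simp only [hI, iff_false]
    set t := minRep b I (longest b)
    have h3 : t = longest b * (t⁻¹ * longest b)⁻¹ := by group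
    rw [h3, mul_smul]
    exact not_isPos_longest_smul ((isPos_smul_iff_of_notMem (inv_mem h2) hI).2 hi)

/-- If the image of `α_i` were not simple, it would be a sum of two positive roots. Their preimages
under `w̄_0` add up to `α_i`, and each is positive exactly when it lies in `R_0^I`; so both are
positive or both negative. Their heights then cannot add up to `1`. -/
lemma exists_minRep_longest_smul_eq {I : Set b.support} {i : b.support} (hi : i ∈ I) :
    ∃ j : b.support, minRep b I (longest b) • (i : ι) = j := by
  set t := minRep b I (longest b) with ht
  have hpos : b.IsPos (t • (i : ι)) :=
    (isPos_minRep_longest_smul_iff I (Base.isPos_of_mem_support i.2)).2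
      (mem_parabolicRoots_of_mem hi)
  obtain ⟨j, hj, hj0⟩ := hpos.exists_mem_support_pos_pairingIn
  by_cases hne : t • (i : ι) = j
  · exact ⟨⟨j, hj⟩, hne⟩
  exfalso
  obtain ⟨l, hl⟩ := P.root_sub_root_mem_of_pairingIn_pos ((P.zero_lt_pairingIn_iff' ℤ).1 hj0) hne
  have hlpos : b.IsPos l := by
    rw [Base.isPos_iff']
    have h1 := b.height_add (i := l) (j := j) (k := t • (i : ι)) (by rw [hl]; abel)
    rw [Base.isPos_iff, h1, Base.height_one_of_mem_support hj] at hpos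
    omega
  have hjpos : b.IsPos j := Base.isPos_of_mem_support hj
  have hsum : P.root i = P.root (t⁻¹ • l) + P.root (t⁻¹ • j) := by
    rw [root_smul, root_smul, hl, ← smul_add, sub_add_cancel, root_smul, inv_smul_smul]
  have hht := b.height_add hsum
  rw [Base.height_one_of_mem_support i.2] at hht
  have key : ∀ m, b.IsPos m → (b.IsPos (t⁻¹ • m) ↔ t⁻¹ • m ∈ parabolicRoots b I) := by
    intro m hm
    by_cases h1 : b.IsPos (t⁻¹ • m)
    · rw [← isPos_minRep_longest_smul_iff I h1, smul_inv_smul]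
      simp [h1, hm]
    · simp only [h1, false_iff]
      intro h2
      have h3 := isPos_minRep_longest_smul_iff I ((isPos_negIndex b _).2 h1)
      rw [negIndex_mem_parabolicRoots, smul_negIndex, isPos_negIndex, smul_inv_smul] at h3
      exact h3.2 h2 hm
  have hI : t⁻¹ • l ∈ parabolicRoots b I ↔ t⁻¹ • j ∈ parabolicRoots b I := by
    have h0 : P.root i ∈ AddSubgroup.closure ((fun j : b.support => P.root j) '' I) :=
      mem_parabolicRoots_of_mem hi
    rw [mem_parabolicRoots_iff, mem_parabolicRoots_iff]
    constructor <;> intro h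
    · have : P.root (t⁻¹ • j) = P.root i - P.root (t⁻¹ • l) := by rw [hsum]; abel
      rw [this]; exact sub_mem h0 h
    · have : P.root (t⁻¹ • l) = P.root i - P.root (t⁻¹ • j) := by rw [hsum]; abel
      rw [this]; exact sub_mem h0 h
  rw [← key l hlpos, ← key j hjpos, Base.isPos_iff, Base.isPos_iff] at hI
  omega

lemma minRep_longest_inv_mem (I : Set b.support) :
    (minRep b I (longest b))⁻¹ ∈ minReps b (dualSet b I) := by
  rw [mem_minReps_iff]
  rintro j ⟨i, -, hij⟩
  rw [← hij, inv_smul_smul]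
  exact Base.isPos_of_mem_support i.2

/-- The inverse of `w̄_0` maps the positive roots outside of `R_0^{I^*}` to the negatives of the
positive roots outside of `R_0^I`. -/
lemma minRep_longest_inv_smul {I : Set b.support} {i : ι} (hi : b.IsPos i)
    (hi' : i ∉ parabolicRoots b (dualSet b I)) :
    ¬ b.IsPos ((minRep b I (longest b))⁻¹ • i) ∧
      (minRep b I (longest b))⁻¹ • i ∉ parabolicRoots b I := by
  set t := minRep b I (longest b) with ht
  have h1 : t⁻¹ • i ∉ parabolicRoots b I := by
    intro h
    apply hi'
    have key : ∀ m ∈ AddSubgroup.closure ((fun j : b.support => P.root j) '' I), t • m ∈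
        AddSubgroup.closure ((fun j : b.support => P.root j) '' dualSet b I) := by
      intro m hm
      induction hm using AddSubgroup.closure_induction with
      | mem m hm =>
        obtain ⟨j, hj, rfl⟩ := hm
        obtain ⟨l, hl⟩ := exists_minRep_longest_smul_eq hj
        simp only
        rw [← root_smul, hl]
        exact AddSubgroup.subset_closure ⟨l, ⟨j, hj, hl⟩, rfl⟩
      | zero => rw [smul_zero]; exact zero_mem _
      | add m n _ _ hm hn => rw [smul_add]; exact add_mem hm hn
      | neg m _ hm => rw [smul_neg]; exact neg_mem hm
    have := key _ h
    rw [root_smul, smul_inv_smul] at this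
    exact this
  refine ⟨fun h => h1 ?_, h1⟩
  rw [← isPos_minRep_longest_smul_iff I h, smul_inv_smul]
  exact hi

end Parabolic

/-! ### The scalars `ε_±(T_j)` -/

section Characters

variable {P : RootPairing ι ℝ M N} [P.IsCrystallographic] (b : P.Base) [Fintype ι] [Nonempty ι]
  [P.IsReduced] [P.IsIrreducible] (k : Mult P) (s : ℤˣ)

lemma epsScalar_ne_zero (a : AffRoot ι) : epsScalar k s a ≠ 0 :=
  mul_ne_zero (Int.cast_ne_zero.2 s.ne_zero) (zpow_ne_zero _ (Units.ne_zero _))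

/-- Either value `±k_a^{±1}` solves the same quadratic equation, which allows both signs to be
treated together. -/
lemma hParam_eq (a : AffRoot ι) : hParam k a = epsScalar k s a - (epsScalar k s a)⁻¹ := by
  rcases Int.units_eq_one_or s with rfl | rfl
  · simp [hParam, epsScalar]
  · simp [hParam, epsScalar, inv_neg]
    ring

lemma epsScalar_smul (w : P.weylGroup) (i : ι) :
    epsScalar k s (w • i, 0) = epsScalar k s (i, 0) := by
  have := k.2 (fin w) (i, 0)
  rw [act_fin] at this
  rw [epsScalar, epsScalar, this]

lemma eps_simple (j : b.support) :
    eps b k s (heckeT b k (simpleRefl b (some j))) = epsScalar k s ((j : ι), 0) :=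
  eps_simpleRefl b k s (some j)

lemma eps_heckeT_ne_zero (w : ExtWeyl P) : eps b k s (heckeT b k w) ≠ 0 :=
  ((isUnit_heckeT b k w).map (eps b k s)).ne_zero

end Characters

/-! ### Left multiplication on minimal coset representatives -/

section MinReps

variable {P : RootPairing ι ℝ M N} [P.IsCrystallographic] {b : P.Base} [Fintype ι] [Nonempty ι]
  [P.IsReduced] [P.IsIrreducible] (k : Mult P)

/-- If `s_i w` leaves `W_0^J`, then `s_i` makes some positive `w α_j`, `j ∈ J`, negative, and the
only such root is `α_i`. In that case `s_i w = w s_j`. -/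
lemma mem_minReps_or_exists {J : Set b.support} {w : P.weylGroup} (hw : w ∈ minReps b J)
    (i : b.support) : simpleRefl₀ b i * w ∈ minReps b J ∨ ∃ j ∈ J, w • (j : ι) = i := by
  rw [mem_minReps_iff] at hw ⊢
  by_contra! hcon
  obtain ⟨⟨j, hj, hneg⟩, hne⟩ := hcon
  rw [mul_smul] at hneg
  exact hneg (isPos_simpleRefl₀_of_ne b (hw j hj) (hne j hj))

lemma mem_minReps_of_mul {J : Set b.support} {w : P.weylGroup} {i : b.support}
    (hi : b.IsPos (w⁻¹ • (i : ι))) (h : simpleRefl₀ b i * w ∈ minReps b J) :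
    w ∈ minReps b J := by
  rcases mem_minReps_or_exists h i with h1 | ⟨j, hj, h1⟩
  · rwa [simpleRefl₀_mul_cancel] at h1
  · exfalso
    have h2 : w • (j : ι) = P.reflectionPerm i i := by
      rw [← simpleRefl₀_smul, ← h1, ← mul_smul, ← mul_assoc, simpleRefl₀_mul_self, one_mul]
    have h3 : (j : ι) = P.reflectionPerm (w⁻¹ • (i : ι)) (w⁻¹ • (i : ι)) := by
      rw [← smul_negIndex, ← h2, inv_smul_smul]
    have h4 : b.IsPos (j : ι) := Base.isPos_of_mem_support j.2
    rw [h3, isPos_negIndex] at h4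
    exact h4 hi

lemma heckeT_simple_mul_of_smul_eq {w : P.weylGroup} {i j : b.support} (h : w • (j : ι) = i) :
    heckeT b k (simpleRefl b (some i)) * heckeT b k (fin w) =
      heckeT b k (fin w) * heckeT b k (simpleRefl b (some j)) := by
  rw [heckeT_simpleRefl₀_mul, heckeT_mul_simpleRefl₀, mul_simpleRefl₀_of_smul_eq b h]
  · rw [h]; exact Base.isPos_of_mem_support i.2
  · rw [← h, inv_smul_smul]; exact Base.isPos_of_mem_support j.2

lemma symmetrizer_eq_sum (J : Set b.support) (s : ℤˣ) :
    symmetrizer b k J s = ∑ w ∈ (Set.toFinite (minReps b J)).toFinset,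
      eps b k s (heckeT b k (fin w)) • heckeT b k (fin w) :=
  finsum_mem_eq_finite_toFinset_sum _ _

end MinReps

/-! ### Symmetrizers, central characters and intertwiners -/

section Spherical

variable {P : RootPairing ι ℝ M N} [P.IsCrystallographic] {b : P.Base} [Fintype ι] [Nonempty ι]
  [P.IsReduced] [P.IsIrreducible] {k : Mult P} {s : ℤˣ} {L : Type*} [AddCommGroup L] [Module ℂ L]
  {ρ : Hecke b k →ₐ[ℂ] Module.End ℂ L}

lemma mem_spherical_iff {J : Set b.support} {v : L} : v ∈ spherical ρ J s ↔
    ∀ j ∈ J, ρ (heckeT b k (simpleRefl b (some j))) v = epsScalar k s ((j : ι), 0) • v := by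
  constructor
  · intro h j hj
    rw [← eps_simple]
    exact h _ (Algebra.subset_adjoin ⟨j, hj, rfl⟩)
  · intro h x hx
    induction hx using Algebra.adjoin_induction with
    | mem x hx =>
      obtain ⟨j, hj, rfl⟩ := hx
      simp only
      rw [h j hj, eps_simple]
    | algebraMap r => rw [AlgHom.commutes, AlgHom.commutes]; rfl
    | add x y _ _ hx hy => rw [map_add, map_add, add_smul, LinearMap.add_apply, hx, hy]
    | mul x y _ _ hx hy =>
      rw [map_mul, map_mul, Module.End.mul_apply, hy, map_smul, hx, smul_smul, mul_comm]

lemma mem_weightSpace_iff {δ : Torus P} {v : L} :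
    v ∈ weightSpace ρ δ ↔ ∀ f, ρ (fYHom b k f) v = evalAt δ f • v :=
  forall_congr' fun f => by rw [fY_eq]

lemma mem_centralSpace_iff {δ : Torus P} {v : L} :
    v ∈ centralSpace ρ δ ↔ ∀ f, IsInv f → ρ (fYHom b k f) v = evalAt δ f • v :=
  forall_congr' fun f => by rw [fY_eq]

/-- In `(T_i - ε(T_i)) C^J v` the summands of `w` and `s_i w` cancel by the quadratic relation. If
`s_i w` is not in `W_0^J`, then `T_i T_w = T_w T_j` with `j ∈ J`, and the summand vanishes because
`v` is `J`-spherical. -/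
lemma symmetrizer_mem_spherical {J : Set b.support} {v : L} (hv : v ∈ spherical ρ J s) :
    ρ (symmetrizer b k J s) v ∈ spherical ρ Set.univ s := by
  classical
  rw [mem_spherical_iff] at hv ⊢
  rintro i -
  set T := heckeT b k (simpleRefl b (some i)) with hT
  set e := epsScalar k s ((i : ι), 0) with he
  have he0 : e ≠ 0 := epsScalar_ne_zero k s _
  have heh : hParam k ((i : ι), 0) = e - e⁻¹ := hParam_eq k s _
  set X : P.weylGroup → L := fun w => ρ (eps b k s (heckeT b k (fin w)) •
    (T * heckeT b k (fin w) - e • heckeT b k (fin w))) v with hX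
  suffices h : ∑ w ∈ (Set.toFinite (minReps b J)).toFinset, X w = 0 by
    rw [← sub_eq_zero, ← h, symmetrizer_eq_sum, map_sum, LinearMap.sum_apply, map_sum,
      Finset.smul_sum, ← Finset.sum_sub_distrib]
    refine Finset.sum_congr rfl fun w _ => ?_
    simp only [hX, map_smul, map_sub, map_mul, LinearMap.smul_apply, LinearMap.sub_apply,
      Module.End.mul_apply, smul_sub]
    rw [smul_comm e]
  have hstay : ∀ w, (∃ j ∈ J, w • (j : ι) = i) → X w = 0 := by
    rintro w ⟨j, hj, hji⟩
    have h1 : epsScalar k s ((j : ι), 0) = e := by rw [he, ← hji, epsScalar_smul]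
    simp only [hX, hT]
    rw [heckeT_simple_mul_of_smul_eq k hji, map_smul, map_sub, map_mul, map_smul,
      LinearMap.smul_apply, LinearMap.sub_apply, Module.End.mul_apply, hv j hj, h1,
      LinearMap.smul_apply, map_smul, sub_self, smul_zero]
  have hpair : ∀ w, b.IsPos (w⁻¹ • (i : ι)) → X w + X (simpleRefl₀ b i * w) = 0 := by
    intro w hw
    have h1 := heckeT_simpleRefl₀_mul b k hw
    have h2 : ¬ b.IsPos ((simpleRefl₀ b i * w)⁻¹ • (i : ι)) := by
      rw [mul_inv_rev, simpleRefl₀_inv, mul_smul, simpleRefl₀_smul, smul_negIndex, isPos_negIndex]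
      exact not_not.2 hw
    have h3 := heckeT_simpleRefl₀_mul_of_neg b k h2
    rw [simpleRefl₀_mul_cancel] at h3
    have h4 : eps b k s (heckeT b k (fin (simpleRefl₀ b i * w))) =
        e * eps b k s (heckeT b k (fin w)) := by
      rw [← h1, map_mul, eps_simple]
    simp only [hX]
    rw [← LinearMap.add_apply, ← map_add, h4, h3, hT, h1, heh]
    have h5 : ∀ (c : ℂ) (x y : Hecke b k),
        c • (x - e • y) + (e * c) • ((e - e⁻¹) • x + y - e • x) = 0 := by
      intro c x y
      rw [smul_sub, smul_sub, smul_add, smul_smul, smul_smul, smul_smul]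
      have : e * c * (e - e⁻¹) = e * c * e - c := by field_simp
      rw [this, sub_smul, mul_comm c e]
      abel
    rw [h5, map_zero, LinearMap.zero_apply]
  refine Finset.sum_involution
    (fun w _ => if simpleRefl₀ b i * w ∈ minReps b J then simpleRefl₀ b i * w else w) ?_ ?_ ?_ ?_
  · intro w hw
    rw [Set.Finite.mem_toFinset] at hw
    split_ifs with h
    · by_cases hp : b.IsPos (w⁻¹ • (i : ι))
      · exact hpair w hp
      · have := hpair (simpleRefl₀ b i * w) (by
          rw [mul_inv_rev, simpleRefl₀_inv, mul_smul, simpleRefl₀_smul, smul_negIndex,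
            isPos_negIndex]
          exact hp)
        rwa [simpleRefl₀_mul_cancel, add_comm] at this
    · have := hstay w ((mem_minReps_or_exists hw i).resolve_left h)
      rw [this, add_zero]
  · intro w hw hne
    rw [Set.Finite.mem_toFinset] at hw
    split_ifs with h
    · intro h'
      have h1 : simpleRefl₀ b i = 1 := by simpa using h'
      have h2 := length₀_mul_simpleRefl₀ b (w := 1) (j := i) (by
        rw [one_smul]; exact Base.isPos_of_mem_support i.2)
      rw [h1, mul_one] at h2
      omega
    · exact absurd (hstay w ((mem_minReps_or_exists hw i).resolve_left h)) hne
  · intro w hw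
    rw [Set.Finite.mem_toFinset] at hw ⊢
    split_ifs with h
    · exact h
    · exact hw
  · intro w hw
    rw [Set.Finite.mem_toFinset] at hw
    by_cases h : simpleRefl₀ b i * w ∈ minReps b J
    · simp only [h, if_true, simpleRefl₀_mul_cancel, hw]
    · simp only [h, if_false]

lemma rexp_neg_coroot_ne_one (i : ι) : (1 : Reg P) - rexp (-corootCowt i) ≠ 0 := by
  intro h
  rw [sub_eq_zero, ← rexp_zero] at h
  have h1 : (0 : Cowt P) = -corootCowt i := by
    have h2 := congrArg (fun f : Reg P => f.coeff) h
    simp only [rexp, AddMonoidAlgebra.coeff_single] at h2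
    exact (Finsupp.single_left_inj one_ne_zero).1 h2
  exact corootCowt_ne_zero i (by simpa using h1.symm)

/-- For invariant `f` the correction term in the Bernstein relation is zero, because `1 -
e^{-α_i^∨}` is not a zero divisor. -/
lemma fYHom_commute_of_isInv {f : Reg P} (hf : IsInv f) (w : P.weylGroup) :
    heckeT b k (fin w) * fYHom b k f = fYHom b k f * heckeT b k (fin w) := by
  induction w using weyl_induction b with
  | h0 => rw [fin_one, heckeT_one, one_mul, mul_one]
  | h1 j w hj ih =>
    obtain ⟨g, h1, h2⟩ := bernstein b k j f
    rw [(isInv_iff f).1 hf, sub_self, eq_comm, mul_eq_zero] at h1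
    rw [h1.resolve_left (rexp_neg_coroot_ne_one _), (isInv_iff f).1 hf, map_zero, smul_zero,
      add_zero] at h2
    rw [← heckeT_simpleRefl₀_mul b k hj, mul_assoc, ih, ← mul_assoc, h2, mul_assoc]

lemma evalAt_torusAct_of_isInv {f : Reg P} (hf : IsInv f) (w : P.weylGroup) (δ : Torus P) :
    evalAt (torusAct w δ) f = evalAt δ f := by
  rw [evalAt_torusAct, (isInv_iff f).1 hf]

lemma centralSpace_torusAct (w : P.weylGroup) (δ : Torus P) :
    centralSpace ρ (torusAct w δ) = centralSpace ρ δ := by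
  ext v
  rw [mem_centralSpace_iff, mem_centralSpace_iff]
  exact forall_congr' fun f => forall_congr' fun hf => by rw [evalAt_torusAct_of_isInv hf]

lemma symmetrizer_mem_centralSpace {J : Set b.support} {δ : Torus P} {v : L}
    (hv : v ∈ weightSpace ρ δ) : ρ (symmetrizer b k J s) v ∈ centralSpace ρ δ := by
  rw [mem_centralSpace_iff]
  intro f hf
  rw [mem_weightSpace_iff] at hv
  have h1 : fYHom b k f * symmetrizer b k J s = symmetrizer b k J s * fYHom b k f := by
    rw [symmetrizer_eq_sum, Finset.mul_sum, Finset.sum_mul]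
    refine Finset.sum_congr rfl fun w _ => ?_
    rw [mul_smul_comm, smul_mul_assoc, fYHom_commute_of_isInv hf]
  rw [← Module.End.mul_apply, ← map_mul, h1, map_mul, Module.End.mul_apply, hv f, map_smul]

/-- The annihilator in `ℂ[T]` of a spherical vector, transported along intertwiners. -/
lemma exists_annihilator {J : Set b.support} {δ : Torus P} {ψ : L}
    (hψ : ψ ∈ spherical ρ Set.univ s)
    (hne : ∀ i, b.IsPos i → i ∉ parabolicRoots b J →
      tpow δ (corootCowt i) ≠ (epsScalar k s (i, 0) ^ 2)⁻¹)
    (h1 : ∃ f, ρ (fYHom b k f) ψ = 0 ∧ evalAt δ f ≠ 0) (w : P.weylGroup) (hw : w ∈ minReps b J) :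
    ∃ f, ρ (fYHom b k f) ψ = 0 ∧ evalAt (torusAct w δ) f ≠ 0 := by
  rw [mem_spherical_iff] at hψ
  induction w using weyl_induction b with
  | h0 => rwa [torusAct_one]
  | h1 i w hi ih =>
    obtain ⟨f, hf, hf1⟩ := ih (mem_minReps_of_mul hi hw)
    set e := epsScalar k s ((i : ι), 0) with he
    have he0 : e ≠ 0 := epsScalar_ne_zero k s _
    have heh : hParam k ((i : ι), 0) = e - e⁻¹ := hParam_eq k s _
    set n : Reg P := algebraMap ℂ _ e⁻¹ - algebraMap ℂ _ e * rexp (-corootCowt (i : ι)) with hn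
    have hint : ρ (intertwiner b k i) ψ = ρ (fYHom b k n) ψ := by
      have h2 : n = e • (1 - rexp (-corootCowt (i : ι))) - algebraMap ℂ _ (e - e⁻¹) := by
        rw [hn, smul_sub, map_sub, Algebra.smul_def, Algebra.smul_def]
        ring
      rw [h2, intertwiner]
      generalize (1 : Reg P) - rexp (-corootCowt (i : ι)) = d
      rw [map_sub, map_mul, LinearMap.sub_apply, Module.End.mul_apply, hψ i (Set.mem_univ _),
        map_smul, heh, map_sub (fYHom b k), map_smul, map_sub ρ, map_smul, LinearMap.sub_apply,
        LinearMap.smul_apply, AlgHom.commutes (fYHom b k)]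
    -- Applying the intertwiner to `f(Y) ψ = 0` turns `f` into `s_i f` and contributes the factor
    -- `n`. At `s_i w δ` the first factor is `f(wδ)`, and `n` is `e⁻¹ - e δ^β` with `β = (w⁻¹
    -- α_i)^∨`, which is nonzero since `w⁻¹ α_i` is positive and outside `R_0^J`.
    refine ⟨regW (simpleRefl₀ b i) f * n, ?_, ?_⟩
    · rw [map_mul, map_mul, Module.End.mul_apply, ← hint, ← Module.End.mul_apply, ← map_mul,
        ← intertwiner_mul, map_mul, Module.End.mul_apply, hf, map_zero]
    · rw [map_mul]
      refine mul_ne_zero ?_ ?_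
      · rwa [torusAct_mul, evalAt_torusAct, simpleRefl₀_inv, ← regW_mul, simpleRefl₀_mul_self,
          regW_one]
      · have h3 : w⁻¹ • (i : ι) ∉ parabolicRoots b J := by
          intro h
          have := isPos_smul_of_mem_parabolicRoots b hw h hi
          rw [mul_smul, smul_inv_smul, simpleRefl₀_smul, isPos_negIndex] at this
          exact this (Base.isPos_of_mem_support i.2)
        have h4 := hne _ hi h3
        rw [epsScalar_smul, ← he] at h4
        have h5 : tpow (torusAct (simpleRefl₀ b i * w) δ) (-corootCowt (i : ι)) =
            tpow δ (corootCowt (w⁻¹ • (i : ι))) := by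
          rw [tpow_torusAct, mul_inv_rev, simpleRefl₀_inv, mul_smul, smul_neg, smul_corootCowt,
            simpleRefl₀_smul, corootCowt_negIndex, neg_neg, smul_corootCowt]
        rw [hn, map_sub, map_mul, AlgHom.commutes, AlgHom.commutes, evalAt_rexp, h5]
        intro h6
        apply h4
        simp only [Algebra.algebraMap_self, RingHom.id_apply] at h6
        field_simp
        field_simp at h6
        linear_combination -h6

end Spherical

/-! ### Triangularity in the universal eigenvector module -/

section Universal

variable {P : RootPairing ι ℝ M N} [P.IsCrystallographic] {b : P.Base} [Fintype ι] [Nonempty ι]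
  [P.IsReduced] [P.IsIrreducible] (k : Mult P) (s : ℤˣ) (J : Set b.support) (δ : Torus P)

/-- The left ideal of `H(k)` generated by the `T_j - ε(T_j)`, `j ∈ J`, and the `f(Y) - f(δ)`. -/
def eigenIdeal : Submodule (Hecke b k) (Hecke b k) :=
  Submodule.span (Hecke b k)
    ({x | ∃ j ∈ J, x = heckeT b k (simpleRefl b (some j)) -
      algebraMap ℂ _ (epsScalar k s ((j : ι), 0))} ∪
      Set.range fun f : Reg P => fYHom b k f - algebraMap ℂ _ (evalAt δ f))

variable {k s J δ}

lemma mul_simple_sub_mem_eigenIdeal (x : Hecke b k) {j : b.support} (hj : j ∈ J) :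
    x * heckeT b k (simpleRefl b (some j)) - epsScalar k s ((j : ι), 0) • x ∈
      eigenIdeal k s J δ := by
  have h := Submodule.smul_mem (eigenIdeal k s J δ) x
    (Submodule.subset_span (Or.inl ⟨j, hj, rfl⟩))
  rwa [smul_eq_mul, mul_sub, ← Algebra.commutes, ← Algebra.smul_def] at h

lemma mul_fYHom_sub_mem_eigenIdeal (x : Hecke b k) (f : Reg P) :
    x * fYHom b k f - evalAt δ f • x ∈ eigenIdeal k s J δ := by
  have h := Submodule.smul_mem (eigenIdeal k s J δ) x
    (Submodule.subset_span (Or.inr ⟨f, rfl⟩))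
  rwa [smul_eq_mul, mul_sub, ← Algebra.commutes, ← Algebra.smul_def] at h

lemma apply_eq_zero_of_mem_eigenIdeal {L : Type*} [AddCommGroup L] [Module ℂ L]
    {ρ : Hecke b k →ₐ[ℂ] Module.End ℂ L} {v : L} (hv : v ∈ spherical ρ J s)
    (hv' : v ∈ weightSpace ρ δ) {x : Hecke b k} (hx : x ∈ eigenIdeal k s J δ) : ρ x v = 0 := by
  rw [mem_spherical_iff] at hv
  rw [mem_weightSpace_iff] at hv'
  have hc : ∀ c : ℂ, ρ (algebraMap ℂ _ c) v = c • v := fun c => by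
    rw [AlgHom.commutes]; rfl
  induction hx using Submodule.span_induction with
  | mem x h =>
    rcases h with ⟨j, hj, rfl⟩ | ⟨f, rfl⟩
    · rw [map_sub, LinearMap.sub_apply, hv j hj, hc, sub_self]
    · simp only
      rw [map_sub, LinearMap.sub_apply, hv' f, hc, sub_self]
  | zero => rw [map_zero, LinearMap.zero_apply]
  | add x y _ _ hx hy => rw [map_add, LinearMap.add_apply, hx, hy, add_zero]
  | smul a x _ hx => rw [smul_eq_mul, map_mul, Module.End.mul_apply, hx, map_zero]

variable (k s J δ)

/-- The span of the left ideal `eigenIdeal` and the `T_u`, `u ∈ W_0^J`, `l(u) < m`. -/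
def lengthFilt (m : ℕ) : Submodule ℂ (Hecke b k) :=
  Submodule.span ℂ {x | ∃ u ∈ minReps b J, length₀ b u < m ∧ x = heckeT b k (fin u)} ⊔
    (eigenIdeal k s J δ).restrictScalars ℂ

variable {k s J δ}

lemma lengthFilt_mono {m n : ℕ} (h : m ≤ n) : lengthFilt k s J δ m ≤ lengthFilt k s J δ n := by
  refine sup_le_sup_right (Submodule.span_mono ?_) _
  rintro _ ⟨u, hu, hl, hx⟩
  exact ⟨u, hu, by omega, hx⟩

lemma heckeT_mem_lengthFilt {u : P.weylGroup} (hu : u ∈ minReps b J) {m : ℕ}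
    (h : length₀ b u < m) : heckeT b k (fin u) ∈ lengthFilt k s J δ m :=
  Submodule.mem_sup_left (Submodule.subset_span ⟨u, hu, h, rfl⟩)

lemma eigenIdeal_mem_lengthFilt {x : Hecke b k} (hx : x ∈ eigenIdeal k s J δ) (m : ℕ) :
    x ∈ lengthFilt k s J δ m := Submodule.mem_sup_right hx

lemma lengthFilt_induction {m : ℕ} {p : Hecke b k → Prop}
    (h1 : ∀ u ∈ minReps b J, length₀ b u < m → p (heckeT b k (fin u)))
    (h2 : ∀ x ∈ eigenIdeal k s J δ, p x) (ha : ∀ x y, p x → p y → p (x + y))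
    (hs : ∀ (c : ℂ) x, p x → p (c • x)) {x : Hecke b k} (hx : x ∈ lengthFilt k s J δ m) : p x := by
  obtain ⟨y, hy, z, hz, rfl⟩ := Submodule.mem_sup.1 hx
  refine ha _ _ ?_ (h2 z hz)
  clear hx
  induction hy using Submodule.span_induction with
  | mem x h => obtain ⟨u, hu, hl, rfl⟩ := h; exact h1 u hu hl
  | zero => exact h2 0 (zero_mem _)
  | add x y _ _ hx hy => exact ha _ _ hx hy
  | smul c x _ hx => exact hs _ _ hx

lemma simple_mul_mem_lengthFilt (i : b.support) {m : ℕ} {x : Hecke b k}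
    (hx : x ∈ lengthFilt k s J δ m) :
    heckeT b k (simpleRefl b (some i)) * x ∈ lengthFilt k s J δ (m + 1) := by
  refine lengthFilt_induction (p := fun x => heckeT b k (simpleRefl b (some i)) * x ∈
    lengthFilt k s J δ (m + 1)) (fun u hu hl => ?_) (fun x hx => ?_) (fun x y hx hy => ?_)
    (fun c x hx => ?_) hx
  · rcases mem_minReps_or_exists hu i with h | ⟨j, hj, hji⟩
    · by_cases hp : b.IsPos (u⁻¹ • (i : ι))
      · rw [heckeT_simpleRefl₀_mul b k hp]
        exact heckeT_mem_lengthFilt h (by rw [length₀_simpleRefl₀_mul b hp]; omega)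
      · rw [heckeT_simpleRefl₀_mul_of_neg b k hp]
        refine add_mem (Submodule.smul_mem _ _ (heckeT_mem_lengthFilt hu (by omega)))
          (heckeT_mem_lengthFilt h ?_)
        have := length₀_simpleRefl₀_mul_of_neg b hp
        omega
    · rw [heckeT_simple_mul_of_smul_eq k hji]
      have h1 := add_mem (eigenIdeal_mem_lengthFilt (mul_simple_sub_mem_eigenIdeal (s := s) (δ := δ)
        (heckeT b k (fin u)) hj) (m + 1)) (Submodule.smul_mem _ (epsScalar k s ((j : ι), 0))
          (heckeT_mem_lengthFilt hu (show _ < m + 1 by omega)))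
      rwa [sub_add_cancel] at h1
  · exact eigenIdeal_mem_lengthFilt (Submodule.smul_mem _ (heckeT b k _) hx) _
  · rw [mul_add]; exact add_mem hx hy
  · rw [mul_smul_comm]; exact Submodule.smul_mem _ _ hx

/-- Passing `f(Y)` through the leftmost `T_i` replaces `f` by `s_i f`, which accounts for the
eigenvalue `f(wδ)`; the correction involves only shorter elements. -/
lemma fYHom_mul_heckeT_sub_mem (w : P.weylGroup) (hw : w ∈ minReps b J) (f : Reg P) :
    fYHom b k f * heckeT b k (fin w) - evalAt (torusAct w δ) f • heckeT b k (fin w) ∈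
      lengthFilt k s J δ (length₀ b w) := by
  induction w using weyl_induction b generalizing f with
  | h0 =>
    rw [torusAct_one, fin_one, heckeT_one, mul_one]
    refine eigenIdeal_mem_lengthFilt ?_ _
    simpa using mul_fYHom_sub_mem_eigenIdeal (k := k) (s := s) (J := J) (δ := δ) 1 f
  | h1 i w hi ih =>
    have hw' := mem_minReps_of_mul hi hw
    obtain ⟨g, -, h2⟩ := bernstein b k i (regW (simpleRefl₀ b i) f)
    rw [← regW_mul, simpleRefl₀_mul_self, regW_one] at h2
    set f' := regW (simpleRefl₀ b i) f with hf'
    have h3 : evalAt (torusAct (simpleRefl₀ b i * w) δ) f = evalAt (torusAct w δ) f' := by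
      rw [torusAct_mul, evalAt_torusAct, simpleRefl₀_inv]
    rw [← heckeT_simpleRefl₀_mul b k hi, length₀_simpleRefl₀_mul b hi, h3]
    set T := heckeT b k (simpleRefl b (some i))
    have h4 : fYHom b k f * (T * heckeT b k (fin w)) -
        evalAt (torusAct w δ) f' • (T * heckeT b k (fin w)) =
        T * (fYHom b k f' * heckeT b k (fin w) - evalAt (torusAct w δ) f' • heckeT b k (fin w)) -
        hParam k ((i : ι), 0) • ((fYHom b k g * heckeT b k (fin w) -
          evalAt (torusAct w δ) g • heckeT b k (fin w)) +
            evalAt (torusAct w δ) g • heckeT b k (fin w)) := by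
      rw [sub_add_cancel, mul_sub, ← mul_assoc T, h2, add_mul, smul_mul_assoc, mul_smul_comm,
        mul_assoc]
      abel
    rw [h4]
    refine sub_mem (simple_mul_mem_lengthFilt i (ih hw' f')) (Submodule.smul_mem _ _ (add_mem
      (lengthFilt_mono (by omega) (ih hw' g))
      (Submodule.smul_mem _ _ (heckeT_mem_lengthFilt hw' (by omega)))))

/-- The eigenvalues of `p(Y)` at nontrivial `u` vanish, so it lowers the filtration by one step
until only scalars modulo the ideal remain. -/
lemma fYHom_mul_mem_lengthFilt {p : Reg P}
    (hp : ∀ u ∈ minReps b J, u ≠ 1 → evalAt (torusAct u δ) p = 0) {m : ℕ} {x : Hecke b k}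
    (hx : x ∈ lengthFilt k s J δ (m + 2)) : fYHom b k p * x ∈ lengthFilt k s J δ (m + 1) := by
  refine lengthFilt_induction (p := fun x => fYHom b k p * x ∈
    lengthFilt k s J δ (m + 1)) (fun u hu hl => ?_) (fun x hx => ?_) (fun x y hx hy => ?_)
    (fun c x hx => ?_) hx
  · have h1 := fYHom_mul_heckeT_sub_mem (k := k) (s := s) (δ := δ) u hu p
    by_cases hu1 : u = 1
    · subst hu1
      have h2 := add_mem (lengthFilt_mono (show _ ≤ m + 1 by rw [length₀_one]; omega) h1)
        (Submodule.smul_mem _ (evalAt (torusAct 1 δ) p)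
          (heckeT_mem_lengthFilt hu (show _ < m + 1 by rw [length₀_one]; omega)))
      rwa [sub_add_cancel] at h2
    · rw [hp u hu hu1, zero_smul, sub_zero] at h1
      exact lengthFilt_mono (by omega) h1
  · exact eigenIdeal_mem_lengthFilt (Submodule.smul_mem _ (fYHom b k p) hx) _
  · rw [mul_add]; exact add_mem hx hy
  · rw [mul_smul_comm]; exact Submodule.smul_mem _ _ hx

lemma exists_pow_mul_symmetrizer_sub_mem {p : Reg P}
    (hp : ∀ u ∈ minReps b J, u ≠ 1 → evalAt (torusAct u δ) p = 0) :
    ∃ (n : ℕ) (c : ℂ), n ≠ 0 ∧ fYHom b k (p ^ n) * symmetrizer b k J s - algebraMap ℂ _ c ∈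
      eigenIdeal k s J δ := by
  obtain ⟨u₀, hu₀⟩ := Finite.exists_max (length₀ b)
  have h1 : symmetrizer b k J s ∈ lengthFilt k s J δ (length₀ b u₀ + 1 + 1) := by
    rw [symmetrizer_eq_sum]
    refine sum_mem fun w hw => Submodule.smul_mem _ _ (heckeT_mem_lengthFilt ?_ ?_)
    · simpa using hw
    · have := hu₀ w; omega
  have h2 : ∀ (n : ℕ) (x : Hecke b k), x ∈ lengthFilt k s J δ (n + 1) →
      fYHom b k (p ^ n) * x ∈ lengthFilt k s J δ 1 := by
    intro n
    induction n with
    | zero => intro x hx; rwa [pow_zero, map_one, one_mul]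
    | succ n ih =>
      intro x hx
      rw [pow_succ, map_mul, mul_assoc]
      exact ih _ (fYHom_mul_mem_lengthFilt hp hx)
  refine ⟨length₀ b u₀ + 1, ?_⟩
  have h3 : ∀ x ∈ lengthFilt k s J δ 1, ∃ c : ℂ, x - algebraMap ℂ _ c ∈ eigenIdeal k s J δ := by
    intro x hx
    refine lengthFilt_induction (p := fun x => ∃ c : ℂ, x - algebraMap ℂ _ c ∈
      eigenIdeal k s J δ) (fun u hu hl => ?_) (fun x hx => ⟨0, by simpa using hx⟩) ?_ ?_ hx
    · have hu1 := (length₀_eq_zero_iff b).1 (Nat.lt_one_iff.1 hl)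
      exact ⟨1, by simp [hu1, heckeT_one]⟩
    · rintro x y ⟨c, hc⟩ ⟨d, hd⟩
      refine ⟨c + d, ?_⟩
      rw [map_add, add_sub_add_comm]
      exact add_mem hc hd
    · rintro a x ⟨c, hc⟩
      refine ⟨a * c, ?_⟩
      rw [map_mul, ← Algebra.smul_def, ← smul_sub]
      exact Submodule.smul_of_tower_mem _ a hc
  obtain ⟨c, hc⟩ := h3 _ (h2 _ _ h1)
  exact ⟨c, by omega, hc⟩

variable (k) in
/-- The dual of `H(k)`, as a left module through right multiplication. -/
def dualRep : Hecke b k →ₐ[ℂ] Module.End ℂ (Module.Dual ℂ (Hecke b k)) :=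
  AlgHom.ofLinearMap
    { toFun := fun h => LinearMap.lcomp ℂ ℂ (LinearMap.mulRight ℂ h)
      map_add' := fun x y => by ext ξ z; simp [mul_add]
      map_smul' := fun c x => by ext ξ z; simp }
    (by ext ξ z; simp) fun x y => by ext ξ z; simp [mul_assoc]

@[simp] lemma dualRep_apply (h x : Hecke b k) (ξ : Module.Dual ℂ (Hecke b k)) :
    dualRep k h ξ x = ξ (x * h) := rfl

/-- In the universal module the symmetrizer does not kill the eigenvector; more precisely
`f(Y) C^J` does not, if `f` is nonzero at the eigenvalue. -/
lemma fYHom_mul_symmetrizer_notMem (q : QParam b)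
    (hδ : ∀ j ∈ J, tpow δ (corootCowt (j : ι)) = epsScalar k s ((j : ι), 0) ^ 2)
    (hne : ∀ i, b.IsPos i → i ∉ parabolicRoots b J →
      tpow δ (corootCowt i) ≠ (epsScalar k s (i, 0) ^ 2)⁻¹)
    {t : P.weylGroup} (ht : t ∈ minReps b J)
    (ht' : ∀ i, b.IsPos i → i ∉ parabolicRoots b J → ¬ b.IsPos (t • i))
    {f : Reg P} (hf : evalAt δ f ≠ 0) :
    fYHom b k f * symmetrizer b k J s ∉ eigenIdeal k s J δ := by
  classical
  intro hmem
  -- An element of `W_0^J` inverts only roots off `R_0^J`, and `t` inverts all positive ones there.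
  have hmax : ∀ u ∈ minReps b J, length₀ b u ≤ length₀ b t := by
    intro u hu
    refine Set.ncard_le_ncard ?_ (Set.toFinite _)
    rintro i ⟨h1, h2⟩
    refine ⟨h1, ht' i h1 fun h3 => h2 (isPos_smul_of_mem_parabolicRoots b hu h3 h1)⟩
  -- The functional is concentrated on the coset `t W_{0,J}`, with the character `ε` along it. On
  -- `W_0^J` it is therefore the indicator of the longest element `t`.
  let n : P.weylGroup → ℂ := fun w =>
    if t⁻¹ * w ∈ parabolic b J then eps b k s (heckeT b k (fin (t⁻¹ * w))) else 0
  have hn : ∀ w, ∀ j ∈ J, b.IsPos (w • (j : ι)) →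
      n (w * simpleRefl₀ b j) = epsScalar k s ((j : ι), 0) * n w := by
    intro w j hj hp
    have hjm : simpleRefl₀ b j ∈ parabolic b J := Subgroup.subset_closure ⟨j, hj, rfl⟩
    simp only [n]
    rw [← mul_assoc, Subgroup.mul_mem_cancel_right _ hjm]
    split_ifs with hx
    · have h1 : b.IsPos ((t⁻¹ * w) • (j : ι)) := by
        rw [← isPos_smul_iff_of_mem ht ((smul_mem_parabolicRoots_iff hx _).2
          (mem_parabolicRoots_of_mem hj)), ← mul_smul, mul_inv_cancel_left]
        exact hp
      rw [← heckeT_mul_simpleRefl₀ b k h1, map_mul, eps_simple, mul_comm]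
    · rw [mul_zero]
  obtain ⟨θ, hθ1, hθ2, hθ3⟩ := exists_eigenfunctional b k q J
    (fun j => epsScalar k s ((j : ι), 0)) (fun j => epsScalar_ne_zero k s _)
    (fun j => hParam_eq k s _) δ hδ n hn
  have hθ4 : ∀ u ∈ minReps b J, u ≠ t → θ (heckeT b k (fin u)) = 0 := by
    intro u hu hut
    rw [hθ1]
    exact if_neg fun h => hut (eq_of_mem_minReps hu ht h)
  have hθ5 : θ (heckeT b k (fin t)) = 1 := by
    rw [hθ1]
    simp [n, heckeT_one]
  have hsph : θ ∈ spherical (dualRep k) J s := by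
    rw [mem_spherical_iff]
    intro j hj
    ext x
    exact hθ3 x j hj
  have hwt : θ ∈ weightSpace (dualRep k) δ := by
    rw [mem_weightSpace_iff]
    intro f
    ext x
    exact hθ2 x f
  have hφ := symmetrizer_mem_spherical hsph
  -- If the ideal contained `f(Y) C^J`, then `f(Y)` would kill the spherical vector `C^J θ`; the
  -- intertwiners carry this from `δ` to `tδ`.
  have hann := apply_eq_zero_of_mem_eigenIdeal hsph hwt hmem
  rw [map_mul, Module.End.mul_apply] at hann
  obtain ⟨F, hF1, hF2⟩ := exists_annihilator hφ hne ⟨f, hann, hf⟩ t ht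
  have hfilt : ∀ x ∈ lengthFilt k s J δ (length₀ b t), θ x = 0 := by
    intro x hx
    refine lengthFilt_induction (p := fun x => θ x = 0) (fun u hu hl => ?_) (fun x hx => ?_)
      (fun x y hx hy => by rw [map_add, hx, hy, add_zero])
      (fun c x hx => by rw [map_smul, hx, smul_zero]) hx
    · exact hθ4 u hu fun h => by rw [h] at hl; exact lt_irrefl _ hl
    · have := congrArg (fun ξ : Module.Dual ℂ (Hecke b k) => ξ 1)
        (apply_eq_zero_of_mem_eigenIdeal hsph hwt hx)
      simpa using this
  have hval : ∀ u ∈ minReps b J, θ (fYHom b k F * heckeT b k (fin u)) =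
      if u = t then evalAt (torusAct t δ) F else 0 := by
    intro u hu
    have h1 := hfilt _ (lengthFilt_mono (hmax u hu)
      (fYHom_mul_heckeT_sub_mem (k := k) (s := s) (δ := δ) u hu F))
    rw [map_sub, map_smul, sub_eq_zero] at h1
    rw [h1]
    split_ifs with h
    · rw [h, hθ5, smul_eq_mul, mul_one]
    · rw [hθ4 u hu h, smul_zero]
  -- At `1` the relation reads `θ(F(Y) C^J) = 0`. By triangularity only the term of `t` survives,
  -- with value `ε(T_t) F(tδ) ≠ 0`.
  have hzero := congrArg (fun ξ : Module.Dual ℂ (Hecke b k) => ξ 1) hF1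
  simp only [dualRep_apply, one_mul, LinearMap.zero_apply] at hzero
  rw [symmetrizer_eq_sum, Finset.mul_sum, map_sum, Finset.sum_eq_single t] at hzero
  · rw [mul_smul_comm, map_smul, hval t ht, if_pos rfl] at hzero
    exact smul_ne_zero (eps_heckeT_ne_zero b k s _) hF2 hzero
  · intro u hu hut
    rw [mul_smul_comm, map_smul, hval u (by simpa using hu), if_neg hut, smul_zero]
  · intro h
    exact absurd (by simpa using ht) h

end Universal

/-! ### Interpolation on the orbit and inversion of the symmetrizer -/

section Interpolation

variable {P : RootPairing ι ℝ M N} [P.IsCrystallographic] {b : P.Base} [Fintype ι] [Nonempty ι]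
  [P.IsReduced] [P.IsIrreducible] {k : Mult P} {s : ℤˣ}

lemma exists_separating (δ : Torus P) (S : Finset (Torus P)) (h : δ ∉ S) :
    ∃ p : Reg P, evalAt δ p = 1 ∧ ∀ t ∈ S, evalAt t p = 0 := by
  classical
  induction S using Finset.induction_on with
  | empty => exact ⟨1, map_one _, by simp⟩
  | insert t S ht ih =>
    rw [Finset.mem_insert, not_or] at h
    obtain ⟨p, hp1, hp2⟩ := ih h.2
    obtain ⟨x, hx⟩ : ∃ x, tpow δ x ≠ tpow t x := by
      by_contra! hcon
      exact h.1 (tpow_ext hcon)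
    refine ⟨(tpow δ x - tpow t x)⁻¹ • (rexp x - algebraMap ℂ _ (tpow t x)) * p, ?_, ?_⟩
    · rw [map_mul, map_smul, map_sub, evalAt_rexp, AlgHom.commutes, hp1, mul_one]
      exact inv_mul_cancel₀ (sub_ne_zero.2 hx)
    · intro t' ht'
      rcases Finset.mem_insert.1 ht' with rfl | ht'
      · rw [map_mul, map_smul, map_sub, evalAt_rexp, AlgHom.commutes]
        simp
      · rw [map_mul, hp2 t' ht', mul_zero]

/-- Regularity separates `δ` from the other `uδ`, so a suitable power of a separating function
carries `C^J` to a scalar modulo the ideal. The scalar is nonzero because `f(Y) C^J` avoids the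
ideal when `f(δ) ≠ 0`. As both are found in the algebra, they serve for every module. -/
lemma exists_inverse_symmetrizer (q : QParam b) {J : Set b.support} {δ : Torus P}
    (hδ : ∀ j ∈ J, tpow δ (corootCowt (j : ι)) = epsScalar k s ((j : ι), 0) ^ 2)
    (hne : ∀ i, b.IsPos i → i ∉ parabolicRoots b J →
      tpow δ (corootCowt i) ≠ (epsScalar k s (i, 0) ^ 2)⁻¹ ∧ tpow δ (corootCowt i) ≠ 1)
    {t : P.weylGroup} (ht : t ∈ minReps b J)
    (ht' : ∀ i, b.IsPos i → i ∉ parabolicRoots b J → ¬ b.IsPos (t • i)) :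
    ∃ (p : Reg P) (c : ℂ), c ≠ 0 ∧ evalAt δ p = 1 ∧
      (∀ u ∈ minReps b J, u ≠ 1 → evalAt (torusAct u δ) p = 0) ∧
      fYHom b k p * symmetrizer b k J s - algebraMap ℂ _ c ∈ eigenIdeal k s J δ := by
  classical
  obtain ⟨p, hp1, hp2⟩ := exists_separating δ
    (((Set.toFinite (minReps b J)).toFinset.erase 1).image fun u => torusAct u δ) (by
      intro h
      obtain ⟨u, hu, hu'⟩ := Finset.mem_image.1 h
      rw [Finset.mem_erase, Set.Finite.mem_toFinset] at hu
      exact hu.1 (eq_one_of_torusAct_eq b hu.2 hu' fun i hi hi' => (hne i hi hi').2))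
  have hp3 : ∀ u ∈ minReps b J, u ≠ 1 → evalAt (torusAct u δ) p = 0 := fun u hu hu1 =>
    hp2 _ (Finset.mem_image_of_mem _ (Finset.mem_erase.2 ⟨hu1, by simpa using hu⟩))
  obtain ⟨n, c, hn, hc⟩ := exists_pow_mul_symmetrizer_sub_mem (k := k) (s := s) hp3
  refine ⟨p ^ n, c, ?_, by rw [map_pow, hp1, one_pow], fun u hu hu1 => ?_, hc⟩
  · rintro rfl
    rw [map_zero, sub_zero] at hc
    exact fYHom_mul_symmetrizer_notMem q hδ (fun i hi hi' => (hne i hi hi').1) ht ht'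
      (by rw [map_pow, hp1, one_pow]; exact one_ne_zero) hc
  · rw [map_pow, hp3 u hu hu1, zero_pow hn]

variable {L : Type*} [AddCommGroup L] [Module ℂ L] {ρ : Hecke b k →ₐ[ℂ] Module.End ℂ L}

lemma fYHom_mul_symmetrizer_apply {J : Set b.support} {δ : Torus P} {p : Reg P} {c : ℂ}
    (h : fYHom b k p * symmetrizer b k J s - algebraMap ℂ _ c ∈ eigenIdeal k s J δ) {v : L}
    (hv : v ∈ spherical ρ J s) (hv' : v ∈ weightSpace ρ δ) :
    ρ (fYHom b k p) (ρ (symmetrizer b k J s) v) = c • v := by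
  have h1 := apply_eq_zero_of_mem_eigenIdeal hv hv' h
  rw [map_sub, map_mul, LinearMap.sub_apply, Module.End.mul_apply, sub_eq_zero] at h1
  rw [h1, AlgHom.commutes]
  rfl

/-- The symmetrizer is injective on `L^{J,±}[δ]`. -/
theorem injOn_symmetrizer (q : QParam b) {J : Set b.support} {δ : Torus P}
    (hδ : ∀ j ∈ J, tpow δ (corootCowt (j : ι)) = epsScalar k s ((j : ι), 0) ^ 2)
    (hne : ∀ i, b.IsPos i → i ∉ parabolicRoots b J →
      tpow δ (corootCowt i) ≠ (epsScalar k s (i, 0) ^ 2)⁻¹ ∧ tpow δ (corootCowt i) ≠ 1)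
    {t : P.weylGroup} (ht : t ∈ minReps b J)
    (ht' : ∀ i, b.IsPos i → i ∉ parabolicRoots b J → ¬ b.IsPos (t • i)) :
    Set.InjOn (ρ (symmetrizer b k J s)) (spherical ρ J s ⊓ weightSpace ρ δ : Submodule ℂ L) := by
  obtain ⟨p, c, hc, -, -, h⟩ := exists_inverse_symmetrizer (k := k) (s := s) q hδ hne ht ht'
  intro v hv v' hv' heq
  have h1 := fYHom_mul_symmetrizer_apply h hv.1 hv.2
  rw [heq, fYHom_mul_symmetrizer_apply h hv'.1 hv'.2] at h1
  exact (smul_right_injective L hc h1).symm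

lemma mapsTo_symmetrizer (J : Set b.support) (δ : Torus P) :
    Set.MapsTo (ρ (symmetrizer b k J s)) (spherical ρ J s ⊓ weightSpace ρ δ : Submodule ℂ L)
      (centralSpace ρ δ ⊓ spherical ρ Set.univ s : Submodule ℂ L) := fun _ hv =>
  ⟨symmetrizer_mem_centralSpace hv.2, symmetrizer_mem_spherical hv.1⟩

lemma fYHom_apply_mem_centralSpace {δ : Torus P} {x : L} (hx : x ∈ centralSpace ρ δ) (f : Reg P) :
    ρ (fYHom b k f) x ∈ centralSpace ρ δ := by
  rw [mem_centralSpace_iff] at hx ⊢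
  intro g hg
  rw [← Module.End.mul_apply, ← map_mul, ← map_mul, mul_comm, map_mul, map_mul,
    Module.End.mul_apply, hx g hg, map_smul]

lemma fYHom_apply_mul (f g : Reg P) (x : L) :
    ρ (fYHom b k (f * g)) x = ρ (fYHom b k f) (ρ (fYHom b k g) x) := by
  rw [map_mul, map_mul, Module.End.mul_apply]

lemma exists_orbit_separating {δ : Torus P} (hfree : ∀ w : P.weylGroup, torusAct w δ = δ → w = 1)
    (w : P.weylGroup) : ∃ p : Reg P, evalAt (torusAct w δ) p = 1 ∧
      ∀ u, u ≠ w → evalAt (torusAct u δ) p = 0 := by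
  classical
  have := Fintype.ofFinite P.weylGroup
  obtain ⟨p, hp1, hp2⟩ := exists_separating (torusAct w δ)
    ((Finset.univ.erase w).image fun u => torusAct u δ) (by
      intro h
      obtain ⟨u, hu, hu'⟩ := Finset.mem_image.1 h
      apply (Finset.mem_erase.1 hu).1
      have h1 := hfree (w⁻¹ * u) (by
        rw [torusAct_mul, hu', ← torusAct_mul, inv_mul_cancel, torusAct_one])
      exact (inv_mul_eq_one.1 h1).symm)
  exact ⟨p, hp1, fun u hu => hp2 _ (Finset.mem_image_of_mem _
    (Finset.mem_erase.2 ⟨hu, Finset.mem_univ _⟩))⟩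

/-- Interpolation combines the given functions into one annihilator `D` with no zero on the orbit.
Its norm `∏ w D` is invariant and divisible by `D`, so it acts on `x` both by zero and by a nonzero
scalar. -/
lemma eq_zero_of_annihilator {δ : Torus P} (hfree : ∀ w : P.weylGroup, torusAct w δ = δ → w = 1)
    {x : L} (hx : x ∈ centralSpace ρ δ)
    (h : ∀ w, ∃ f, ρ (fYHom b k f) x = 0 ∧ evalAt (torusAct w δ) f ≠ 0) : x = 0 := by
  classical
  have := Fintype.ofFinite P.weylGroup
  choose f hf1 hf2 using h
  choose p hp1 hp2 using exists_orbit_separating hfree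
  set D : Reg P := ∑ w, p w * f w with hD
  have hD1 : ρ (fYHom b k D) x = 0 := by
    rw [hD, map_sum, map_sum, LinearMap.sum_apply]
    refine Finset.sum_eq_zero fun w _ => ?_
    rw [fYHom_apply_mul, hf1, map_zero]
  have hD2 : ∀ w, evalAt (torusAct w δ) D ≠ 0 := fun w => by
    rw [hD, map_sum, Finset.sum_eq_single w]
    · rw [map_mul, hp1, one_mul]; exact hf2 w
    · intro u _ hu
      rw [map_mul, hp2 u w hu.symm, zero_mul]
    · simp
  set n : Reg P := ∏ w : P.weylGroup, regW w D with hn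
  have hn1 : IsInv n := by
    rw [isInv_iff]
    intro v
    rw [hn, map_prod]
    simp_rw [← regW_mul]
    exact Equiv.prod_comp (Equiv.mulLeft v) fun w => regW w D
  obtain ⟨n', hn'⟩ : D ∣ n := by
    have := Finset.dvd_prod_of_mem (fun w : P.weylGroup => regW w D) (Finset.mem_univ 1)
    rwa [regW_one] at this
  have h1 := (mem_centralSpace_iff.1 hx) n hn1
  rw [hn', mul_comm, fYHom_apply_mul, hD1, map_zero, mul_comm, ← hn'] at h1
  refine (smul_eq_zero.1 h1.symm).resolve_left ?_
  rw [hn, map_prod]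
  refine Finset.prod_ne_zero_iff.2 fun w _ => ?_
  have := hD2 w⁻¹
  rwa [evalAt_torusAct, inv_inv] at this

/-- The polynomial `Q = ∑_v v(F) ∏_{u ≠ v} (X - u(g))` has invariant coefficients, all of which
vanish at `δ` because `F` vanishes on the orbit. They kill `x`, and `Q(g)` is the function in
question. -/
lemma lagrange_annihilates [Fintype P.weylGroup] [DecidableEq P.weylGroup] {δ : Torus P} {x : L}
    (hx : x ∈ centralSpace ρ δ) {F : Reg P}
    (hF : ∀ w, evalAt (torusAct w δ) F = 0) (g : Reg P) :
    ρ (fYHom b k (F * ∏ u ∈ Finset.univ.erase (1 : P.weylGroup), (g - regW u g))) x = 0 := by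
  let Q : Polynomial (Reg P) := ∑ v : P.weylGroup, Polynomial.C (regW v F) *
    ∏ u ∈ Finset.univ.erase v, (Polynomial.X - Polynomial.C (regW u g))
  have hQinv : ∀ z : P.weylGroup, Q.map (regW z).toRingHom = Q := by
    intro z
    simp only [Q, Polynomial.map_sum, Polynomial.map_mul, Polynomial.map_prod, Polynomial.map_sub,
      Polynomial.map_C, Polynomial.map_X, AlgHom.toRingHom_eq_coe, RingHom.coe_coe, ← regW_mul]
    refine Fintype.sum_equiv (Equiv.mulLeft z) _ _ fun v => ?_
    congr 1
    refine Finset.prod_equiv (Equiv.mulLeft z) (fun u => ?_) fun u _ => rfl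
    simp
  have hcoeff : ∀ n, IsInv (Q.coeff n) := fun n => by
    rw [isInv_iff]
    intro z
    conv_rhs => rw [← hQinv z, Polynomial.coeff_map]
    rfl
  have hQ0 : Q.map (evalAt δ).toRingHom = 0 := by
    simp only [Q, Polynomial.map_sum, Polynomial.map_mul]
    refine Finset.sum_eq_zero fun v _ => ?_
    have h1 := hF v⁻¹
    rw [evalAt_torusAct, inv_inv] at h1
    rw [Polynomial.map_C, AlgHom.toRingHom_eq_coe, RingHom.coe_coe, h1, map_zero, zero_mul]
  have hcoeff0 : ∀ n, evalAt δ (Q.coeff n) = 0 := fun n => by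
    have := congrArg (fun R : Polynomial ℂ => R.coeff n) hQ0
    simpa using this
  have hQg : Q.eval g = F * ∏ u ∈ Finset.univ.erase (1 : P.weylGroup), (g - regW u g) := by
    simp only [Q, Polynomial.eval_finsetSum, Polynomial.eval_mul, Polynomial.eval_C,
      Polynomial.eval_prod, Polynomial.eval_sub, Polynomial.eval_X]
    rw [Finset.sum_eq_single 1]
    · rw [regW_one]
    · intro v _ hv
      rw [Finset.prod_eq_zero (Finset.mem_erase.2 ⟨hv.symm, Finset.mem_univ 1⟩), mul_zero]
      rw [regW_one, sub_self]
    · simp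
  rw [← hQg, Polynomial.eval_eq_sum_range, map_sum, map_sum, LinearMap.sum_apply]
  refine Finset.sum_eq_zero fun n _ => ?_
  rw [mul_comm, fYHom_apply_mul, mem_centralSpace_iff.1 hx _ (hcoeff n), hcoeff0, zero_smul,
    map_zero]

/-- On vectors with a regular central character, `f(Y)` only depends on the restriction of `f` to
the orbit. -/
lemma fYHom_apply_eq_zero {δ : Torus P} (hfree : ∀ w : P.weylGroup, torusAct w δ = δ → w = 1)
    {x : L} (hx : x ∈ centralSpace ρ δ) {F : Reg P} (hF : ∀ w, evalAt (torusAct w δ) F = 0) :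
    ρ (fYHom b k F) x = 0 := by
  classical
  have := Fintype.ofFinite P.weylGroup
  refine eq_zero_of_annihilator hfree (fYHom_apply_mem_centralSpace hx F) fun w => ?_
  -- For a function that separates `wδ` from the rest of its orbit, the Lagrange factor takes the
  -- value `1` at `wδ`.
  obtain ⟨p, hp1, hp2⟩ := exists_orbit_separating hfree w
  refine ⟨∏ u ∈ Finset.univ.erase (1 : P.weylGroup), (p - regW u p), ?_, ?_⟩
  · rw [← fYHom_apply_mul, mul_comm]
    exact lagrange_annihilates hx hF p
  · rw [map_prod]
    refine Finset.prod_ne_zero_iff.2 fun u hu => ?_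
    have h1 : evalAt (torusAct w δ) (regW u p) = 0 := by
      have h2 := evalAt_torusAct u⁻¹ (torusAct w δ) p
      rw [inv_inv, ← torusAct_mul] at h2
      rw [← h2]
      refine hp2 _ fun h => (Finset.mem_erase.1 hu).1 ?_
      rwa [mul_eq_right, inv_eq_one] at h
    rw [map_sub, hp1, h1, sub_zero]
    exact one_ne_zero

/-- The symmetrizer is a bijection from a regular weight space onto the spherical vectors with the
corresponding central character. -/
theorem bijOn_symmetrizer (q : QParam b) {δ : Torus P}
    (hne : ∀ i, tpow δ (corootCowt i) ≠ (epsScalar k s (i, 0) ^ 2)⁻¹ ∧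
      tpow δ (corootCowt i) ≠ 1) :
    Set.BijOn (ρ (symmetrizer b k ∅ s)) (weightSpace ρ δ : Submodule ℂ L)
      (centralSpace ρ δ ⊓ spherical ρ Set.univ s : Submodule ℂ L) := by
  have htop : (spherical ρ ∅ s ⊓ weightSpace ρ δ : Submodule ℂ L) = weightSpace ρ δ :=
    inf_eq_right.2 fun v _ => mem_spherical_iff.2 fun j hj => absurd hj (Set.notMem_empty j)
  have hmin : ∀ w : P.weylGroup, w ∈ minReps b ∅ := fun w =>
    (mem_minReps_iff b ∅ w).2 fun j hj => absurd hj (Set.notMem_empty j)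
  have hδ : ∀ j ∈ (∅ : Set b.support), tpow δ (corootCowt (j : ι)) =
      epsScalar k s ((j : ι), 0) ^ 2 := fun j hj => absurd hj (Set.notMem_empty j)
  have hfree : ∀ w : P.weylGroup, torusAct w δ = δ → w = 1 := fun w hw =>
    eq_one_of_torusAct_eq b (hmin w) hw fun i _ _ => (hne i).2
  refine ⟨htop ▸ mapsTo_symmetrizer ∅ δ, htop ▸ injOn_symmetrizer q hδ (fun i _ _ => hne i)
    (hmin (longest b)) fun i hi _ => not_isPos_longest_smul hi, ?_⟩
  obtain ⟨p, c, hc, hp1, hp2, h⟩ := exists_inverse_symmetrizer (k := k) (s := s) q hδ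
    (fun i _ _ => hne i) (hmin (longest b)) fun i hi _ => not_isPos_longest_smul hi
  rintro φ ⟨hφ1, hφ2⟩
  set v := ρ (fYHom b k p) φ with hv
  have hvw : v ∈ weightSpace ρ δ := by
    rw [mem_weightSpace_iff]
    intro f
    have h1 : ρ (fYHom b k ((f - algebraMap ℂ _ (evalAt δ f)) * p)) φ = 0 := by
      refine fYHom_apply_eq_zero hfree hφ1 fun w => ?_
      by_cases hw : w = 1
      · rw [hw, torusAct_one, map_mul, map_sub, AlgHom.commutes]
        simp
      · rw [map_mul, hp2 w (hmin w) hw, mul_zero]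
    rw [fYHom_apply_mul, ← hv, map_sub, map_sub, LinearMap.sub_apply, sub_eq_zero] at h1
    rw [h1, AlgHom.commutes, AlgHom.commutes]
    rfl
  have hvw' : v ∈ (spherical ρ ∅ s ⊓ weightSpace ρ δ : Submodule ℂ L) := by rw [htop]; exact hvw
  -- The candidate preimage. The difference `ψ` is spherical, has the right central character and is
  -- killed by `p(Y)`; as `p(δ) ≠ 0`, the intertwiners supply annihilators nonzero at every point of
  -- the orbit.
  refine ⟨c⁻¹ • v, Submodule.smul_mem _ _ hvw, ?_⟩
  set ψ := φ - c⁻¹ • ρ (symmetrizer b k ∅ s) v with hψ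
  have hCv := mapsTo_symmetrizer (ρ := ρ) (s := s) ∅ δ hvw'
  have hψ1 : ψ ∈ centralSpace ρ δ := sub_mem hφ1 (Submodule.smul_mem _ _ hCv.1)
  have hψ2 : ψ ∈ spherical ρ Set.univ s := sub_mem hφ2 (Submodule.smul_mem _ _ hCv.2)
  have hψ3 : ρ (fYHom b k p) ψ = 0 := by
    rw [hψ, map_sub, map_smul, fYHom_mul_symmetrizer_apply h hvw'.1 hvw'.2, smul_smul,
      inv_mul_cancel₀ hc, one_smul, ← hv, sub_self]
  have hψ0 : ψ = 0 := eq_zero_of_annihilator hfree hψ1 fun w =>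
    exists_annihilator (J := ∅) hψ2 (fun i _ _ => (hne i).1)
      ⟨p, hψ3, by rw [hp1]; exact one_ne_zero⟩ w (hmin w)
  rw [map_smul]
  exact (sub_eq_zero.1 hψ0).symm

lemma epsScalar_inv_sq (k : Mult P) (s : ℤˣ) (a : AffRoot ι) :
    epsScalar k⁻¹ s a ^ 2 = (((k ^ (s : ℤ)).1 a : ℂ) ^ 2)⁻¹ := by
  rcases Int.units_eq_one_or s with rfl | rfl <;> simp [epsScalar]

lemma tpow_inv (t : Torus P) (x : Cowt P) : tpow t⁻¹ x = (tpow t x)⁻¹ := by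
  simp [tpow]

lemma tpow_torusAct_inv (w : P.weylGroup) (γ : Torus P) (i : ι) :
    tpow (torusAct w γ⁻¹) (corootCowt i) = (tpow γ (corootCowt (w⁻¹ • i)))⁻¹ := by
  rw [tpow_torusAct, tpow_inv, smul_corootCowt]

lemma epsScalar_negIndex (k : Mult P) (s : ℤˣ) (i : ι) :
    epsScalar k s (P.reflectionPerm i i, 0) = epsScalar k s (i, 0) := by
  rw [← ofIdx_smul_index, epsScalar_smul]

end Interpolation

end AffHecke

end

/-! ### The main theorem -/

open AffHecke in
theorem mainTheorem4 {ι M N : Type*} [Fintype ι] [Nonempty ι]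
    [AddCommGroup M] [Module ℝ M] [AddCommGroup N] [Module ℝ N]
    (P : RootPairing ι ℝ M N) [P.IsCrystallographic] [P.IsReduced] [P.IsIrreducible]
    (b : P.Base) (k : Mult P) (q : QParam b)
    (L : Type*) [AddCommGroup L] [Module ℂ L] [Module (diffAlg q k) L]
    [IsScalarTower ℂ (diffAlg q k) L] :
    (∃! π : Hecke b k⁻¹ →ₐ[ℂ] diffAlg q k, IsCherednikHom q k k⁻¹ π) ∧
    ∀ π : Hecke b k⁻¹ →ₐ[ℂ] diffAlg q k, IsCherednikHom q k k⁻¹ π → ∀ s : ℤˣ,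
      (∀ (I : Set b.support), ∀ γ ∈ TIreg b (k ^ (s : ℤ)) I,
        Set.MapsTo (pull π L (symmetrizer b k⁻¹ (dualSet b I) s))
          (spherical (pull π L) (dualSet b I) s ⊓
            weightSpace (pull π L) (torusAct (minRep b I (longest b)) γ⁻¹) : Submodule ℂ L)
          (centralSpace (pull π L) γ⁻¹ ⊓ spherical (pull π L) Set.univ s : Submodule ℂ L) ∧
        Set.InjOn (pull π L (symmetrizer b k⁻¹ (dualSet b I) s))
          (spherical (pull π L) (dualSet b I) s ⊓
            weightSpace (pull π L) (torusAct (minRep b I (longest b)) γ⁻¹) : Submodule ℂ L)) ∧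
      (∀ γ : Torus P,
        (∀ i, tpow γ (corootCowt i) ≠ (k.1 (i, 0) : ℂ) ^ 2 ∧ tpow γ (corootCowt i) ≠ 1) →
        Set.BijOn (pull π L (symmetrizer b k⁻¹ ∅ s))
          (weightSpace (pull π L) (torusAct (longest b) γ⁻¹))
          (centralSpace (pull π L) γ⁻¹ ⊓ spherical (pull π L) Set.univ s : Submodule ℂ L)) := by
  refine ⟨existsUnique_cherednikHom q k, fun π _ s => ⟨fun I γ hγ => ?_, fun γ hγ => ?_⟩⟩
  · set t := minRep b I (longest b) with ht
    have hδ : ∀ j ∈ dualSet b I, tpow (torusAct t γ⁻¹) (corootCowt (j : ι)) =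
        epsScalar k⁻¹ s ((j : ι), 0) ^ 2 := by
      rintro j ⟨i, hi, hij⟩
      rw [tpow_torusAct_inv, ← hij, inv_smul_smul, hγ.1 i hi, epsScalar_smul, epsScalar_inv_sq]
    have hne : ∀ i, b.IsPos i → i ∉ parabolicRoots b (dualSet b I) →
        tpow (torusAct t γ⁻¹) (corootCowt i) ≠ (epsScalar k⁻¹ s (i, 0) ^ 2)⁻¹ ∧
          tpow (torusAct t γ⁻¹) (corootCowt i) ≠ 1 := by
      intro i hi hi'
      obtain ⟨h1, h2⟩ := minRep_longest_inv_smul hi hi'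
      -- Regularity of `γ` is applied to the root `-w̄_0⁻¹ α_i`, which is positive and outside
      -- `R_0^I`; the sign absorbs the inverse in `γ⁻¹`.
      have h3 := hγ.2 _ ((isPos_negIndex b _).2 h1) (mt negIndex_mem_parabolicRoots.1 h2)
      rw [corootCowt_negIndex, tpow_neg, ← ht] at h3
      rw [tpow_torusAct_inv]
      refine ⟨?_, h3.2⟩
      have h4 := h3.1
      rwa [← inv_inv (((k ^ (s : ℤ)).1 _ : ℂ) ^ 2), ← epsScalar_inv_sq, epsScalar_negIndex,
        epsScalar_smul] at h4
    refine ⟨?_, injOn_symmetrizer q hδ hne (minRep_longest_inv_mem I)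
      fun i hi hi' => (minRep_longest_inv_smul hi hi').1⟩
    rw [← centralSpace_torusAct t]
    exact mapsTo_symmetrizer _ _
  · rw [← centralSpace_torusAct (longest b)]
    refine bijOn_symmetrizer q fun i => ?_
    rw [tpow_torusAct_inv, epsScalar_inv_sq, inv_inv]
    have hk : ∀ w : P.weylGroup, k.1 (w • i, 0) = k.1 (i, 0) := fun w => by
      have := k.2 (fin w) (i, 0)
      rwa [act_fin] at this
    set j := (longest b)⁻¹ • i with hj
    refine ⟨?_, fun h => (hγ j).2 (inv_eq_one.1 h)⟩
    -- The hypothesis on `γ` is symmetric under `α ↦ -α`: the sign `+` uses it at `-α_j`, the sign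
    -- `-` at `α_j`.
    rcases Int.units_eq_one_or s with rfl | rfl
    · have h1 := (hγ (P.reflectionPerm j j)).1
      rw [corootCowt_negIndex, tpow_neg, ← ofIdx_smul_index, hj, ← mul_smul, hk] at h1
      simpa using h1
    · have h1 := (hγ j).1
      rw [hj, hk] at h1
      intro h2
      apply h1
      rw [← hj, ← inv_inv (tpow γ _), h2]
      simp
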